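/- Let $M$ be a compact smooth Riemannian manifold (without boundary) of dimension $n\ge 1$, and let $x:M\to\mathbb R^N$ be an isometric embedding with second fundamental form $\mathrm{II}$, mean curvature vector $\mathbf H=\operatorname{tr}\mathrm{II}$ and mean curvature function $H=\frac1n|\mathbf H|$. Let $S$ be a (real or complex) Dirac bundle over $M$: a smooth bundle of left modules over the Clifford bundle $Cl(M)$ (with $v\cdot v=-|v|^2$ for tangent vectors $v$), with a smooth Riemannian (resp. Hermitian) fibre metric $\langle\cdot,\cdot\rangle$ and a smooth metric connection $\nabla$ such that $$\langle v\cdot\sigma_1,\sigma_2\rangle+\langle\sigma_1,v\cdot\sigma_2\rangle=0\quad\text{for tangent vectors } v,\qquad \nabla(\varphi\cdot\sigma)=(\nabla\varphi)\cdot\sigma+\varphi\cdot\nabla\sigma\quad\text{for }\varphi\in\Gamma(Cl(M)),\ \sigma\in\Gamma(S),$$ where $Cl(M)$ carries the connection induced by the Levi-Civita connection; in the complex case Clifford multiplication and $\nabla$ are complex linear. Let $D=\sum_i e_i\cdot\nabla_{e_i}$ be its Dirac operator and $$\mathfrak R=\sum_{i<j}e_i\cdot e_j\cdot\big([\nabla_{e_i},\nabla_{e_j}]-\nabla_{[e_i,e_j]}\big)$$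 the curvature term of the Bochner identity $D^2=\nabla^*\nabla+\mathfrak R$, where $(e_i)$ is a local orthonormal frame of $TM$. Let $\{\lambda_j;\varphi_j\}_{j\ge1}$ be a spectral resolution of $D^2$: $(\varphi_j)$ is an orthonormal basis of $L^2(S)$ consisting of smooth sections with $D^2\varphi_j=\lambda_j\varphi_j$ and $\lambda_1\le\lambda_2\le\cdots$. Write $(\sigma,\tau)=\operatorname{Re}\int_M\langle\sigma,\tau\rangle$, the integral being taken with respect to the Riemannian volume. Then, for every $k\ge1$, $$\sum_{i=1}^k(\lambda_{k+1}-\lambda_i)^2\le\frac4n\sum_{i=1}^k(\lambda_{k+1}-\lambda_i)\Big(\lambda_i+\tfrac14\big(n^2(H^2\varphi_i,\varphi_i)-4(\mathfrak R\varphi_i,\varphi_i)\big)\Big).$$ Moreover, if $k\ge1$ and $R\in\mathbb R$ are such that $(\mathfrak R\varphi_i,\varphi_i)\ge R$ for $i=1,\dots,k$, then the numbers $\eta_i=\lambda_i+\frac14n^2\sup_MH^2-R$ satisfy $$\sum_{i=1}^k(\eta_{k+1}-\eta_i)\Big(\eta_{k+1}-\big(1+\tfrac4n\big)\eta_i\Big)\le0.$$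 -/

import Mathlib

open Bundle MeasureTheory
open scoped Manifold ContDiff

noncomputable section

namespace DiracYang

section Tangent

variable {n : ℕ} {M : Type*} [TopologicalSpace M]
  [ChartedSpace (EuclideanSpace ℝ (Fin n)) M]

instance finiteDimensional_tangentSpace (x : M) : FiniteDimensional ℝ (TangentSpace (𝓡 n) x) :=
  inferInstanceAs (FiniteDimensional ℝ (EuclideanSpace ℝ (Fin n)))

variable [RiemannianBundle (fun x : M ↦ TangentSpace (𝓡 n) x)]

/-- The coordinate vector field `∂ᵢ` of the preferred chart at `p`, at the point with
coordinates `y`. -/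
def coordVec (p : M) (y : EuclideanSpace ℝ (Fin n)) (i : Fin n) :
    TangentSpace (𝓡 n) ((chartAt (EuclideanSpace ℝ (Fin n)) p).symm y) :=
  mfderiv (𝓡 n) (𝓡 n) (chartAt (EuclideanSpace ℝ (Fin n)) p).symm y
    ((NormedSpace.fromTangentSpace (𝕜 := ℝ) y).symm (EuclideanSpace.single i 1))

/-- The matrix `g_{ij} = ⟨∂ᵢ, ∂ⱼ⟩` of the metric in the preferred chart at `p`. -/
def gram (p : M) (y : EuclideanSpace ℝ (Fin n)) : Matrix (Fin n) (Fin n) ℝ :=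
  Matrix.of fun i j ↦ inner ℝ (coordVec p y i) (coordVec p y j)

/-- The measure `√(det g_{ij}) dy¹ ⋯ dyⁿ` of the preferred chart at `p`, as a measure on `M`
carried by the domain of that chart. -/
def chartVolume [MeasurableSpace M] (p : M) : Measure M :=
  ((volume.restrict (chartAt (EuclideanSpace ℝ (Fin n)) p).target).withDensity
    fun y ↦ ENNReal.ofReal (Real.sqrt (gram p y).det)).map
      (chartAt (EuclideanSpace ℝ (Fin n)) p).symm

variable (n M) in
/-- The Riemannian volume measure. The measures `chartVolume p` agree on the overlaps of the
chart domains, so that their supremum is the measure which restricts to `chartVolume p` on the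
domain of the chart at `p`, for every `p`. -/
def riemannianVolume [MeasurableSpace M] : Measure M :=
  ⨆ p : M, chartVolume (n := n) p

/-- The quadratic form `v ↦ -⟨v, v⟩` on a tangent space; its Clifford algebra, in which
`v * v = -⟨v, v⟩`, is the fibre of the Clifford bundle `Cl(M)`. -/
def cliffordForm (x : M) : QuadraticForm ℝ (TangentSpace (𝓡 n) x) :=
  -(LinearMap.BilinMap.toQuadraticMap (innerₗ (TangentSpace (𝓡 n) x)))

set_option synthInstance.maxHeartbeats 200000 in
/-- A connection on the tangent bundle is the Levi-Civita connection if it is torsion-free and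
compatible with the metric. -/
def IsLeviCivita [IsManifold (𝓡 n) ∞ M]
    [IsContMDiffRiemannianBundle (𝓡 n) ∞ (EuclideanSpace ℝ (Fin n))
      (fun x : M ↦ TangentSpace (𝓡 n) x)]
    (nabla : CovariantDerivative (𝓡 n) (EuclideanSpace ℝ (Fin n))
      (fun x : M ↦ TangentSpace (𝓡 n) x)) : Prop :=
  nabla.torsion = 0 ∧ nabla.IsMetricCompatible

/-- `f : M → ℝᴺ` is an isometric embedding: a smooth embedding which pulls back the Euclidean
metric to the metric of `M`. -/
structure IsIsometricEmbedding {N : ℕ} (f : M → EuclideanSpace ℝ (Fin N)) : Prop where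
  isSmoothEmbedding : Manifold.IsSmoothEmbedding (𝓡 n) (𝓡 N) ∞ f
  inner_eq : ∀ (p : M) (v w : TangentSpace (𝓡 n) p),
    inner ℝ (mvfderiv (𝓡 n) f p v) (mvfderiv (𝓡 n) f p w) = inner ℝ v w

variable [IsManifold (𝓡 n) ∞ M]

/-- The second fundamental form of `f : M → ℝᴺ` at `p`: the component normal to `df(T_pM)` of the
derivative, in the direction `v`, of the vector-valued function `q ↦ df_q(W_q)`, where `W` is a
vector field, smooth near `p`, that extends `w`. -/
def secondFundamentalForm {N : ℕ} (f : M → EuclideanSpace ℝ (Fin N)) (p : M)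
    (v w : TangentSpace (𝓡 n) p) : EuclideanSpace ℝ (Fin N) :=
  (LinearMap.range (mvfderiv (𝓡 n) f p).toLinearMap)ᗮ.starProjection
    (mvfderiv (𝓡 n)
      (fun q ↦ mvfderiv (𝓡 n) f q (FiberBundle.extend (EuclideanSpace ℝ (Fin n)) w q)) p v)

/-- The mean curvature vector: the trace of the second fundamental form. -/
def meanCurvatureVector {N : ℕ} (f : M → EuclideanSpace ℝ (Fin N)) (p : M) :
    EuclideanSpace ℝ (Fin N) :=
  ∑ i : Fin (Module.finrank ℝ (TangentSpace (𝓡 n) p)),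
    secondFundamentalForm (n := n) f p (stdOrthonormalBasis ℝ (TangentSpace (𝓡 n) p) i)
    (stdOrthonormalBasis ℝ (TangentSpace (𝓡 n) p) i)

/-- The mean curvature function `H = |𝐇| / n`. -/
def meanCurvature {N : ℕ} (f : M → EuclideanSpace ℝ (Fin N)) (p : M) : ℝ :=
  ‖meanCurvatureVector (n := n) f p‖ / n

end Tangent

section Dirac

variable (𝕜 : Type*) [RCLike 𝕜]
  (n : ℕ) {M : Type*} [TopologicalSpace M] [ChartedSpace (EuclideanSpace ℝ (Fin n)) M]
  [IsManifold (𝓡 n) ∞ M]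
  [RiemannianBundle (fun x : M ↦ TangentSpace (𝓡 n) x)]
  [IsContMDiffRiemannianBundle (𝓡 n) ∞ (EuclideanSpace ℝ (Fin n))
    (fun x : M ↦ TangentSpace (𝓡 n) x)]
  (F : Type*) [NormedAddCommGroup F] [NormedSpace ℝ F] [FiniteDimensional ℝ F]
  (V : M → Type*) [TopologicalSpace (TotalSpace F V)]
  [∀ x, NormedAddCommGroup (V x)] [∀ x, InnerProductSpace ℝ (V x)]
  [∀ x, InnerProductSpace 𝕜 (V x)]
  [FiberBundle F V] [VectorBundle ℝ F V] [ContMDiffVectorBundle ∞ F V (𝓡 n)]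
  [IsContMDiffRiemannianBundle (𝓡 n) ∞ F V]

/-- The structure of a Dirac bundle on a smooth real (`𝕜 = ℝ`) or complex (`𝕜 = ℂ`) vector bundle
`V` with a smooth fibre metric. A complex bundle is a smooth real bundle whose fibres carry a
complex structure that depends smoothly on the point, and a Hermitian metric. The instances
`InnerProductSpace ℝ (V x)` and `InnerProductSpace 𝕜 (V x)` have the norm in common; so, by
polarization, the real inner product is the real part of the `𝕜`-valued one, and the action of `ℝ`
is the restriction of the action of `𝕜`. -/
structure DiracBundle where
  /-- Scalar multiplication by `𝕜` is smooth. -/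
  contMDiff_smul : ∀ (a : 𝕜) (σ : Cₛ^∞⟮𝓡 n; F, V⟯),
    ContMDiff (𝓡 n) ((𝓡 n).prod 𝓘(ℝ, F)) ∞ (fun x ↦ TotalSpace.mk' F x (a • σ x))
  /-- The left module structure over the Clifford bundle. -/
  cliffordModule : ∀ x : M, CliffordAlgebra (cliffordForm (n := n) x) →ₐ[ℝ] Module.End ℝ (V x)
  /-- The module structure is smooth: `X · σ` is smooth if `X` and `σ` are. -/
  contMDiff_clifford : ∀
    (X : Cₛ^∞⟮𝓡 n; EuclideanSpace ℝ (Fin n), (fun x : M ↦ TangentSpace (𝓡 n) x)⟯)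
    (σ : Cₛ^∞⟮𝓡 n; F, V⟯),
    ContMDiff (𝓡 n) ((𝓡 n).prod 𝓘(ℝ, F)) ∞
      (fun x ↦ TotalSpace.mk' F x
        (cliffordModule x (CliffordAlgebra.ι (cliffordForm (n := n) x) (X x)) (σ x)))
  /-- The connection on `V`; `conn σ x v` is `∇_v σ` at `x`. -/
  conn : CovariantDerivative (𝓡 n) F V
  contMDiff_conn : CovariantDerivative.ContMDiffCovariantDerivative conn ∞
  /-- Clifford multiplication is `𝕜`-linear. -/
  clifford_smul : ∀ (x : M) (v : TangentSpace (𝓡 n) x) (a : 𝕜) (s : V x),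
    cliffordModule x (CliffordAlgebra.ι (cliffordForm (n := n) x) v) (a • s) =
      a • cliffordModule x (CliffordAlgebra.ι (cliffordForm (n := n) x) v) s
  /-- The connection is `𝕜`-linear. -/
  conn_smul : ∀ (a : 𝕜) (σ : Cₛ^∞⟮𝓡 n; F, V⟯) (x : M) (v : TangentSpace (𝓡 n) x),
    conn (fun y ↦ a • σ y) x v = a • conn (fun y ↦ σ y) x v
  /-- The connection is a metric connection. -/
  conn_metric : conn.IsMetricCompatible
  /-- Clifford multiplication by tangent vectors is skew-adjoint. -/
  clifford_skew : ∀ (x : M) (v : TangentSpace (𝓡 n) x) (s t : V x),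
    inner 𝕜 (cliffordModule x (CliffordAlgebra.ι (cliffordForm (n := n) x) v) s) t +
      inner 𝕜 s (cliffordModule x (CliffordAlgebra.ι (cliffordForm (n := n) x) v) t) = 0
  /-- The connection is a derivation of the module structure: `∇(X · σ) = (∇X) · σ + X · ∇σ`,
  where `∇X` is the Levi-Civita derivative. As `TM` generates `Cl(M)`, and the connection of
  `Cl(M)` is the extension of the Levi-Civita connection as a derivation of the product, the same
  rule follows for all sections of `Cl(M)`. -/
  conn_clifford : ∃ nabla : CovariantDerivative (𝓡 n) (EuclideanSpace ℝ (Fin n))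
      (fun x : M ↦ TangentSpace (𝓡 n) x), IsLeviCivita nabla ∧
    ∀ (X : Cₛ^∞⟮𝓡 n; EuclideanSpace ℝ (Fin n), (fun x : M ↦ TangentSpace (𝓡 n) x)⟯)
      (σ : Cₛ^∞⟮𝓡 n; F, V⟯) (x : M) (v : TangentSpace (𝓡 n) x),
      conn (fun y ↦ cliffordModule y (CliffordAlgebra.ι (cliffordForm (n := n) y) (X y)) (σ y)) x v =
        cliffordModule x (CliffordAlgebra.ι (cliffordForm (n := n) x) (nabla (fun y ↦ X y) x v)) (σ x) +
        cliffordModule x (CliffordAlgebra.ι (cliffordForm (n := n) x) (X x)) (conn (fun y ↦ σ y) x v)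

variable {𝕜 n F V}

namespace DiracBundle

variable (S : DiracBundle 𝕜 n F V)

/-- Clifford multiplication `v · s` of `s ∈ V_x` by the tangent vector `v ∈ T_xM`. -/
def cmul (x : M) (v : TangentSpace (𝓡 n) x) (s : V x) : V x :=
  S.cliffordModule x (CliffordAlgebra.ι (cliffordForm (n := n) x) v) s

/-- The Dirac operator `Dσ = ∑ᵢ eᵢ · ∇_{eᵢ} σ`, with `(eᵢ)` an orthonormal basis of `T_xM`. -/
def dirac (σ : Π x : M, V x) (x : M) : V x :=
  ∑ i : Fin (Module.finrank ℝ (TangentSpace (𝓡 n) x)), S.cmul x (stdOrthonormalBasis ℝ (TangentSpace (𝓡 n) x) i)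
    (S.conn σ x (stdOrthonormalBasis ℝ (TangentSpace (𝓡 n) x) i))

/-- The curvature `R(X, Y)σ = ∇_X ∇_Y σ - ∇_Y ∇_X σ - ∇_{[X, Y]} σ`. -/
def curvature (X Y : Π x : M, TangentSpace (𝓡 n) x) (σ : Π x : M, V x) (x : M) : V x :=
  S.conn (fun y ↦ S.conn σ y (Y y)) x (X x) - S.conn (fun y ↦ S.conn σ y (X y)) x (Y x) -
    S.conn σ x (VectorField.mlieBracket (𝓡 n) X Y x)

/-- The curvature morphism `𝔑σ = ∑_{i<j} eᵢ · eⱼ · R(eᵢ, eⱼ)σ` of the Bochner identity, with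
`(eᵢ)` an orthonormal basis of `T_xM`, extended to vector fields that are smooth near `x`. -/
def bochnerCurvature (σ : Π x : M, V x) (x : M) : V x :=
  ∑ i : Fin (Module.finrank ℝ (TangentSpace (𝓡 n) x)), ∑ j ∈ Finset.Ioi i,
    S.cmul x (stdOrthonormalBasis ℝ (TangentSpace (𝓡 n) x) i)
      (S.cmul x (stdOrthonormalBasis ℝ (TangentSpace (𝓡 n) x) j)
        (S.curvature
          (FiberBundle.extend (EuclideanSpace ℝ (Fin n))
            (stdOrthonormalBasis ℝ (TangentSpace (𝓡 n) x) i))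
          (FiberBundle.extend (EuclideanSpace ℝ (Fin n))
            (stdOrthonormalBasis ℝ (TangentSpace (𝓡 n) x) j)) σ x))

end DiracBundle

variable [MeasurableSpace M]

variable (𝕜 n) in
/-- The `L²` inner product `∫_M ⟨σ, τ⟩` of sections. -/
def l2Inner (σ τ : Π x : M, V x) : 𝕜 :=
  ∫ x, inner 𝕜 (σ x) (τ x) ∂(riemannianVolume n M)

variable (𝕜 n) in
/-- The real pairing `(σ, τ) = Re ∫_M ⟨σ, τ⟩`. -/
def pairing (σ τ : Π x : M, V x) : ℝ :=
  RCLike.re (l2Inner 𝕜 n σ τ)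

/-- A spectral resolution of `D²`: an orthonormal basis `(φ_j)` of `L²(V)` of smooth sections with
`D² φ_j = lam_j φ_j`, numbered so that the eigenvalues increase. As `L²(V)` is the completion of
the space of smooth sections, an orthonormal family is a basis of it if and only if its linear
span is dense in the space of smooth sections for the `L²` norm. Indices start at `0`. -/
structure IsSpectralResolution (S : DiracBundle 𝕜 n F V) (lam : ℕ → ℝ)
    (φ : ℕ → Cₛ^∞⟮𝓡 n; F, V⟯) : Prop where
  monotone : Monotone lam
  eigen : ∀ (j : ℕ) (x : M), S.dirac (S.dirac (φ j)) x = lam j • φ j x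
  orthonormal : ∀ i j : ℕ, l2Inner 𝕜 n (φ i) (φ j) = if i = j then 1 else 0
  complete : ∀ (σ : Cₛ^∞⟮𝓡 n; F, V⟯) (ε : ℝ), 0 < ε → ∃ (s : Finset ℕ) (a : ℕ → 𝕜),
    ∫ x, ‖σ x - ∑ j ∈ s, a j • φ j x‖ ^ 2 ∂(riemannianVolume n M) < ε

end Dirac

end DiracYang

end

/-! Let `xₐ` be the coordinates of the embedding and `Eₐ` their gradients. With `cₐ = [D², xₐ]`, the
relation `⟨cₐ φᵢ, φⱼ⟩ = (λⱼ - λᵢ) ⟨xₐ φᵢ, φⱼ⟩` turns `⟨cₐ φᵢ, xₐ φᵢ⟩` and `‖cₐ φᵢ‖²` into series in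
`|⟨xₐ φᵢ, φⱼ⟩|²` with weights `λⱼ - λᵢ` and `(λⱼ - λᵢ)²`. These squares are symmetric in `i, j`, and
Yang's argument (`sum_sq_mul_le_of_hasSum`, `sum_sq_mul_re_inner_le`) bounds `∑ (λₖ - λᵢ)² ⟨cₐ φᵢ,
xₐ φᵢ⟩` by `∑ (λₖ - λᵢ) ‖cₐ φᵢ‖²`.

It remains to sum over `a`. By `dirac_dirac_coord_smul`, `cₐ σ = -2 ∇_{Eₐ} σ - (Δxₐ) σ` with `Δ =
div grad`. Integration by parts gives `⟨cₐ φ, xₐ φ⟩ = ∫ |Eₐ|² |φ|²`, and `∑ |Eₐ|² = n`. The vector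
`(Δxₐ)ₐ` is the mean curvature vector, which is normal, so `∑ (Δxₐ) Eₐ = 0` kills the cross terms of
`∑ ‖cₐ φ‖²` and leaves `4 ∫ |∇φ|² + n² ∫ H² |φ|²`. The Bochner identity `dirac_dirac_eq` replaces `∫
|∇φ|²` by `λ - (𝔑φ, φ)`.

The `Eₐ` are global smooth fields forming a tight frame, `∑ ⟨Eₐ, v⟩ Eₐ = v`, so they serve
throughout in place of local orthonormal frames. The forms `⟨∇_v Eₐ, w⟩` are the components of the
second fundamental form. Their symmetry and normality (`IsSecondForm`) give `∑ ∇_{Eₐ} Eₐ = 0` and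
remove every correction term caused by the frame not being parallel. Symmetry of `D` and all
integrations by parts come from one divergence theorem, `integral_sum_mvfderiv_coordGrad`, proved in
charts and globalized by a partition of unity. -/

noncomputable section

namespace DiracYang

/-! ### Yang's inequality for abstract commutators -/

section Yang

/-- The algebraic core of Yang's inequality: the terms with both indices below `k` cancel by
antisymmetry, the others have a sign. -/
theorem sum_sq_mul_le_of_hasSum {lam : ℕ → ℝ} (hlam : Monotone lam) {w : ℕ → ℕ → ℝ}
    (hw : ∀ i j, 0 ≤ w i j) (hsymm : ∀ i j, w i j = w j i) {a b : ℕ → ℝ} (k : ℕ)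
    (ha : ∀ i, HasSum (fun j ↦ (lam j - lam i) * w i j) (a i))
    (hb : ∀ i, HasSum (fun j ↦ (lam j - lam i) ^ 2 * w i j) (b i)) :
    ∑ i ∈ Finset.range k, (lam k - lam i) ^ 2 * a i ≤
      ∑ i ∈ Finset.range k, (lam k - lam i) * b i := by
  have hA : HasSum (fun j ↦ ∑ i ∈ Finset.range k,
      (lam k - lam i) * (lam j - lam i) * (lam k - lam j) * w i j)
      (∑ i ∈ Finset.range k, ((lam k - lam i) ^ 2 * a i - (lam k - lam i) * b i)) := by
    refine hasSum_sum fun i _ ↦ ?_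
    refine (((ha i).mul_left _).sub ((hb i).mul_left _)).congr_fun ?_
    intro j
    ring
  have hB : ∑ j ∈ Finset.range k, ∑ i ∈ Finset.range k,
      (lam k - lam i) * (lam j - lam i) * (lam k - lam j) * w i j = 0 := by
    have h : ∑ j ∈ Finset.range k, ∑ i ∈ Finset.range k,
        (lam k - lam i) * (lam j - lam i) * (lam k - lam j) * w i j =
        -∑ j ∈ Finset.range k, ∑ i ∈ Finset.range k,
          (lam k - lam i) * (lam j - lam i) * (lam k - lam j) * w i j := by
      conv_lhs => rw [Finset.sum_comm]
      simp only [← Finset.sum_neg_distrib]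
      refine Finset.sum_congr rfl fun i _ ↦ Finset.sum_congr rfl fun j _ ↦ ?_
      rw [hsymm i j]
      ring
    linarith
  have hC := sum_le_hasSum (f := fun j ↦ -∑ i ∈ Finset.range k,
      (lam k - lam i) * (lam j - lam i) * (lam k - lam j) * w i j) (Finset.range k)
    (fun j hj ↦ ?_) hA.neg
  · simp only [Finset.sum_neg_distrib, hB, neg_zero, Finset.sum_sub_distrib] at hC
    linarith
  · rw [Finset.mem_range, not_lt] at hj
    rw [← Finset.sum_neg_distrib]
    refine Finset.sum_nonneg fun i hi ↦ ?_
    have hi' := (Finset.mem_range.1 hi).le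
    have h1 := sub_nonneg.2 (hlam hi')
    have h2 := sub_nonneg.2 (hlam (hi'.trans hj))
    have h3 := sub_nonneg.2 (hlam hj)
    have := mul_nonneg (mul_nonneg (mul_nonneg h1 h2) h3) (hw i j)
    linarith

variable {𝕜 : Type*} [RCLike 𝕜]

/-- Parseval's identity without completeness: in the completion the family becomes a Hilbert basis.
This lets smooth sections stand in for `L²`. -/
theorem hasSum_inner_mul_inner_of_dense {E : Type*} [SeminormedAddCommGroup E]
    [InnerProductSpace 𝕜 E] {φ : ℕ → E} (hφ : Orthonormal 𝕜 φ)
    (hd : Dense (Submodule.span 𝕜 (Set.range φ) : Set E)) (s t : E) :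
    HasSum (fun j ↦ inner 𝕜 s (φ j) * inner 𝕜 (φ j) t) (inner 𝕜 s t) := by
  let e : E →ₗᵢ[𝕜] UniformSpace.Completion E := UniformSpace.Completion.toComplₗᵢ
  have ho : Orthonormal 𝕜 (fun j ↦ e (φ j)) := hφ.comp_linearIsometry e
  have hspan : ⊤ ≤ (Submodule.span 𝕜 (Set.range fun j ↦ e (φ j))).topologicalClosure := by
    have hr : Set.range (fun j ↦ e (φ j)) = e '' Set.range φ := by
      rw [← Set.range_comp]; rfl
    intro z _
    rw [← SetLike.mem_coe, Submodule.topologicalClosure_coe, hr]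
    have hsp : ((Submodule.span 𝕜 (e '' Set.range φ) : Submodule 𝕜 _) :
        Set (UniformSpace.Completion E)) = e '' (Submodule.span 𝕜 (Set.range φ)) := by
      have := Submodule.map_span e.toLinearMap (Set.range φ)
      exact (congrArg (fun s : Submodule 𝕜 _ ↦ (s : Set (UniformSpace.Completion E))) this).symm
    rw [hsp]
    have hde : DenseRange e := UniformSpace.Completion.denseRange_coe
    exact (hde.dense_image e.continuous hd) z
  let b := HilbertBasis.mk ho hspan
  have := b.hasSum_inner_mul_inner (e s) (e t)
  simpa [b, HilbertBasis.coe_mk] using this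

/-- Yang's inequality for a family `ψ i = G (φ i)`, with `G` symmetric, and the commutators
`c i = (A - lam i) (ψ i)`, where `A` is symmetric with eigenbasis `φ`. -/
theorem sum_sq_mul_re_inner_le {E : Type*} [SeminormedAddCommGroup E]
    [InnerProductSpace 𝕜 E] {φ : ℕ → E} (hφ : Orthonormal 𝕜 φ)
    (hd : Dense (Submodule.span 𝕜 (Set.range φ) : Set E)) {lam : ℕ → ℝ} (hlam : Monotone lam)
    {ψ c : ℕ → E} (hψ : ∀ i j, inner 𝕜 (ψ i) (φ j) = inner 𝕜 (φ i) (ψ j))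
    (hc : ∀ i j, inner 𝕜 (c i) (φ j) = ((lam j - lam i : ℝ) : 𝕜) * inner 𝕜 (ψ i) (φ j)) (k : ℕ) :
    ∑ i ∈ Finset.range k, (lam k - lam i) ^ 2 * RCLike.re (inner 𝕜 (c i) (ψ i)) ≤
      ∑ i ∈ Finset.range k, (lam k - lam i) * RCLike.re (inner 𝕜 (c i) (c i)) := by
  -- The weights are the squared Fourier coefficients of `ψ i`; Parseval for `⟨c i, ψ i⟩` and `⟨c i,
  -- c i⟩` produces the two series.
  refine sum_sq_mul_le_of_hasSum hlam (w := fun i j ↦ ‖(inner 𝕜 (ψ i) (φ j) : 𝕜)‖ ^ 2)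
    (fun i j ↦ by positivity) (fun i j ↦ ?_) k (fun i ↦ ?_) (fun i ↦ ?_)
  · rw [hψ, norm_inner_symm]
  · refine (RCLike.hasSum_re 𝕜 (hasSum_inner_mul_inner_of_dense hφ hd (c i) (ψ i))).congr_fun ?_
    intro j
    rw [hc, mul_assoc, ← inner_conj_symm (φ j) (ψ i), RCLike.mul_conj, RCLike.re_ofReal_mul]
    norm_cast
  · refine (RCLike.hasSum_re 𝕜 (hasSum_inner_mul_inner_of_dense hφ hd (c i) (c i))).congr_fun ?_
    intro j
    rw [← inner_conj_symm (φ j) (c i), RCLike.mul_conj, hc, norm_mul, ← RCLike.ofReal_pow,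
      RCLike.ofReal_re, RCLike.norm_ofReal, mul_pow, sq_abs]

end Yang

/-! ### Determinants and inverses of variable matrices -/

section Matrix

variable {ι : Type*} [Fintype ι] [DecidableEq ι]

/-- Jacobi's formula for the derivative of a determinant. -/
theorem hasFDerivAt_det {E : Type*} [NormedAddCommGroup E] [NormedSpace ℝ E]
    {A : E → Matrix ι ι ℝ} {A' : ι → ι → E →L[ℝ] ℝ} {x : E}
    (h : ∀ i j, HasFDerivAt (fun y ↦ A y i j) (A' i j) x) :
    HasFDerivAt (fun y ↦ (A y).det) (∑ i, ∑ j, (A x).adjugate i j • A' j i) x := by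
  have h1 : HasFDerivAt (fun y ↦ (A y).det)
      (∑ σ : Equiv.Perm ι, (Equiv.Perm.sign σ : ℤ) •
        ∑ i, (∏ j ∈ Finset.univ.erase i, A x (σ j) j) • A' (σ i) i) x := by
    simp only [Matrix.det_apply]
    refine HasFDerivAt.fun_sum fun σ _ ↦ ?_
    exact (HasFDerivAt.finsetProd fun i _ ↦ h (σ i) i).const_smul (Equiv.Perm.sign σ : ℤ)
  convert h1 using 1
  ext v
  -- Cramer's rule: the sum is the determinant with column `i` differentiated, which is what the
  -- Leibniz expansion `h1` yields.
  have h2 (i : ι) : ∑ j, (A x).adjugate i j * A' j i v =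
      ((A x).updateCol i fun j ↦ A' j i v).det := by
    rw [← Matrix.cramer_apply, Matrix.cramer_eq_adjugate_mulVec]
    rfl
  simp only [sum_apply, smul_apply, smul_eq_mul, h2,
    Matrix.det_apply, Finset.smul_sum]
  rw [Finset.sum_comm]
  refine Finset.sum_congr rfl fun σ _ ↦ Finset.sum_congr rfl fun i _ ↦ ?_
  rw [← Finset.mul_prod_erase _ _ (Finset.mem_univ i), Matrix.updateCol_self, mul_comm]
  rw [Finset.prod_congr rfl fun j hj ↦ Matrix.updateCol_ne (Finset.ne_of_mem_erase hj)]
  rfl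

variable {E : Type*} [NormedAddCommGroup E] [NormedSpace ℝ E] {H : Type*} [TopologicalSpace H]
  {I : ModelWithCorners ℝ E H} {M : Type*} [TopologicalSpace M] [ChartedSpace H M] {k : WithTop ℕ∞}

theorem contMDiffAt_det {A : M → Matrix ι ι ℝ} {x : M}
    (h : ∀ i j, ContMDiffAt I 𝓘(ℝ) k (fun y ↦ A y i j) x) :
    ContMDiffAt I 𝓘(ℝ) k (fun y ↦ (A y).det) x := by
  simp only [Matrix.det_apply']
  exact ContMDiffAt.sum fun σ _ ↦ contMDiffAt_const.mul
    (contMDiffAt_finsetProd fun i _ ↦ h (σ i) i)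

theorem contMDiffAt_inv_apply {A : M → Matrix ι ι ℝ} {x : M}
    (h : ∀ i j, ContMDiffAt I 𝓘(ℝ) k (fun y ↦ A y i j) x) (hA : (A x).det ≠ 0) (i j : ι) :
    ContMDiffAt I 𝓘(ℝ) k (fun y ↦ (A y)⁻¹ i j) x := by
  simp only [Matrix.inv_def, Ring.inverse_eq_inv', Matrix.smul_apply, smul_eq_mul,
    Matrix.adjugate_apply]
  refine ((contMDiffAt_det h).inv₀ hA).mul (contMDiffAt_det fun a b ↦ ?_)
  by_cases hab : a = j
  · subst hab
    simpa only [Matrix.updateRow_self] using contMDiffAt_const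
  · simpa only [Matrix.updateRow_ne hab] using h a b

end Matrix

/-! ### The divergence theorem in a parametrized domain -/

section Divergence

variable {n : ℕ} {W : Type*} [NormedAddCommGroup W] [InnerProductSpace ℝ W]

local notation "𝔼" => EuclideanSpace ℝ (Fin n)

theorem integral_fderiv_eq_zero {η : 𝔼 → ℝ} (hη : ContDiff ℝ 1 η) (hc : HasCompactSupport η)
    (v : 𝔼) : ∫ y, fderiv ℝ η y v = 0 := by
  have hcont : Continuous (fun y ↦ fderiv ℝ η y v) :=
    (hη.continuous_fderiv one_ne_zero).clm_apply continuous_const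
  have h := integral_mul_fderiv_eq_neg_fderiv_mul_of_integrable (μ := (volume : Measure 𝔼))
    (f := fun _ ↦ (1 : ℝ)) (g := η) (v := v) (by simp)
    (by simpa using hcont.integrable_of_hasCompactSupport (hc.fderiv_apply ℝ v))
    (by simpa using hη.continuous.integrable_of_hasCompactSupport hc)
    (fun _ _ ↦ differentiableAt_const _)
    (fun y _ ↦ (hη.differentiable one_ne_zero) y)
  simpa using h

/-- The pointwise identity behind the divergence theorem. -/
theorem sum_inv_mul_inner_eq {G : Matrix (Fin n) (Fin n) ℝ} (hG : 0 < G.det)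
    {d : Fin n → W} (hGd : ∀ i j, G i j = inner ℝ (d i) (d j)) (a : Fin n → Fin n → ℝ)
    (B : Fin n → Fin n → W) (hB : ∀ k l, B k l = B l k) (ξ : Fin n → ℝ) :
    (∑ m, ∑ l, G⁻¹ m l * inner ℝ (d m) (∑ k, (a k l • d k + ξ k • B k l))) * √G.det =
      ∑ k, (√G.det * a k k + ξ k * (1 / (2 * √G.det) *
        ∑ i, ∑ j, G.adjugate i j * (inner ℝ (d j) (B i k) + inner ℝ (B j k) (d i)))) := by
  have hs : √G.det ≠ 0 := (Real.sqrt_pos.2 hG).ne'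
  have hunit : IsUnit G.det := hG.ne'.isUnit
  have hsymm : G.transpose = G := by
    ext i j; rw [Matrix.transpose_apply, hGd, hGd, real_inner_comm]
  have hinv (i j) : G⁻¹ i j = G⁻¹ j i := by
    have := Matrix.transpose_nonsing_inv G
    rw [hsymm] at this
    conv_lhs => rw [← this]
    rfl
  have hadj : G.adjugate = G.det • G⁻¹ := by
    rw [Matrix.inv_def, Ring.inverse_eq_inv', smul_smul, mul_inv_cancel₀ hG.ne', one_smul]
  have h1 : ∑ m, ∑ l, G⁻¹ m l * inner ℝ (d m) (∑ k, (a k l • d k + ξ k • B k l)) =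
      ∑ k, (a k k + ξ k * ∑ m, ∑ l, G⁻¹ m l * inner ℝ (d m) (B k l)) := by
    have h2 (l k) : ∑ m, G⁻¹ m l * inner ℝ (d m) (d k) = if l = k then 1 else 0 := by
      have := congrFun₂ (Matrix.nonsing_inv_mul G hunit) l k
      rw [Matrix.mul_apply, Matrix.one_apply] at this
      rw [← this]
      exact Finset.sum_congr rfl fun m _ ↦ by rw [hinv, hGd]
    calc _ = ∑ k, ((∑ l, a k l * ∑ m, G⁻¹ m l * inner ℝ (d m) (d k)) +
        ξ k * ∑ m, ∑ l, G⁻¹ m l * inner ℝ (d m) (B k l)) := by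
          simp only [inner_sum, inner_add_right, real_inner_smul_right, mul_add, Finset.mul_sum,
            Finset.sum_add_distrib]
          congr 1
          · rw [Finset.sum_comm]
            rw [Finset.sum_congr rfl fun l _ ↦ Finset.sum_comm, Finset.sum_comm]
            exact Finset.sum_congr rfl fun _ _ ↦ Finset.sum_congr rfl fun _ _ ↦
              Finset.sum_congr rfl fun _ _ ↦ by ring
          · rw [Finset.sum_congr rfl fun l _ ↦ Finset.sum_comm, Finset.sum_comm]
            exact Finset.sum_congr rfl fun _ _ ↦ Finset.sum_congr rfl fun _ _ ↦
              Finset.sum_congr rfl fun _ _ ↦ by ring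
      _ = _ := by simp [h2]
  rw [h1, Finset.sum_mul]
  refine Finset.sum_congr rfl fun k _ ↦ ?_
  -- The left side is the derivative of `det G` in direction `k`. Its two halves agree since `G⁻¹`
  -- is symmetric, and the symmetry of `B` identifies the result with the Christoffel-type term of
  -- `h1`.
  have h3 : ∑ i, ∑ j, G.adjugate i j * (inner ℝ (d j) (B i k) + inner ℝ (B j k) (d i)) =
      2 * G.det * ∑ m, ∑ l, G⁻¹ m l * inner ℝ (d m) (B k l) := by
    simp only [mul_add, Finset.sum_add_distrib, hadj, Matrix.smul_apply, smul_eq_mul]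
    have h4 : ∑ i, ∑ j, G.det * G⁻¹ i j * inner ℝ (d j) (B i k) =
        ∑ i, ∑ j, G.det * G⁻¹ i j * inner ℝ (B j k) (d i) := by
      rw [Finset.sum_comm]
      exact Finset.sum_congr rfl fun i _ ↦ Finset.sum_congr rfl fun j _ ↦ by
        rw [hinv, real_inner_comm]
    rw [h4, ← two_mul, mul_assoc, Finset.mul_sum]
    simp only [Finset.mul_sum]
    exact Finset.sum_congr rfl fun i _ ↦ Finset.sum_congr rfl fun j _ ↦ by
      rw [real_inner_comm, hB k j]; ring
  rw [h3]
  field_simp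
  rw [Real.sq_sqrt hG.le]
  ring

set_option maxHeartbeats 400000 in
/-- The divergence theorem for a compactly supported vector field on a parametrized piece of a
submanifold; the field is given by its values `w` in the ambient space. -/
theorem integral_divergence_eq_zero {U : Set 𝔼} (hU : IsOpen U) {F : 𝔼 → W}
    (hF : ContDiffOn ℝ ∞ F U) {w : 𝔼 → W} (hw : ContDiff ℝ ∞ w) (hc : HasCompactSupport w)
    (hwU : tsupport w ⊆ U) (hrange : ∀ y ∈ U, ∃ v, w y = fderiv ℝ F y v)
    {G : 𝔼 → Matrix (Fin n) (Fin n) ℝ}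
    (hG : ∀ y ∈ U, ∀ i j, G y i j = inner ℝ (fderiv ℝ F y (EuclideanSpace.single i 1))
      (fderiv ℝ F y (EuclideanSpace.single j 1)))
    (hdet : ∀ y ∈ U, 0 < (G y).det) :
    ∫ y in U, (∑ k, ∑ l, (G y)⁻¹ k l * inner ℝ (fderiv ℝ F y (EuclideanSpace.single k 1))
      (fderiv ℝ w y (EuclideanSpace.single l 1))) * √(G y).det = 0 := by
  let e : Fin n → 𝔼 := fun k ↦ EuclideanSpace.single k 1
  let d : Fin n → 𝔼 → W := fun k y ↦ fderiv ℝ F y (e k)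
  let ξ : Fin n → 𝔼 → ℝ := fun k y ↦ ∑ m, (G y)⁻¹ k m * inner ℝ (d m y) (w y)
  let η : Fin n → 𝔼 → ℝ := fun k y ↦ √(G y).det * ξ k y
  have hFat (y) (hy : y ∈ U) : ContDiffAt ℝ ∞ F y := hF.contDiffAt (hU.mem_nhds hy)
  have hd (k y) (hy : y ∈ U) : ContDiffAt ℝ ∞ (d k) y :=
    ((hFat y hy).fderiv_right (m := ∞) le_rfl).clm_apply contDiffAt_const
  have hGev (y) (hy : y ∈ U) (i j) :
      (fun z ↦ G z i j) =ᶠ[nhds y] fun z ↦ inner ℝ (d i z) (d j z) :=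
    Filter.eventuallyEq_of_mem (hU.mem_nhds hy) fun z hz ↦ hG z hz i j
  have hGc (y) (hy : y ∈ U) (i j) : ContMDiffAt 𝓘(ℝ, 𝔼) 𝓘(ℝ) ∞ (fun z ↦ G z i j) y :=
    (((hd i y hy).inner ℝ (hd j y hy)).congr_of_eventuallyEq (hGev y hy i j)).contMDiffAt
  have hξc (k y) (hy : y ∈ U) : ContDiffAt ℝ ∞ (ξ k) y := by
    refine ContDiffAt.sum fun m _ ↦ ?_
    exact (contMDiffAt_inv_apply (hGc y hy) (hdet y hy).ne' k m).contDiffAt.mul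
      ((hd m y hy).inner ℝ hw.contDiffAt)
  have hdc (y) (hy : y ∈ U) : ContDiffAt ℝ ∞ (fun z ↦ (G z).det) y :=
    (contMDiffAt_det (hGc y hy)).contDiffAt
  have hsc (y) (hy : y ∈ U) : ContDiffAt ℝ ∞ (fun z ↦ √(G z).det) y :=
    (hdc y hy).sqrt (hdet y hy).ne'
  have hξ0 (k y) (hy : w y = 0) : η k y = 0 := by simp [η, ξ, hy]
  -- Nothing is known about `G` outside `U`, but `η k` vanishes off the support of `w`, which lies
  -- in `U`.
  have hηc (k) : ContDiff ℝ 1 (η k) := by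
    rw [contDiff_iff_contDiffAt]
    intro y
    by_cases hy : y ∈ tsupport w
    · exact ((hsc y (hwU hy)).mul (hξc k y (hwU hy))).of_le (by norm_num)
    · have h0 : η k =ᶠ[nhds y] fun _ ↦ 0 := by
        filter_upwards [notMem_tsupport_iff_eventuallyEq.1 hy] with z hz using hξ0 k z hz
      exact contDiffAt_const.congr_of_eventuallyEq h0
  have hηs (k) : HasCompactSupport (η k) :=
    hc.mono fun y hy ↦ fun h ↦ hy (hξ0 k y h)
  have hwξ (y) (hy : y ∈ U) : w y = ∑ k, ξ k y • d k y := by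
    obtain ⟨v, hv⟩ := hrange y hy
    have hv' : w y = ∑ k, v k • d k y := by
      rw [hv]
      conv_lhs => rw [← (EuclideanSpace.basisFun (Fin n) ℝ).sum_repr v]
      simp [d, e]
    have : ∀ k, ξ k y = v k := by
      intro k
      have h1 : ∀ m, inner ℝ (d m y) (w y) = (G y).mulVec v m := by
        intro m
        rw [hv', inner_sum, Matrix.mulVec, dotProduct]
        refine Finset.sum_congr rfl fun l _ ↦ ?_
        rw [real_inner_smul_right, hG y hy, mul_comm]
      have h2 : ξ k y = ((G y)⁻¹.mulVec ((G y).mulVec v)) k := by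
        simp only [ξ, h1]
        rfl
      rw [h2, Matrix.mulVec_mulVec, Matrix.nonsing_inv_mul _ (hdet y hy).ne'.isUnit,
        Matrix.one_mulVec]
    rw [hv']
    exact Finset.sum_congr rfl fun k _ ↦ by rw [this]
  -- The classical formula `√g · div w = ∑ ∂ₖ(√g ξᵏ)`; each term on the right has integral zero.
  have key (y) (hy : y ∈ U) :
      (∑ k, ∑ l, (G y)⁻¹ k l * inner ℝ (d k y) (fderiv ℝ w y (e l))) * √(G y).det =
        ∑ k, fderiv ℝ (η k) y (e k) := by
    have hd' (k) : HasFDerivAt (d k) (fderiv ℝ (d k) y) y :=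
      ((hd k y hy).differentiableAt (by simp)).hasFDerivAt
    have hξ' (k) : HasFDerivAt (ξ k) (fderiv ℝ (ξ k) y) y :=
      ((hξc k y hy).differentiableAt (by simp)).hasFDerivAt
    have hsym (k l) : fderiv ℝ (d k) y (e l) = fderiv ℝ (d l) y (e k) := by
      have h1 (k) : fderiv ℝ (d k) y = (fderiv ℝ (fderiv ℝ F) y).flip (e k) := by
        have : DifferentiableAt ℝ (fderiv ℝ F) y :=
          ((hFat y hy).fderiv_right (m := ∞) le_rfl).differentiableAt (by simp)
        have h2 := (this.hasFDerivAt.clm_apply (hasFDerivAt_const (e k) y)).fderiv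
        simpa [d] using h2
      rw [h1, h1]
      exact ((hFat y hy).isSymmSndFDerivAt (by simpa using ENat.LEInfty.out)).eq _ _
    have hw' (l) : fderiv ℝ w y (e l) =
        ∑ k, (fderiv ℝ (ξ k) y (e l) • d k y + ξ k y • fderiv ℝ (d k) y (e l)) := by
      have h1 : w =ᶠ[nhds y] fun z ↦ ∑ k, ξ k z • d k z :=
        Filter.eventuallyEq_of_mem (hU.mem_nhds hy) fun z hz ↦ hwξ z hz
      rw [h1.fderiv_eq, (HasFDerivAt.fun_sum fun k _ ↦ (hξ' k).fun_smul (hd' k)).fderiv]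
      simp [add_comm]
    have hdet' := hasFDerivAt_det (A := G) (x := y) (A' := fun i j ↦
      (fderivInnerCLM ℝ (d i y, d j y)).comp ((fderiv ℝ (d i) y).prod (fderiv ℝ (d j) y)))
      fun i j ↦
        ((hd' i).inner ℝ (hd' j)).congr_of_eventuallyEq (hGev y hy i j)
    have hη' (k) : fderiv ℝ (η k) y (e k) = √(G y).det * fderiv ℝ (ξ k) y (e k) +
        ξ k y * (1 / (2 * √(G y).det) * ∑ i, ∑ j, (G y).adjugate i j *
          (inner ℝ (d j y) (fderiv ℝ (d i) y (e k)) +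
            inner ℝ (fderiv ℝ (d j) y (e k)) (d i y))) := by
      have h1 := ((hdet'.sqrt (hdet y hy).ne').fun_mul (hξ' k)).fderiv
      rw [show fderiv ℝ (η k) y = _ from h1]
      simp only [add_apply, smul_apply, sum_apply, smul_eq_mul, ContinuousLinearMap.comp_apply,
        ContinuousLinearMap.prod_apply, fderivInnerCLM_apply]
    simp only [hη', hw']
    exact sum_inv_mul_inner_eq (hdet y hy) (hG y hy) (fun k l ↦ fderiv ℝ (ξ k) y (e l))
      (fun k l ↦ fderiv ℝ (d k) y (e l)) hsym (fun k ↦ ξ k y)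
  rw [setIntegral_congr_fun hU.measurableSet key,
    setIntegral_eq_integral_of_forall_compl_eq_zero, integral_finsetSum]
  · exact Finset.sum_eq_zero fun k _ ↦ integral_fderiv_eq_zero (hηc k) (hηs k) _
  · intro k _
    exact (((hηc k).continuous_fderiv one_ne_zero).clm_apply
      continuous_const).integrable_of_hasCompactSupport ((hηs k).fderiv_apply ℝ _)
  · intro y hy
    refine Finset.sum_eq_zero fun k _ ↦ ?_
    have h0 : η k =ᶠ[nhds y] fun _ ↦ 0 := by
      filter_upwards [notMem_tsupport_iff_eventuallyEq.1 fun h ↦ hy (hwU h)] with z hz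
        using hξ0 k z hz
    rw [h0.fderiv_eq]
    simp

end Divergence

/-- The inverse Gram matrix raises the index: it recovers the coordinates of a vector from its inner
products with a basis that need not be orthonormal. -/
theorem sum_gram_inv_mul_inner_smul {ι V : Type*} [Fintype ι] [DecidableEq ι]
    [NormedAddCommGroup V] [InnerProductSpace ℝ V] (b : Module.Basis ι ℝ V) (z : V) :
    ∑ i, (∑ j, (Matrix.gram ℝ b)⁻¹ i j * inner ℝ (b j) z) • b i = z := by
  have hdet : IsUnit (Matrix.gram ℝ b).det :=
    (Matrix.posDef_gram_of_linearIndependent b.linearIndependent).det_pos.ne'.isUnit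
  have h1 (j) : inner ℝ (b j) z = (Matrix.gram ℝ b).mulVec (b.repr z) j := by
    conv_lhs => rw [← b.sum_repr z]
    rw [inner_sum, Matrix.mulVec, dotProduct]
    exact Finset.sum_congr rfl fun l _ ↦ by
      rw [real_inner_smul_right, Matrix.gram_apply, mul_comm]
  conv_rhs => rw [← b.sum_repr z]
  refine Finset.sum_congr rfl fun i _ ↦ ?_
  congr 1
  have h2 : ∑ j, (Matrix.gram ℝ b)⁻¹ i j * inner ℝ (b j) z =
      ((Matrix.gram ℝ b)⁻¹.mulVec ((Matrix.gram ℝ b).mulVec (b.repr z))) i := by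
    simp only [h1]
    rfl
  rw [h2, Matrix.mulVec_mulVec, Matrix.nonsing_inv_mul _ hdet, Matrix.one_mulVec]

/-! ### Smoothness of gradients -/

section Gradient

variable {n : ℕ} {M : Type*} [TopologicalSpace M] [ChartedSpace (EuclideanSpace ℝ (Fin n)) M]

section

variable [IsManifold (𝓡 n) ∞ M]

/-- The derivative of a smooth function along a smooth vector field is smooth. -/
theorem contMDiffAt_mvfderiv_apply {W : Type*} [NormedAddCommGroup W] [NormedSpace ℝ W]
    {u : M → W} (hu : ContMDiff (𝓡 n) 𝓘(ℝ, W) ∞ u) {X : Π x : M, TangentSpace (𝓡 n) x} {x : M}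
    (hX : ContMDiffAt (𝓡 n) ((𝓡 n).prod 𝓘(ℝ, EuclideanSpace ℝ (Fin n))) ∞ (T% X) x) :
    ContMDiffAt (𝓡 n) 𝓘(ℝ, W) ∞ (fun y ↦ mvfderiv (𝓡 n) u y (X y)) x := by
  have h1 := (hu.contMDiff_tangentMap (m := ∞) le_rfl).contMDiffAt.comp x hX
  exact (contMDiff_snd_tangentBundle_modelSpace W 𝓘(ℝ, W)).contMDiffAt.comp x h1

theorem contMDiff_mvfderiv_apply {W : Type*} [NormedAddCommGroup W] [NormedSpace ℝ W]
    {u : M → W} (hu : ContMDiff (𝓡 n) 𝓘(ℝ, W) ∞ u) {X : Π x : M, TangentSpace (𝓡 n) x}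
    (hX : ContMDiff (𝓡 n) ((𝓡 n).prod 𝓘(ℝ, EuclideanSpace ℝ (Fin n))) ∞ (T% X)) :
    ContMDiff (𝓡 n) 𝓘(ℝ, W) ∞ (fun y ↦ mvfderiv (𝓡 n) u y (X y)) :=
  fun x ↦ contMDiffAt_mvfderiv_apply hu (hX x)

end

variable [RiemannianBundle (fun x : M ↦ TangentSpace (𝓡 n) x)]

/-- The gradient of a function on a Riemannian manifold. -/
def grad (u : M → ℝ) (x : M) : TangentSpace (𝓡 n) x :=
  haveI : CompleteSpace (TangentSpace (𝓡 n) x) := FiniteDimensional.complete ℝ _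
  (InnerProductSpace.toDual ℝ (TangentSpace (𝓡 n) x)).symm (mvfderiv (𝓡 n) u x)

theorem inner_grad (u : M → ℝ) (x : M) (v : TangentSpace (𝓡 n) x) :
    inner ℝ (grad u x) v = mvfderiv (𝓡 n) u x v := by
  have : CompleteSpace (TangentSpace (𝓡 n) x) := FiniteDimensional.complete ℝ _
  exact InnerProductSpace.toDual_symm_apply

variable [IsManifold (𝓡 n) ∞ M]
  [IsContMDiffRiemannianBundle (𝓡 n) ∞ (EuclideanSpace ℝ (Fin n))
    (fun x : M ↦ TangentSpace (𝓡 n) x)]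

/-- In a local frame `s` the gradient is `∑ gⁱʲ (sⱼ u) sᵢ`, and the inverse Gram matrix `gⁱʲ` is
smooth. -/
theorem contMDiff_grad {u : M → ℝ} (hu : ContMDiff (𝓡 n) 𝓘(ℝ) ∞ u) :
    ContMDiff (𝓡 n) ((𝓡 n).prod 𝓘(ℝ, EuclideanSpace ℝ (Fin n))) ∞
      (T% (grad u : Π x : M, TangentSpace (𝓡 n) x)) := by
  intro x
  let t := trivializationAt (EuclideanSpace ℝ (Fin n)) (TangentSpace (𝓡 n) : M → Type _) x
  let b := (EuclideanSpace.basisFun (Fin n) ℝ).toBasis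
  have hx : x ∈ t.baseSet := FiberBundle.mem_baseSet_trivializationAt _ _ x
  let s := t.localFrame b
  have hs (i) : ContMDiffAt (𝓡 n) ((𝓡 n).prod 𝓘(ℝ, EuclideanSpace ℝ (Fin n))) ∞ (T% (s i)) x :=
    contMDiffAt_localFrame_of_mem ∞ t b i hx
  let G : M → Matrix (Fin n) (Fin n) ℝ := fun y ↦ Matrix.gram ℝ fun i ↦ s i y
  have hG (i j) : ContMDiffAt (𝓡 n) 𝓘(ℝ) ∞ (fun y ↦ G y i j) x := (hs i).inner_bundle (hs j)
  have hsb (y) (hy : y ∈ t.baseSet) : (fun i ↦ s i y) = t.basisAt b hy :=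
    funext fun i ↦ t.localFrame_apply_of_mem_baseSet b hy
  have hdet : (G x).det ≠ 0 := by
    simp only [G, hsb x hx]
    exact (Matrix.posDef_gram_of_linearIndependent (t.basisAt b hx).linearIndependent).det_pos.ne'
  have hev : (T% (grad u : Π x : M, TangentSpace (𝓡 n) x)) =ᶠ[nhds x]
      T% (fun y ↦ ∑ i, (∑ j, (G y)⁻¹ i j * mvfderiv (𝓡 n) u y (s j y)) • s i y) := by
    filter_upwards [t.open_baseSet.mem_nhds hx] with y hy
    have h := sum_gram_inv_mul_inner_smul (t.basisAt b hy) (grad u y)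
    rw [← hsb y hy] at h
    simp only [real_inner_comm, inner_grad] at h
    exact congrArg _ h.symm
  refine ContMDiffAt.congr_of_eventuallyEq ?_ hev
  refine ContMDiffAt.sum_section fun i _ ↦ ContMDiffAt.smul_section ?_ (hs i)
  exact ContMDiffAt.sum fun j _ ↦ (contMDiffAt_inv_apply hG hdet i j).mul
    (contMDiffAt_mvfderiv_apply hu (hs j))

end Gradient

/-! ### The Riemannian volume in charts -/

section ChartMeasurable

variable {n : ℕ} {M : Type*} [TopologicalSpace M] [ChartedSpace (EuclideanSpace ℝ (Fin n)) M]
  [MeasurableSpace M] [BorelSpace M]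

local notation "𝔼" => EuclideanSpace ℝ (Fin n)

theorem measurableSet_target_inter_preimage (p : M) {A : Set M} (hA : MeasurableSet A) :
    MeasurableSet ((chartAt 𝔼 p).target ∩ (chartAt 𝔼 p).symm ⁻¹' A) := by
  have h1 := MeasurableSet.subtype_image (chartAt 𝔼 p).open_target.measurableSet
    ((chartAt 𝔼 p).continuousOn_symm.domRestrict.measurable hA)
  convert h1 using 1
  ext y
  simp
  tauto

/-- The inverse chart is continuous only on its target. Without a.e. measurability `Measure.map`
would be the zero measure by default. -/
theorem aemeasurable_chart_symm (p : M) (g : 𝔼 → ENNReal) :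
    AEMeasurable (chartAt 𝔼 p).symm
      ((volume.restrict (chartAt 𝔼 p).target).withDensity g) :=
  ((chartAt 𝔼 p).continuousOn_symm.aemeasurable
    (chartAt 𝔼 p).open_target.measurableSet).mono_ac (withDensity_absolutelyContinuous _ _)

variable [RiemannianBundle (fun x : M ↦ TangentSpace (𝓡 n) x)]

theorem chartVolume_apply (p : M) {A : Set M} (hA : MeasurableSet A) :
    chartVolume (n := n) p A = ∫⁻ y in (chartAt 𝔼 p).target ∩ (chartAt 𝔼 p).symm ⁻¹' A,
      ENNReal.ofReal √(gram p y).det := by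
  rw [chartVolume, Measure.map_apply_of_aemeasurable (aemeasurable_chart_symm p _) hA,
    withDensity_apply', Measure.restrict_restrict' (chartAt 𝔼 p).open_target.measurableSet,
    Set.inter_comm]

theorem chartVolume_compl_source (p : M) :
    chartVolume (n := n) p (chartAt 𝔼 p).sourceᶜ = 0 := by
  rw [chartVolume_apply p (chartAt 𝔼 p).open_source.measurableSet.compl]
  have : (chartAt 𝔼 p).target ∩ (chartAt 𝔼 p).symm ⁻¹' (chartAt 𝔼 p).sourceᶜ = ∅ := by
    ext y
    simp only [Set.mem_inter_iff, Set.mem_preimage, Set.mem_compl_iff, Set.mem_empty_iff_false,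
      iff_false, not_and, not_not]
    exact fun hy ↦ (chartAt 𝔼 p).map_target hy
  rw [this]
  simp

theorem chartVolume_inter_source (p : M) (A : Set M) :
    chartVolume (n := n) p (A ∩ (chartAt 𝔼 p).source) = chartVolume (n := n) p A :=
  measure_inter_conull (chartVolume_compl_source p)

end ChartMeasurable

section Volume

variable {n : ℕ} {M : Type*} [TopologicalSpace M] [ChartedSpace (EuclideanSpace ℝ (Fin n)) M]
  [IsManifold (𝓡 n) ∞ M]

local notation "𝔼" => EuclideanSpace ℝ (Fin n)

section

variable {W : Type*} [NormedAddCommGroup W] [NormedSpace ℝ W]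

theorem contDiffOn_comp_chart_symm {u : M → W} (hu : ContMDiff (𝓡 n) 𝓘(ℝ, W) ∞ u) (p : M) :
    ContDiffOn ℝ ∞ (u ∘ (chartAt 𝔼 p).symm) (chartAt 𝔼 p).target :=
  contMDiffOn_iff_contDiffOn.1 (hu.comp_contMDiffOn contMDiffOn_chart_symm)

theorem fderiv_comp_chart_symm {u : M → W} (hu : ContMDiff (𝓡 n) 𝓘(ℝ, W) ∞ u) (p : M) {y : 𝔼}
    (hy : y ∈ (chartAt 𝔼 p).target) (v : 𝔼) :
    fderiv ℝ (u ∘ (chartAt 𝔼 p).symm) y v =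
      mvfderiv (𝓡 n) u ((chartAt 𝔼 p).symm y) (mfderiv (𝓡 n) (𝓡 n) (chartAt 𝔼 p).symm y
        ((NormedSpace.fromTangentSpace (𝕜 := ℝ) y).symm v)) := by
  have h := mfderiv_comp (I := 𝓡 n) (I' := 𝓡 n) (I'' := 𝓘(ℝ, W)) y
    (hu.mdifferentiable (by simp) _)
    (((mdifferentiable_chart (I := 𝓡 n) p).mdifferentiableAt_symm hy))
  rw [mfderiv_eq_fderiv] at h
  exact congrArg (fun L ↦ L v) h

end

/-- The coordinate change from the preferred chart at `p` to the preferred chart at `q`. -/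
def coordChange (p q : M) : 𝔼 → 𝔼 := chartAt 𝔼 q ∘ (chartAt 𝔼 p).symm

theorem differentiableAt_coordChange {p q : M} {y : 𝔼} (hy : y ∈ (chartAt 𝔼 p).target)
    (hq : (chartAt 𝔼 p).symm y ∈ (chartAt 𝔼 q).source) :
    DifferentiableAt ℝ (coordChange p q) y := by
  rw [← mdifferentiableAt_iff_differentiableAt]
  exact MDifferentiableAt.comp (I' := 𝓡 n) y
    ((mdifferentiable_chart (I := 𝓡 n) q).mdifferentiableAt hq)
    ((mdifferentiable_chart (I := 𝓡 n) p).mdifferentiableAt_symm hy)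

variable [RiemannianBundle (fun x : M ↦ TangentSpace (𝓡 n) x)]
  {N : ℕ} {f : M → EuclideanSpace ℝ (Fin N)}

/-- The metric coefficients are those of the parametrization `f ∘ chart⁻¹` of a Euclidean
submanifold, so their smoothness and transformation law are read off from `f`. -/
theorem gram_apply_eq (hf : IsIsometricEmbedding (n := n) f) (p : M) {y : 𝔼} (hy : y ∈ (chartAt 𝔼 p).target) (i j : Fin n) :
    gram p y i j =
      inner ℝ (fderiv ℝ (f ∘ (chartAt 𝔼 p).symm) y (EuclideanSpace.single i 1))
        (fderiv ℝ (f ∘ (chartAt 𝔼 p).symm) y (EuclideanSpace.single j 1)) := by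
  have hc := hf.isSmoothEmbedding.contMDiff
  rw [fderiv_comp_chart_symm hc p hy, fderiv_comp_chart_symm hc p hy, hf.inner_eq]
  rfl

/-- The coordinate vectors of the preferred chart at `p`, as a basis of a tangent space. -/
def coordBasis (p : M) {y : 𝔼} (hy : y ∈ (chartAt 𝔼 p).target) :
    Module.Basis (Fin n) ℝ (TangentSpace (𝓡 n) ((chartAt 𝔼 p).symm y)) :=
  (EuclideanSpace.basisFun (Fin n) ℝ).toBasis.map
    ((mdifferentiable_chart (I := 𝓡 n) p).symm.mfderiv hy).toLinearEquiv

theorem coe_coordBasis (p : M) {y : 𝔼} (hy : y ∈ (chartAt 𝔼 p).target) :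
    ⇑(coordBasis p hy) = coordVec p y := by
  ext1 i
  have h : (EuclideanSpace.basisFun (Fin n) ℝ).toBasis i = EuclideanSpace.single i 1 := by simp
  exact congrArg (mfderiv (𝓡 n) (𝓡 n) (chartAt 𝔼 p).symm y) h

theorem gram_eq (p : M) {y : 𝔼} (hy : y ∈ (chartAt 𝔼 p).target) :
    gram p y = Matrix.gram ℝ (coordBasis p hy) := by
  rw [coe_coordBasis]
  rfl

theorem det_gram_pos (p : M) {y : 𝔼} (hy : y ∈ (chartAt 𝔼 p).target) : 0 < (gram p y).det := by
  rw [gram_eq p hy]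
  exact (Matrix.posDef_gram_of_linearIndependent (coordBasis p hy).linearIndependent).det_pos

theorem contDiffAt_gram (hf : IsIsometricEmbedding (n := n) f) (p : M) {y : 𝔼}
    (hy : y ∈ (chartAt 𝔼 p).target) (i j : Fin n) : ContDiffAt ℝ ∞ (fun z ↦ gram p z i j) y := by
  have ht := (chartAt 𝔼 p).open_target.mem_nhds hy
  have h1 : ContDiffAt ℝ ∞ (f ∘ (chartAt 𝔼 p).symm) y :=
    (contDiffOn_comp_chart_symm hf.isSmoothEmbedding.contMDiff p).contDiffAt ht
  have h2 (k : Fin n) : ContDiffAt ℝ ∞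
      (fun z ↦ fderiv ℝ (f ∘ (chartAt 𝔼 p).symm) z (EuclideanSpace.single k 1)) y :=
    (h1.fderiv_right (m := ∞) le_rfl).clm_apply contDiffAt_const
  refine ((h2 i).inner ℝ (h2 j)).congr_of_eventuallyEq ?_
  filter_upwards [ht] with z hz using gram_apply_eq hf p hz i j

theorem continuousOn_sqrt_det_gram (hf : IsIsometricEmbedding (n := n) f) (p : M) :
    ContinuousOn (fun y ↦ √(gram p y).det) (chartAt 𝔼 p).target := fun _ hy ↦
  (((contMDiffAt_det fun i j ↦ (contDiffAt_gram hf p hy i j).contMDiffAt).contDiffAt.sqrt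
    (det_gram_pos p hy).ne').continuousAt).continuousWithinAt

/-- The chain rule gives `G_p = Jᵀ G_q J` for the Jacobian `J` of the coordinate change; take
determinants and square roots. -/
theorem sqrt_det_gram_coordChange (hf : IsIsometricEmbedding (n := n) f) {p q : M} {y : 𝔼}
    (hy : y ∈ (chartAt 𝔼 p).target) (hq : (chartAt 𝔼 p).symm y ∈ (chartAt 𝔼 q).source) :
    |(fderiv ℝ (coordChange p q) y).det| * √(gram q (coordChange p q y)).det =
      √(gram p y).det := by
  let L := fderiv ℝ (coordChange p q) y
  let b := (EuclideanSpace.basisFun (Fin n) ℝ).toBasis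
  let J : Matrix (Fin n) (Fin n) ℝ := LinearMap.toMatrix b b L.toLinearMap
  have hyq : coordChange p q y ∈ (chartAt 𝔼 q).target := (chartAt 𝔼 q).map_source hq
  have hev : f ∘ (chartAt 𝔼 p).symm =ᶠ[nhds y]
      (f ∘ (chartAt 𝔼 q).symm) ∘ coordChange p q := by
    have h1 := (chartAt 𝔼 p).continuousAt_symm hy
    filter_upwards [h1 ((chartAt 𝔼 q).open_source.mem_nhds hq)] with z hz
    simp [coordChange, (chartAt 𝔼 q).left_inv hz]
  have hfd (v : 𝔼) : fderiv ℝ (f ∘ (chartAt 𝔼 p).symm) y v =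
      fderiv ℝ (f ∘ (chartAt 𝔼 q).symm) (coordChange p q y) (L v) := by
    rw [hev.fderiv_eq, fderiv_comp]
    · rfl
    · exact ((contDiffOn_comp_chart_symm hf.isSmoothEmbedding.contMDiff q).contDiffAt
        ((chartAt 𝔼 q).open_target.mem_nhds hyq)).differentiableAt (by simp)
    · exact differentiableAt_coordChange hy hq
  have hL (i) : L (EuclideanSpace.single i 1) = ∑ k, J k i • EuclideanSpace.single k (1 : ℝ) := by
    have h := b.sum_repr (L (b i))
    simp only [J, LinearMap.toMatrix_apply]
    simpa [b] using h.symm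
  have hmat : gram p y = J.transpose * gram q (coordChange p q y) * J := by
    ext i j
    rw [gram_apply_eq hf p hy, hfd, hfd, hL, hL]
    simp only [map_sum, map_smul, sum_inner, inner_sum, real_inner_smul_left,
      real_inner_smul_right, Matrix.mul_apply, Matrix.transpose_apply, Finset.sum_mul,
      gram_apply_eq hf q hyq]
    exact Finset.sum_congr rfl fun _ _ ↦ Finset.sum_congr rfl fun _ _ ↦ by ring
  have hdet : (gram p y).det = L.det ^ 2 * (gram q (coordChange p q y)).det := by
    rw [hmat, Matrix.det_mul, Matrix.det_mul, Matrix.det_transpose,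
      show J.det = L.det from LinearMap.det_toMatrix b _]
    ring
  rw [hdet, Real.sqrt_mul (sq_nonneg _), Real.sqrt_sq_eq_abs]

variable [MeasurableSpace M] [BorelSpace M]

/-- Change of variables along the coordinate change, whose Jacobian is absorbed by
`sqrt_det_gram_coordChange`. This is the agreement on overlaps that makes the supremum of the chart
measures meaningful. -/
theorem chartVolume_eq_of_subset (hf : IsIsometricEmbedding (n := n) f) {p q : M} {A : Set M}
    (hA : MeasurableSet A) (hp : A ⊆ (chartAt 𝔼 p).source) (hq : A ⊆ (chartAt 𝔼 q).source) :
    chartVolume (n := n) q A = chartVolume (n := n) p A := by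
  rw [chartVolume_apply p hA, chartVolume_apply q hA]
  have himg : (chartAt 𝔼 q).target ∩ (chartAt 𝔼 q).symm ⁻¹' A =
      coordChange p q '' ((chartAt 𝔼 p).target ∩ (chartAt 𝔼 p).symm ⁻¹' A) := by
    ext z
    constructor
    · rintro ⟨hz, hzA⟩
      refine ⟨chartAt 𝔼 p ((chartAt 𝔼 q).symm z), ⟨(chartAt 𝔼 p).map_source (hp hzA), ?_⟩, ?_⟩
      · rw [Set.mem_preimage, (chartAt 𝔼 p).left_inv (hp hzA)]
        exact hzA
      · simp [coordChange, (chartAt 𝔼 p).left_inv (hp hzA), (chartAt 𝔼 q).right_inv hz]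
    · rintro ⟨y, ⟨hy, hyA⟩, rfl⟩
      refine ⟨(chartAt 𝔼 q).map_source (hq hyA), ?_⟩
      simpa [coordChange, (chartAt 𝔼 q).left_inv (hq hyA)] using hyA
  rw [himg, lintegral_image_eq_lintegral_abs_det_fderiv_mul volume
    (measurableSet_target_inter_preimage p hA)
    (fun y hy ↦ (differentiableAt_coordChange hy.1 (hq hy.2)).hasFDerivAt.hasFDerivWithinAt)]
  · refine setLIntegral_congr_fun (measurableSet_target_inter_preimage p hA) fun y hy ↦ ?_
    rw [← ENNReal.ofReal_mul (abs_nonneg _), sqrt_det_gram_coordChange hf hy.1 (hq hy.2)]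
  · intro y hy z hz hyz
    have h1 := (chartAt 𝔼 q).injOn (hq hy.2) (hq hz.2) hyz
    exact (chartAt 𝔼 p).symm.injOn hy.1 hz.1 h1

/-- On a chart domain, the Riemannian volume is given by the formula in that chart. -/
theorem riemannianVolume_restrict_source (hf : IsIsometricEmbedding (n := n) f) (p : M) :
    (riemannianVolume n M).restrict (chartAt 𝔼 p).source = chartVolume (n := n) p := by
  have hs := (chartAt 𝔼 p).open_source.measurableSet
  -- A measure equal to `chartVolume p` on the chart domain and as large as possible outside
  -- dominates every `chartVolume q`, hence their supremum.
  have hle : riemannianVolume n M ≤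
      chartVolume (n := n) p + (⊤ : Measure M).restrict (chartAt 𝔼 p).sourceᶜ := by
    refine iSup_le fun q ↦ Measure.le_iff.2 fun A hA ↦ ?_
    rw [Measure.add_apply, Measure.restrict_apply hA, ← measure_inter_add_sdiff A hs]
    refine add_le_add ?_ (Measure.le_iff'.1 le_top _)
    rw [← chartVolume_inter_source q, chartVolume_eq_of_subset hf
      ((hA.inter hs).inter (chartAt 𝔼 q).open_source.measurableSet)
      (Set.inter_subset_left.trans Set.inter_subset_right) Set.inter_subset_right]
    exact measure_mono (Set.inter_subset_left.trans Set.inter_subset_left)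
  ext A hA
  rw [Measure.restrict_apply hA]
  refine le_antisymm ?_ ?_
  · refine (Measure.le_iff'.1 hle _).trans ?_
    rw [Measure.add_apply, Measure.restrict_apply (hA.inter hs), Set.inter_assoc,
      Set.inter_compl_self, Set.inter_empty, measure_empty, add_zero]
    exact measure_mono Set.inter_subset_left
  · rw [← chartVolume_inter_source p]
    exact Measure.le_iff'.1 (le_iSup (fun p : M ↦ chartVolume (n := n) p) p) _

/-- Near each point the density is bounded on a compact neighbourhood in the chart; compactness of
`M` makes local finiteness global. -/
theorem isFiniteMeasure_riemannianVolume [CompactSpace M]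
    (hf : IsIsometricEmbedding (n := n) f) : IsFiniteMeasure (riemannianVolume n M) := by
  refine ⟨isCompact_univ.measure_lt_top_of_nhdsWithin fun x _ ↦ ?_⟩
  have hx := mem_chart_target 𝔼 x
  obtain ⟨K, hK, hKt, hKc⟩ := local_compact_nhds ((chartAt 𝔼 x).open_target.mem_nhds hx)
  obtain ⟨C, hC⟩ := hKc.exists_bound_of_continuousOn ((continuousOn_sqrt_det_gram hf x).mono hKt)
  have hmem : (chartAt 𝔼 x).source ∩ chartAt 𝔼 x ⁻¹' (interior K) ∈ nhds x :=
    ((chartAt 𝔼 x).isOpen_inter_preimage isOpen_interior).mem_nhds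
      ⟨mem_chart_source _ x, mem_interior_iff_mem_nhds.2 hK⟩
  refine ⟨_, mem_nhdsWithin_of_mem_nhds hmem, ?_⟩
  have hmeas := ((chartAt 𝔼 x).isOpen_inter_preimage (isOpen_interior (s := K))).measurableSet
  have h1 : riemannianVolume n M ((chartAt 𝔼 x).source ∩ chartAt 𝔼 x ⁻¹' (interior K)) =
      chartVolume (n := n) x ((chartAt 𝔼 x).source ∩ chartAt 𝔼 x ⁻¹' (interior K)) := by
    rw [← riemannianVolume_restrict_source hf x, Measure.restrict_apply hmeas,
      Set.inter_eq_left.2 Set.inter_subset_left]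
  rw [h1, chartVolume_apply x hmeas]
  have hsub : (chartAt 𝔼 x).target ∩ (chartAt 𝔼 x).symm ⁻¹'
      ((chartAt 𝔼 x).source ∩ chartAt 𝔼 x ⁻¹' (interior K)) ⊆ K := by
    rintro y ⟨hy, -, hyK⟩
    rw [Set.mem_preimage, (chartAt 𝔼 x).right_inv hy] at hyK
    exact interior_subset hyK
  calc _ ≤ ∫⁻ y in K, ENNReal.ofReal √(gram x y).det := lintegral_mono_set hsub
    _ ≤ ∫⁻ _ in K, ENNReal.ofReal C := by
        refine setLIntegral_mono' hKc.measurableSet fun y hy ↦ ENNReal.ofReal_le_ofReal ?_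
        exact (le_abs_self _).trans (hC y hy)
    _ < ⊤ := by
        rw [setLIntegral_const]
        exact ENNReal.mul_lt_top ENNReal.ofReal_lt_top hKc.measure_lt_top

/-- The integral of a function carried by a chart domain, in that chart. -/
theorem integral_riemannianVolume_eq (hf : IsIsometricEmbedding (n := n) f) (p : M) {g : M → ℝ}
    (hg : Continuous g) (hsupp : ∀ x, x ∉ (chartAt 𝔼 p).source → g x = 0) :
    ∫ x, g x ∂(riemannianVolume n M) =
      ∫ y in (chartAt 𝔼 p).target, g ((chartAt 𝔼 p).symm y) * √(gram p y).det := by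
  rw [← setIntegral_eq_integral_of_forall_compl_eq_zero hsupp,
    riemannianVolume_restrict_source hf p, chartVolume,
    integral_map (aemeasurable_chart_symm p _) hg.measurable.aestronglyMeasurable,
    integral_withDensity_eq_integral_toReal_smul₀]
  · refine integral_congr_ae (Filter.Eventually.of_forall fun y ↦ ?_)
    dsimp only
    rw [ENNReal.toReal_ofReal (Real.sqrt_nonneg _), smul_eq_mul, mul_comm]
  · exact ((continuousOn_sqrt_det_gram hf p).aemeasurable
      (chartAt 𝔼 p).open_target.measurableSet).ennreal_ofReal
  · exact Filter.Eventually.of_forall fun y ↦ ENNReal.ofReal_lt_top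

end Volume

/-! ### Coordinate gradients and the divergence theorem on the manifold -/

section DivergenceTheorem

variable {n : ℕ} {M : Type*} [TopologicalSpace M] [ChartedSpace (EuclideanSpace ℝ (Fin n)) M]
  {N : ℕ}

local notation "𝔼" => EuclideanSpace ℝ (Fin n)

theorem mvfderiv_euclidean_apply {U : M → EuclideanSpace ℝ (Fin N)} {x : M}
    (hU : MDifferentiableAt (𝓡 n) (𝓡 N) U x) (v : TangentSpace (𝓡 n) x) (a : Fin N) :
    mvfderiv (𝓡 n) U x v a = mvfderiv (𝓡 n) (fun y ↦ U y a) x v := by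
  have h := mfderiv_comp (I := 𝓡 n) (I' := 𝓡 N) (I'' := 𝓘(ℝ)) x
    (EuclideanSpace.proj (𝕜 := ℝ) a).mdifferentiableAt hU
  rw [ContinuousLinearMap.mfderiv_eq] at h
  exact (congrArg (fun L ↦ L v) h).symm

theorem contMDiff_euclidean_apply {U : M → EuclideanSpace ℝ (Fin N)}
    (hU : ContMDiff (𝓡 n) (𝓡 N) ∞ U) (a : Fin N) :
    ContMDiff (𝓡 n) 𝓘(ℝ) ∞ (fun y ↦ U y a) :=
  (EuclideanSpace.proj (𝕜 := ℝ) a).contMDiff.comp hU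

theorem mvfderiv_fun_sum {W ι : Type*} [NormedAddCommGroup W] [NormedSpace ℝ W] {u : ι → M → W}
    {x : M} (t : Finset ι) (hu : ∀ i ∈ t, MDifferentiableAt (𝓡 n) 𝓘(ℝ, W) (u i) x) :
    mvfderiv (𝓡 n) (fun y ↦ ∑ i ∈ t, u i y) x = ∑ i ∈ t, mvfderiv (𝓡 n) (u i) x := by
  classical
  -- Differentiability of the partial sums is carried along, since the induction step needs it.
  have h : MDifferentiableAt (𝓡 n) 𝓘(ℝ, W) (fun y ↦ ∑ i ∈ t, u i y) x ∧
      mvfderiv (𝓡 n) (fun y ↦ ∑ i ∈ t, u i y) x = ∑ i ∈ t, mvfderiv (𝓡 n) (u i) x := by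
    induction t using Finset.induction_on with
    | empty =>
      simp only [Finset.sum_empty]
      exact ⟨mdifferentiableAt_const, mvfderiv_const 0⟩
    | insert i t hi ih =>
      simp only [Finset.forall_mem_insert] at hu
      obtain ⟨h1, h2⟩ := ih hu.2
      simp only [Finset.sum_insert hi]
      exact ⟨hu.1.add h1, by rw [mvfderiv_fun_add hu.1 h1, h2]⟩
  exact h.2

variable [RiemannianBundle (fun x : M ↦ TangentSpace (𝓡 n) x)]

/-- The gradient of the `a`-th coordinate function of `f : M → ℝᴺ`. -/
def coordGrad (f : M → EuclideanSpace ℝ (Fin N)) (a : Fin N) (x : M) : TangentSpace (𝓡 n) x :=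
  grad (fun y ↦ f y a) x

variable {f : M → EuclideanSpace ℝ (Fin N)}

theorem mvfderiv_apply_eq_inner_coordGrad (hf : IsIsometricEmbedding (n := n) f) (x : M)
    (v : TangentSpace (𝓡 n) x) (a : Fin N) :
    mvfderiv (𝓡 n) f x v a = inner ℝ (coordGrad f a x) v := by
  rw [mvfderiv_euclidean_apply (hf.isSmoothEmbedding.contMDiff.mdifferentiable (by simp) x),
    coordGrad, inner_grad]

theorem inner_eq_sum_coordGrad (hf : IsIsometricEmbedding (n := n) f) (x : M)
    (v w : TangentSpace (𝓡 n) x) :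
    ∑ a, inner ℝ (coordGrad f a x) v * inner ℝ (coordGrad f a x) w = inner ℝ v w := by
  rw [← hf.inner_eq, PiLp.inner_apply]
  refine Finset.sum_congr rfl fun a _ ↦ ?_
  rw [mvfderiv_apply_eq_inner_coordGrad hf, mvfderiv_apply_eq_inner_coordGrad hf]
  simp [mul_comm]

/-- The gradients of the coordinate functions form a tight frame. -/
theorem sum_inner_smul_coordGrad (hf : IsIsometricEmbedding (n := n) f) (x : M)
    (v : TangentSpace (𝓡 n) x) :
    ∑ a, inner ℝ (coordGrad f a x) v • coordGrad f a x = v := by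
  refine ext_inner_right ℝ fun w ↦ ?_
  rw [sum_inner, ← inner_eq_sum_coordGrad hf]
  exact Finset.sum_congr rfl fun a _ ↦ real_inner_smul_left _ _ _

variable [IsManifold (𝓡 n) ∞ M]

/-- Substituting `Eₐ = ∑ gˡᵏ (∂ₖ fₐ) ∂ₗ` identifies the frame expression `∑ Eₐ(Uₐ)` of the
divergence with the chart expression of `integral_divergence_eq_zero`. -/
theorem sum_mvfderiv_coordGrad_chart_symm (hf : IsIsometricEmbedding (n := n) f)
    {U : M → EuclideanSpace ℝ (Fin N)} (hU : ContMDiff (𝓡 n) (𝓡 N) ∞ U) (p : M) {y : 𝔼}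
    (hy : y ∈ (chartAt 𝔼 p).target) :
    ∑ a, mvfderiv (𝓡 n) U ((chartAt 𝔼 p).symm y) (coordGrad f a ((chartAt 𝔼 p).symm y)) a =
      ∑ k, ∑ l, (gram p y)⁻¹ k l *
        inner ℝ (fderiv ℝ (f ∘ (chartAt 𝔼 p).symm) y (EuclideanSpace.single k 1))
          (fderiv ℝ (U ∘ (chartAt 𝔼 p).symm) y (EuclideanSpace.single l 1)) := by
  have hinv : (gram p y)⁻¹.IsHermitian := by
    rw [gram_eq p hy]
    exact (Matrix.isHermitian_gram ℝ (coordBasis p hy)).inv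
  have hfd {u : M → EuclideanSpace ℝ (Fin N)} (hu : ContMDiff (𝓡 n) (𝓡 N) ∞ u) (k : Fin n) :
      fderiv ℝ (u ∘ (chartAt 𝔼 p).symm) y (EuclideanSpace.single k 1) =
        mvfderiv (𝓡 n) u ((chartAt 𝔼 p).symm y) (coordBasis p hy k) := by
    rw [fderiv_comp_chart_symm hu p hy, coe_coordBasis]
    rfl
  have hE (a) : mvfderiv (𝓡 n) U ((chartAt 𝔼 p).symm y) (coordGrad f a ((chartAt 𝔼 p).symm y)) a =
      ∑ l, ∑ k, (gram p y)⁻¹ l k *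
        (mvfderiv (𝓡 n) f ((chartAt 𝔼 p).symm y) (coordBasis p hy k) a *
          mvfderiv (𝓡 n) U ((chartAt 𝔼 p).symm y) (coordBasis p hy l) a) := by
    have h := sum_gram_inv_mul_inner_smul (coordBasis p hy)
      (coordGrad f a ((chartAt 𝔼 p).symm y))
    conv_lhs => rw [← h]
    rw [← gram_eq p hy, map_sum, WithLp.ofLp_sum, Finset.sum_apply]
    refine Finset.sum_congr rfl fun l _ ↦ ?_
    rw [map_smul, PiLp.smul_apply, smul_eq_mul, Finset.sum_mul]
    refine Finset.sum_congr rfl fun k _ ↦ ?_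
    rw [mvfderiv_apply_eq_inner_coordGrad hf, real_inner_comm, mul_assoc]
  rw [Finset.sum_congr rfl fun a _ ↦ hE a, Finset.sum_comm,
    Finset.sum_congr rfl fun l _ ↦ Finset.sum_comm, Finset.sum_comm]
  refine Finset.sum_congr rfl fun k _ ↦ Finset.sum_congr rfl fun l _ ↦ ?_
  rw [← Finset.mul_sum, hfd hU, hfd hf.isSmoothEmbedding.contMDiff, PiLp.inner_apply,
    ← hinv.apply k l]
  congr 1
  exact Finset.sum_congr rfl fun a _ ↦ by simp [mul_comm]

variable [IsContMDiffRiemannianBundle (𝓡 n) ∞ (EuclideanSpace ℝ (Fin n))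
    (fun x : M ↦ TangentSpace (𝓡 n) x)]

theorem contMDiff_coordGrad (hf : IsIsometricEmbedding (n := n) f) (a : Fin N) :
    ContMDiff (𝓡 n) ((𝓡 n).prod 𝓘(ℝ, EuclideanSpace ℝ (Fin n))) ∞
      (T% (coordGrad f a : Π x : M, TangentSpace (𝓡 n) x)) :=
  contMDiff_grad (contMDiff_euclidean_apply hf.isSmoothEmbedding.contMDiff a)

variable [MeasurableSpace M] [BorelSpace M] [CompactSpace M]

/-- A field supported in one chart domain, read in the chart and extended by zero, is smooth because
the image of its support is compact. The local divergence theorem then applies. -/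
theorem integral_sum_mvfderiv_coordGrad_of_tsupport (hf : IsIsometricEmbedding (n := n) f)
    {U : M → EuclideanSpace ℝ (Fin N)} (hU : ContMDiff (𝓡 n) (𝓡 N) ∞ U)
    (htan : ∀ x, ∃ X : TangentSpace (𝓡 n) x, U x = mvfderiv (𝓡 n) f x X) (p : M)
    (hp : tsupport U ⊆ (chartAt 𝔼 p).source) :
    ∫ x, ∑ a, mvfderiv (𝓡 n) U x (coordGrad f a x) a ∂(riemannianVolume n M) = 0 := by
  classical
  let c := chartAt 𝔼 p
  have hcont : Continuous (fun x ↦ ∑ a, mvfderiv (𝓡 n) U x (coordGrad f a x) a) := by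
    refine continuous_finsetSum _ fun a _ ↦ ?_
    exact (contMDiff_euclidean_apply (contMDiff_mvfderiv_apply hU (contMDiff_coordGrad hf a))
      a).continuous
  rw [integral_riemannianVolume_eq hf p hcont]
  · let w : 𝔼 → EuclideanSpace ℝ (Fin N) := c.target.indicator (U ∘ c.symm)
    let K : Set 𝔼 := c '' tsupport U
    have hK : IsCompact K :=
      (isClosed_tsupport U).isCompact.image_of_continuousOn (c.continuousOn.mono hp)
    have hKt : K ⊆ c.target := by
      rintro _ ⟨x, hx, rfl⟩
      exact c.map_source (hp hx)
    have hwt (y) (hy : y ∈ c.target) : w y = U (c.symm y) := Set.indicator_of_mem hy _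
    have hw0 (y) (hy : y ∉ K) : w y = 0 := by
      by_cases hyt : y ∈ c.target
      · rw [hwt y hyt]
        by_contra h
        exact hy ⟨c.symm y, subset_tsupport U h, c.right_inv hyt⟩
      · exact Set.indicator_of_notMem hyt _
    have hwK : tsupport w ⊆ K := closure_minimal
      (fun y hy ↦ by_contra fun h ↦ hy (hw0 y h)) hK.isClosed
    have hwev (y) (hy : y ∈ c.target) : w =ᶠ[nhds y] U ∘ c.symm := by
      filter_upwards [c.open_target.mem_nhds hy] with z hz using Set.indicator_of_mem hz _
    have hw : ContDiff ℝ ∞ w := by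
      rw [contDiff_iff_contDiffAt]
      intro y
      by_cases hy : y ∈ K
      · exact ((contDiffOn_comp_chart_symm hU p).contDiffAt
          (c.open_target.mem_nhds (hKt hy))).congr_of_eventuallyEq (hwev y (hKt hy))
      · have h0 : w =ᶠ[nhds y] fun _ ↦ 0 := by
          filter_upwards [hK.isClosed.isOpen_compl.mem_nhds hy] with z hz using hw0 z hz
        exact contDiffAt_const.congr_of_eventuallyEq h0
    have hmain := integral_divergence_eq_zero c.open_target
      (contDiffOn_comp_chart_symm hf.isSmoothEmbedding.contMDiff p) hw
      (hK.of_isClosed_subset (isClosed_tsupport w) hwK) (hwK.trans hKt) (fun y hy ↦ ?_)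
      (fun y hy ↦ gram_apply_eq hf p hy) (fun y hy ↦ det_gram_pos p hy)
    · rw [← hmain]
      refine setIntegral_congr_fun c.open_target.measurableSet fun y hy ↦ ?_
      simp only
      rw [sum_mvfderiv_coordGrad_chart_symm hf hU p hy, (hwev y hy).fderiv_eq]
    · obtain ⟨X, hX⟩ := htan (c.symm y)
      obtain ⟨v, hv⟩ := (mdifferentiable_chart (I := 𝓡 n) p).symm.mfderiv_surjective hy X
      refine ⟨v, ?_⟩
      rw [hwt y hy, hX, ← hv]
      exact (fderiv_comp_chart_symm hf.isSmoothEmbedding.contMDiff p hy v).symm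
  · intro x hx
    have h0 : U =ᶠ[nhds x] fun _ ↦ 0 := notMem_tsupport_iff_eventuallyEq.1 fun h ↦ hx (hp h)
    have h1 : mvfderiv (𝓡 n) U x = 0 :=
      (h0.mfderiv_eq (I := 𝓡 n) (I' := 𝓡 N)).trans mfderiv_const
    simp [h1]

/-- The divergence theorem: `U` is a tangential field, given by its values in the ambient space. -/
theorem integral_sum_mvfderiv_coordGrad [T2Space M] (hf : IsIsometricEmbedding (n := n) f)
    {U : M → EuclideanSpace ℝ (Fin N)} (hU : ContMDiff (𝓡 n) (𝓡 N) ∞ U)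
    (htan : ∀ x, ∃ X : TangentSpace (𝓡 n) x, U x = mvfderiv (𝓡 n) f x X) :
    ∫ x, ∑ a, mvfderiv (𝓡 n) U x (coordGrad f a x) a ∂(riemannianVolume n M) = 0 := by
  obtain ⟨t, ht⟩ := isCompact_univ.elim_finite_subcover
    (fun p : M ↦ (chartAt 𝔼 p).source) (fun p ↦ (chartAt 𝔼 p).open_source)
    (fun x _ ↦ Set.mem_iUnion.2 ⟨x, mem_chart_source 𝔼 x⟩)
  obtain ⟨ρ, hρ⟩ := SmoothPartitionOfUnity.exists_isSubordinate (𝓡 n) (isClosed_univ (X := M))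
    (fun p : t ↦ (chartAt 𝔼 p.1).source) (fun p ↦ (chartAt 𝔼 p.1).open_source)
    (fun x hx ↦ by simpa using ht hx)
  have hρU (i) : ContMDiff (𝓡 n) (𝓡 N) ∞ (fun x ↦ ρ i x • U x) := (ρ i).contMDiff.smul hU
  have hsum : U = fun x ↦ ∑ i, ρ i x • U x := by
    ext1 x
    rw [← Finset.sum_smul, ← finsum_eq_sum_of_fintype, ρ.sum_eq_one (Set.mem_univ x), one_smul]
  have hint (i) : Integrable
      (fun x ↦ ∑ a, mvfderiv (𝓡 n) (fun x ↦ ρ i x • U x) x (coordGrad f a x) a)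
      (riemannianVolume n M) := by
    have := isFiniteMeasure_riemannianVolume hf
    refine Continuous.integrable_of_hasCompactSupport ?_ (HasCompactSupport.of_compactSpace _)
    refine continuous_finsetSum _ fun a _ ↦ ?_
    exact (contMDiff_euclidean_apply (contMDiff_mvfderiv_apply (hρU i) (contMDiff_coordGrad hf a))
      a).continuous
  have hpt (x) : ∑ a, mvfderiv (𝓡 n) U x (coordGrad f a x) a =
      ∑ i, ∑ a, mvfderiv (𝓡 n) (fun x ↦ ρ i x • U x) x (coordGrad f a x) a := by
    have h1 : mvfderiv (𝓡 n) U x = ∑ i, mvfderiv (𝓡 n) (fun x ↦ ρ i x • U x) x := by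
      conv_lhs => rw [hsum]
      exact mvfderiv_fun_sum _ fun i _ ↦ (hρU i).mdifferentiable (by simp) x
    rw [h1, Finset.sum_comm]
    simp
  simp only [hpt]
  rw [integral_finsetSum _ fun i _ ↦ hint i]
  refine Finset.sum_eq_zero fun i _ ↦
    integral_sum_mvfderiv_coordGrad_of_tsupport hf (hρU i) (fun x ↦ ?_) i.1
      ((closure_mono (Function.support_smul_subset_left _ _)).trans (hρ i))
  obtain ⟨X, hX⟩ := htan x
  exact ⟨ρ i x • X, by rw [map_smul, hX]⟩

/-- The matrix `⟨E_b, Eₐ⟩` is the orthogonal projection of `ℝᴺ` onto the tangent space, so `htan`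
says that `(uₐ)` is tangential. All later integrations by parts use this component form. -/
theorem integral_sum_mvfderiv_eq_zero [T2Space M] (hf : IsIsometricEmbedding (n := n) f)
    {u : Fin N → M → ℝ} (hu : ∀ a, ContMDiff (𝓡 n) 𝓘(ℝ) ∞ (u a))
    (htan : ∀ x a, ∑ b, u b x * inner ℝ (coordGrad (n := n) f b x) (coordGrad f a x) = u a x) :
    ∫ x, ∑ a, mvfderiv (𝓡 n) (u a) x (coordGrad f a x) ∂(riemannianVolume n M) = 0 := by
  let U : M → EuclideanSpace ℝ (Fin N) := fun x ↦ WithLp.toLp 2 fun a ↦ u a x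
  have hU : ContMDiff (𝓡 n) (𝓡 N) ∞ U :=
    (EuclideanSpace.equiv (Fin N) ℝ).symm.contDiff.contMDiff.comp (contMDiff_pi_space.2 hu)
  rw [← integral_sum_mvfderiv_coordGrad hf hU fun x ↦
    ⟨∑ b, u b x • coordGrad f b x, PiLp.ext fun a ↦ ?_⟩]
  · refine integral_congr_ae (Filter.Eventually.of_forall fun x ↦ ?_)
    exact Finset.sum_congr rfl fun a _ ↦
      (mvfderiv_euclidean_apply (hU.mdifferentiable (by simp) x) _ a).symm
  · rw [mvfderiv_apply_eq_inner_coordGrad hf, inner_sum]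
    simp only [real_inner_smul_right]
    refine (htan x a).symm.trans ?_
    exact Finset.sum_congr rfl fun b _ ↦ by rw [real_inner_comm]

end DivergenceTheorem

/-! ### Algebra of a tight frame and its second fundamental form -/

section TightFrame

variable {V : Type*} [NormedAddCommGroup V] [InnerProductSpace ℝ V] {N : ℕ} {E : Fin N → V}

/-- A tight frame spans, so symmetry (`ε = 1`) or antisymmetry (`ε = -1`) of a bilinear form can be
tested on it. -/
theorem inner_eq_mul_inner_of_frame (hE : ∀ v, ∑ a, inner ℝ (E a) v • E a = v) (A : V →ₗ[ℝ] V)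
    (ε : ℝ) (h : ∀ a b, inner ℝ (A (E a)) (E b) = ε * inner ℝ (A (E b)) (E a)) (v w : V) :
    inner ℝ (A v) w = ε * inner ℝ (A w) v := by
  have key (v w : V) : inner ℝ (A v) w =
      ∑ a, ∑ b, inner ℝ (E a) v * inner ℝ (E b) w * inner ℝ (A (E a)) (E b) := by
    conv_lhs => rw [← hE v, ← hE w]
    simp only [map_sum, map_smul, sum_inner, inner_sum, real_inner_smul_left,
      real_inner_smul_right]
    rw [Finset.sum_comm]
    exact Finset.sum_congr rfl fun _ _ ↦ Finset.sum_congr rfl fun _ _ ↦ by ring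
  rw [key, key, Finset.mul_sum, Finset.sum_comm]
  refine Finset.sum_congr rfl fun a _ ↦ ?_
  rw [Finset.mul_sum]
  refine Finset.sum_congr rfl fun b _ ↦ ?_
  rw [h]
  ring

/-- A tight frame together with the second fundamental form `⟪H a v, w⟫`, in the sense of an
isometric immersion. -/
structure IsSecondForm (E : Fin N → V) (H : Fin N → V →ₗ[ℝ] V) : Prop where
  frame : ∀ v, ∑ a, inner ℝ (E a) v • E a = v
  symm : ∀ a v w, inner ℝ (H a v) w = inner ℝ (H a w) v
  orth : ∀ v w, ∑ a, inner ℝ (H a v) w • E a = 0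

/-- The trilinear form `T(v, w, z) = ∑ ⟨Hₐ v, w⟩ ⟨Eₐ, z⟩` is symmetric in `v, w` by `hs` and
antisymmetric in `w, z` by `ha`. Such a form vanishes, as in the uniqueness of the Levi-Civita
connection, and this is the normality `orth`. -/
theorem IsSecondForm.of_frame {H : Fin N → V →ₗ[ℝ] V}
    (hE : ∀ v, ∑ a, inner ℝ (E a) v • E a = v)
    (hs : ∀ a b c, inner ℝ (H a (E b)) (E c) = inner ℝ (H a (E c)) (E b))
    (ha : ∀ v b c, ∑ a, (inner ℝ (H a v) (E b) * inner ℝ (E a) (E c) +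
      inner ℝ (E a) (E b) * inner ℝ (H a v) (E c)) = 0) : IsSecondForm E H := by
  have hsymm (a v w) : inner ℝ (H a v) w = inner ℝ (H a w) v := by
    simpa using inner_eq_mul_inner_of_frame hE (H a) 1 (fun b c ↦ by rw [hs, one_mul]) v w
  refine ⟨hE, hsymm, fun v w ↦ ?_⟩
  have hT (v z w) : inner ℝ (∑ a, inner ℝ (E a) z • H a v) w =
      ∑ a, inner ℝ (H a v) w * inner ℝ (E a) z := by
    simp only [sum_inner, real_inner_smul_left, mul_comm]
  have hanti (v w z) : ∑ a, inner ℝ (H a v) w * inner ℝ (E a) z =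
      -∑ a, inner ℝ (H a v) z * inner ℝ (E a) w := by
    let A : V →ₗ[ℝ] V := ∑ a, (innerₗ V (E a)).smulRight (H a v)
    have hA (z) : A z = ∑ a, inner ℝ (E a) z • H a v := by simp [A]
    have h := inner_eq_mul_inner_of_frame hE A (-1) (fun b c ↦ ?_) z w
    · rw [hA, hA, hT, hT] at h
      rw [h]
      ring
    · rw [hA, hA, hT, hT]
      have := ha v b c
      rw [Finset.sum_add_distrib] at this
      rw [neg_one_mul, eq_neg_iff_add_eq_zero, add_comm, ← this]
      congr 1
      exact Finset.sum_congr rfl fun a _ ↦ by ring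
  have hsw (v w z) : ∑ a, inner ℝ (H a v) w * inner ℝ (E a) z =
      ∑ a, inner ℝ (H a w) v * inner ℝ (E a) z :=
    Finset.sum_congr rfl fun a _ ↦ by rw [hsymm]
  refine ext_inner_right ℝ fun z ↦ ?_
  simp only [sum_inner, real_inner_smul_left, inner_zero_left]
  -- Six alternating transpositions return `T(v, w, z)` to itself with the sign `-1`.
  have h1 := hsw v w z
  have h2 := hanti w v z
  have h3 := hsw w z v
  have h4 := hanti z w v
  have h5 := hsw z v w
  have h6 := hanti v z w
  linarith

namespace IsSecondForm

variable {H : Fin N → V →ₗ[ℝ] V}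

/-- The trace of the `a`-th component of the second fundamental form. -/
def lap (E : Fin N → V) (H : Fin N → V →ₗ[ℝ] V) (a : Fin N) : ℝ :=
  ∑ b, inner ℝ (H a (E b)) (E b)

/-- With `Hₐ = ∇Eₐ` this reads `∑ ∇_{Eₐ} Eₐ = 0`: expanding the argument in the frame reduces it to
normality. It is what lets the frame be treated as if it were parallel in second-order traces. -/
theorem sum_apply_self (h : IsSecondForm E H) : ∑ a, H a (E a) = 0 := by
  refine ext_inner_right ℝ fun w ↦ ?_
  rw [sum_inner, inner_zero_left]
  have h1 (a) : inner ℝ (H a (E a)) w = ∑ b, inner ℝ (E b) (E a) * inner ℝ (H a w) (E b) := by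
    rw [h.symm]
    conv_lhs => rw [← h.frame (E a)]
    simp only [inner_sum, real_inner_smul_right]
  rw [Finset.sum_congr rfl fun a _ ↦ h1 a, Finset.sum_comm]
  refine Finset.sum_eq_zero fun b _ ↦ ?_
  have h2 := congrArg (fun z ↦ inner ℝ z (E b)) (h.orth w (E b))
  simp only [sum_inner, real_inner_smul_left, inner_zero_left] at h2
  rw [← h2]
  exact Finset.sum_congr rfl fun a _ ↦ by rw [real_inner_comm, mul_comm]

/-- The trace of a normal-valued form is normal: the mean curvature vector has no tangential part.
-/
theorem sum_lap_smul (h : IsSecondForm E H) : ∑ a, lap E H a • E a = 0 := by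
  simp only [lap, Finset.sum_smul]
  rw [Finset.sum_comm]
  exact Finset.sum_eq_zero fun b _ ↦ h.orth _ _

theorem apply_eq_sum (h : IsSecondForm E H) (a : Fin N) (v : V) :
    H a v = ∑ c, inner ℝ (H a v) (E c) • E c := by
  conv_lhs => rw [← h.frame (H a v)]
  exact Finset.sum_congr rfl fun c _ ↦ by rw [real_inner_comm]

section Clifford

variable {S : Type*} [AddCommGroup S] [Module ℝ S] (c : V →ₗ[ℝ] S →ₗ[ℝ] S)

/-- Expanding `Hₐ v` in the frame moves the coefficients onto `Eₐ`, where normality annihilates the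
sum. -/
theorem sum_clifford_apply (h : IsSecondForm E H) (T : V →ₗ[ℝ] S) (v : V) :
    ∑ a, c (E a) (T (H a v)) = 0 := by
  have h1 (a) : c (E a) (T (H a v)) = ∑ b, c (inner ℝ (H a v) (E b) • E a) (T (E b)) := by
    conv_lhs => rw [h.apply_eq_sum a v]
    simp
  rw [Finset.sum_congr rfl fun a _ ↦ h1 a, Finset.sum_comm]
  refine Finset.sum_eq_zero fun b _ ↦ ?_
  rw [← LinearMap.sum_apply, ← map_sum, h.orth, map_zero, LinearMap.zero_apply]

/-- The coefficients `⟨Hₐ E_b, E_d⟩` are symmetric in `b, d`, so only the symmetric part of `E_b ·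
E_d`, a scalar by the Clifford relation `hc`, survives; it gives minus the trace. -/
theorem sum_clifford_clifford (h : IsSecondForm E H)
    (hc : ∀ v w s, c v (c w s) + c w (c v s) = (-2 * inner ℝ v w : ℝ) • s) (a : Fin N) (s : S) :
    ∑ b, c (E b) (c (H a (E b)) s) = -lap E H a • s := by
  have h1 : ∑ b, c (E b) (c (H a (E b)) s) =
      ∑ b, ∑ d, inner ℝ (H a (E b)) (E d) • c (E b) (c (E d) s) := by
    refine Finset.sum_congr rfl fun b _ ↦ ?_
    conv_lhs => rw [h.apply_eq_sum a (E b)]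
    simp
  have h2 : ∑ b, c (E b) (c (H a (E b)) s) =
      ∑ b, ∑ d, inner ℝ (H a (E b)) (E d) • c (E d) (c (E b) s) := by
    rw [h1, Finset.sum_comm]
    exact Finset.sum_congr rfl fun b _ ↦ Finset.sum_congr rfl fun d _ ↦ by rw [h.symm]
  have h3 : (2 : ℝ) • ∑ b, c (E b) (c (H a (E b)) s) = (2 : ℝ) • (-lap E H a • s) := by
    rw [two_smul]
    nth_rewrite 1 [h1]
    rw [h2, ← Finset.sum_add_distrib]
    have h4 (b) : (∑ d, inner ℝ (H a (E b)) (E d) • c (E b) (c (E d) s)) +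
        (∑ d, inner ℝ (H a (E b)) (E d) • c (E d) (c (E b) s)) =
        (-2 * inner ℝ (H a (E b)) (E b)) • s := by
      rw [← Finset.sum_add_distrib]
      simp only [← smul_add, hc, smul_smul, ← Finset.sum_smul]
      congr 1
      have h5 : inner ℝ (H a (E b)) (E b) =
          ∑ d, inner ℝ (E d) (E b) * inner ℝ (H a (E b)) (E d) := by
        conv_lhs => enter [3]; rw [← h.frame (E b)]
        simp only [inner_sum, real_inner_smul_right]
      rw [h5, Finset.mul_sum]
      exact Finset.sum_congr rfl fun d _ ↦ by rw [real_inner_comm (E d) (E b)]; ring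
    rw [Finset.sum_congr rfl fun b _ ↦ h4 b, ← Finset.sum_smul, ← Finset.mul_sum, smul_smul]
    congr 1
    rw [lap]
    ring
  exact smul_right_injective S (two_ne_zero (α := ℝ)) h3

end Clifford

end IsSecondForm

end TightFrame

/-! ### Lie brackets, the Levi-Civita connection and the Hessians of the coordinates -/

section LeviCivita

variable {n : ℕ} {M : Type*} [TopologicalSpace M] [ChartedSpace (EuclideanSpace ℝ (Fin n)) M]
  [IsManifold (𝓡 n) ∞ M]

local notation "𝔼" => EuclideanSpace ℝ (Fin n)

section LieBracket

open VectorField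

/-- Compare the Jacobi identity for `V, W, uZ` with the one for `V, W, Z`: after the Leibniz rule
only second derivatives of `u`, multiplied by `Z`, are left. -/
theorem mvfderiv_mlieBracket_smul {u : M → ℝ} (hu : ContMDiff (𝓡 n) 𝓘(ℝ) ∞ u)
    {V W Z : Π x : M, TangentSpace (𝓡 n) x}
    (hV : ContMDiff (𝓡 n) ((𝓡 n).prod 𝓘(ℝ, 𝔼)) ∞ (T% V))
    (hW : ContMDiff (𝓡 n) ((𝓡 n).prod 𝓘(ℝ, 𝔼)) ∞ (T% W))
    (hZ : ContMDiff (𝓡 n) ((𝓡 n).prod 𝓘(ℝ, 𝔼)) ∞ (T% Z)) (x : M) :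
    mvfderiv (𝓡 n) u x (mlieBracket (𝓡 n) V W x) • Z x =
      (mvfderiv (𝓡 n) (fun y ↦ mvfderiv (𝓡 n) u y (W y)) x (V x) -
        mvfderiv (𝓡 n) (fun y ↦ mvfderiv (𝓡 n) u y (V y)) x (W x)) • Z x := by
  have hM3 : IsManifold (𝓡 n) (minSmoothness ℝ 3) M := by
    rw [minSmoothness_of_isRCLikeNormedField]
    infer_instance
  have hMi : IsManifold (𝓡 n) (∞ + 1) M := by
    simpa using! (inferInstance : IsManifold (𝓡 n) ∞ M)
  have h2 {X : Π x : M, TangentSpace (𝓡 n) x}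
      (hX : ContMDiff (𝓡 n) ((𝓡 n).prod 𝓘(ℝ, 𝔼)) ∞ (T% X)) :
      ContMDiffAt (𝓡 n) ((𝓡 n).prod 𝓘(ℝ, 𝔼)) (minSmoothness ℝ 2) (T% X) x := by
    rw [minSmoothness_of_isRCLikeNormedField]
    exact (hX x).of_le (by simpa using ENat.LEInfty.out)
  have hd {X : Π x : M, TangentSpace (𝓡 n) x}
      (hX : ContMDiff (𝓡 n) ((𝓡 n).prod 𝓘(ℝ, 𝔼)) ∞ (T% X)) (y : M) :
      MDifferentiableAt (𝓡 n) ((𝓡 n).prod 𝓘(ℝ, 𝔼)) (T% X) y := hX.mdifferentiable (by simp) y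
  have hud {v : M → ℝ} (hv : ContMDiff (𝓡 n) 𝓘(ℝ) ∞ v) (y : M) :
      MDifferentiableAt (𝓡 n) 𝓘(ℝ) v y := hv.mdifferentiable (by simp) y
  have hbr {X Y : Π x : M, TangentSpace (𝓡 n) x}
      (hX : ContMDiff (𝓡 n) ((𝓡 n).prod 𝓘(ℝ, 𝔼)) ∞ (T% X))
      (hY : ContMDiff (𝓡 n) ((𝓡 n).prod 𝓘(ℝ, 𝔼)) ∞ (T% Y)) :
      ContMDiff (𝓡 n) ((𝓡 n).prod 𝓘(ℝ, 𝔼)) ∞ (T% (mlieBracket (𝓡 n) X Y)) := fun y ↦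
    ContMDiffAt.mlieBracket_vectorField (m := ⊤) (n := ⊤) (hX y) (hY y)
      (by rw [minSmoothness_of_isRCLikeNormedField]; simp)
  have huZ : ContMDiff (𝓡 n) ((𝓡 n).prod 𝓘(ℝ, 𝔼)) ∞ (T% (u • Z)) := hu.smul_section hZ
  have hJ := leibniz_identity_mlieBracket_apply (h2 hV) (h2 hW) (h2 huZ)
  have hJZ := leibniz_identity_mlieBracket_apply (h2 hV) (h2 hW) (h2 hZ)
  have hexp {X Y : Π x : M, TangentSpace (𝓡 n) x}
      (hX : ContMDiff (𝓡 n) ((𝓡 n).prod 𝓘(ℝ, 𝔼)) ∞ (T% X))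
      (hY : ContMDiff (𝓡 n) ((𝓡 n).prod 𝓘(ℝ, 𝔼)) ∞ (T% Y)) :
      mlieBracket (𝓡 n) X (mlieBracket (𝓡 n) Y (u • Z)) x =
        mvfderiv (𝓡 n) (fun y ↦ mvfderiv (𝓡 n) u y (Y y)) x (X x) • Z x +
          mvfderiv (𝓡 n) u x (Y x) • mlieBracket (𝓡 n) X Z x +
          (mvfderiv (𝓡 n) u x (X x) • mlieBracket (𝓡 n) Y Z x +
            u x • mlieBracket (𝓡 n) X (mlieBracket (𝓡 n) Y Z) x) := by
    have h1 : mlieBracket (𝓡 n) Y (u • Z) =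
        (fun y ↦ mvfderiv (𝓡 n) u y (Y y)) • Z + u • mlieBracket (𝓡 n) Y Z := by
      ext1 y
      exact mlieBracket_smul_right (hud hu y) (hd hZ y)
    have hYu := contMDiff_mvfderiv_apply hu hY
    rw [h1, mlieBracket_add_right (hd (hYu.smul_section hZ) x) (hd (hu.smul_section (hbr hY hZ)) x),
      mlieBracket_smul_right (hud hYu x) (hd hZ x),
      mlieBracket_smul_right (hud hu x) (hd (hbr hY hZ) x)]
  rw [hexp hV hW, hexp hW hV, mlieBracket_smul_right (hud hu x) (hd hZ x), hJZ] at hJ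
  rw [sub_smul, eq_sub_iff_add_eq]
  simp only [smul_add] at hJ
  linear_combination (norm := module) -hJ

end LieBracket

variable [RiemannianBundle (fun x : M ↦ TangentSpace (𝓡 n) x)]
  [IsContMDiffRiemannianBundle (𝓡 n) ∞ (EuclideanSpace ℝ (Fin n))
    (fun x : M ↦ TangentSpace (𝓡 n) x)]
  {N : ℕ} {f : M → EuclideanSpace ℝ (Fin N)}

/-- The Lie bracket of vector fields is the commutator of the derivations. -/
theorem mvfderiv_mlieBracket (hf : IsIsometricEmbedding (n := n) f)
    {u : M → ℝ} (hu : ContMDiff (𝓡 n) 𝓘(ℝ) ∞ u) {V W : Π x : M, TangentSpace (𝓡 n) x}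
    (hV : ContMDiff (𝓡 n) ((𝓡 n).prod 𝓘(ℝ, 𝔼)) ∞ (T% V))
    (hW : ContMDiff (𝓡 n) ((𝓡 n).prod 𝓘(ℝ, 𝔼)) ∞ (T% W)) (x : M) :
    mvfderiv (𝓡 n) u x (VectorField.mlieBracket (𝓡 n) V W x) =
      mvfderiv (𝓡 n) (fun y ↦ mvfderiv (𝓡 n) u y (W y)) x (V x) -
        mvfderiv (𝓡 n) (fun y ↦ mvfderiv (𝓡 n) u y (V y)) x (W x) := by
  -- The factor `Z x` cancels for a coordinate gradient that is nonzero at `x`. If there is none,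
  -- the tight frame identity forces the tangent space to be zero.
  by_cases h : ∃ a, coordGrad (n := n) f a x ≠ 0
  · obtain ⟨a, ha⟩ := h
    exact smul_left_injective ℝ ha
      (mvfderiv_mlieBracket_smul hu hV hW (contMDiff_coordGrad hf a) x)
  · push Not at h
    have h0 (v : TangentSpace (𝓡 n) x) : v = 0 := by
      rw [← sum_inner_smul_coordGrad hf x v]
      exact Finset.sum_eq_zero fun a _ ↦ by rw [h a, smul_zero]
    rw [h0 (VectorField.mlieBracket (𝓡 n) V W x), h0 (V x), h0 (W x)]
    simp

theorem contMDiff_inner_coordGrad (hf : IsIsometricEmbedding (n := n) f) (a b : Fin N) :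
    ContMDiff (𝓡 n) 𝓘(ℝ) ∞ (fun y ↦ inner ℝ (coordGrad (n := n) f a y) (coordGrad f b y)) :=
  (contMDiff_coordGrad hf a).inner_bundle (contMDiff_coordGrad hf b)

variable {nabla : CovariantDerivative (𝓡 n) (EuclideanSpace ℝ (Fin n))
      (fun x : M ↦ TangentSpace (𝓡 n) x)}

set_option synthInstance.maxHeartbeats 200000 in
theorem IsLeviCivita.mvfderiv_inner (hLC : IsLeviCivita nabla)
    {X Y : Π x : M, TangentSpace (𝓡 n) x} {x : M}
    (hX : MDifferentiableAt (𝓡 n) ((𝓡 n).prod 𝓘(ℝ, 𝔼)) (T% X) x)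
    (hY : MDifferentiableAt (𝓡 n) ((𝓡 n).prod 𝓘(ℝ, 𝔼)) (T% Y) x) (v : TangentSpace (𝓡 n) x) :
    mvfderiv (𝓡 n) (fun y ↦ inner ℝ (X y) (Y y)) x v =
      inner ℝ (nabla X x v) (Y x) + inner ℝ (X x) (nabla Y x v) := by
  have h := hLC.2.mvfderiv_inner_eq (FiberBundle.extend 𝔼 v) hX hY
  simpa using h

-- Here `Hₐ = ∇Eₐ` is the Hessian of `xₐ`; it is symmetric because the torsion vanishes. The other
-- condition of `IsSecondForm.of_frame` is the derivative of the tight frame identity `∑ ⟨Eₐ, E_b⟩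
-- ⟨Eₐ, E_c⟩ = ⟨E_b, E_c⟩`.
set_option synthInstance.maxHeartbeats 200000 in
theorem IsLeviCivita.isSecondForm (hf : IsIsometricEmbedding (n := n) f)
    (hLC : IsLeviCivita nabla) (x : M) :
    IsSecondForm (fun a ↦ coordGrad (n := n) f a x)
      (fun a ↦ (nabla (coordGrad f a) x).toLinearMap) := by
  have hE (a) := contMDiff_coordGrad hf a
  have hEd (a) (y : M) : MDifferentiableAt (𝓡 n) ((𝓡 n).prod 𝓘(ℝ, 𝔼))
      (T% (coordGrad (n := n) f a)) y := (hE a).mdifferentiable (by simp) y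
  refine IsSecondForm.of_frame (sum_inner_smul_coordGrad hf x) (fun a b c ↦ ?_) (fun v b c ↦ ?_)
  · have hfa : ContMDiff (𝓡 n) 𝓘(ℝ) ∞ (fun y ↦ f y a) :=
      contMDiff_euclidean_apply hf.isSmoothEmbedding.contMDiff a
    have hu (b) : (fun y ↦ mvfderiv (𝓡 n) (fun y ↦ f y a) y (coordGrad f b y)) =
        fun y ↦ inner ℝ (coordGrad (n := n) f a y) (coordGrad f b y) := by
      ext1 y
      exact (inner_grad _ _ _).symm
    have h1 := mvfderiv_mlieBracket hf hfa (hE b) (hE c) x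
    rw [hu, hu, hLC.mvfderiv_inner (hEd a x) (hEd c x), hLC.mvfderiv_inner (hEd a x) (hEd b x),
      ← inner_grad, ← (nabla.torsion_eq_zero_iff.1 hLC.1) (hEd b x) (hEd c x), inner_sub_right]
      at h1
    change _ = inner ℝ (nabla (coordGrad f a) x (coordGrad f c x)) (coordGrad f b x)
    change inner ℝ (nabla (coordGrad f a) x (coordGrad f b x)) (coordGrad f c x) = _
    rw [coordGrad.eq_1 f a x] at h1
    linarith
  · have hfr : (fun y ↦ ∑ a, inner ℝ (coordGrad (n := n) f a y) (coordGrad f b y) *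
        inner ℝ (coordGrad (n := n) f a y) (coordGrad f c y)) =
        fun y ↦ inner ℝ (coordGrad (n := n) f b y) (coordGrad f c y) := by
      ext1 y
      exact inner_eq_sum_coordGrad hf y _ _
    have hG (a b) : MDifferentiableAt (𝓡 n) 𝓘(ℝ)
        (fun y ↦ inner ℝ (coordGrad (n := n) f a y) (coordGrad f b y)) x :=
      (contMDiff_inner_coordGrad hf a b).mdifferentiable (by simp) x
    have h1 := congrArg (fun u : M → ℝ ↦ mvfderiv (𝓡 n) u x v) hfr
    rw [mvfderiv_fun_sum (u := fun a y ↦ inner ℝ (coordGrad (n := n) f a y) (coordGrad f b y) *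
        inner ℝ (coordGrad (n := n) f a y) (coordGrad f c y)) _ fun a _ ↦ (hG a b).mul (hG a c),
      sum_apply,
      hLC.mvfderiv_inner (hEd b x) (hEd c x)] at h1
    have h2 (a) : mvfderiv (𝓡 n) (fun y ↦ inner ℝ (coordGrad (n := n) f a y) (coordGrad f b y) *
        inner ℝ (coordGrad (n := n) f a y) (coordGrad f c y)) x v =
        inner ℝ (coordGrad (n := n) f a x) (coordGrad f b x) *
          (inner ℝ (nabla (coordGrad f a) x v) (coordGrad f c x) +
            inner ℝ (coordGrad f a x) (nabla (coordGrad f c) x v)) +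
        inner ℝ (coordGrad (n := n) f a x) (coordGrad f c x) *
          (inner ℝ (nabla (coordGrad f a) x v) (coordGrad f b x) +
            inner ℝ (coordGrad f a x) (nabla (coordGrad f b) x v)) := by
      rw [mvfderiv_fun_mul (hG a b) (hG a c)]
      simp only [add_apply, smul_apply, smul_eq_mul]
      rw [hLC.mvfderiv_inner (hEd a x) (hEd c x), hLC.mvfderiv_inner (hEd a x) (hEd b x)]
    rw [Finset.sum_congr rfl fun a _ ↦ h2 a,
      ← inner_eq_sum_coordGrad hf x (nabla (coordGrad f b) x v),
      ← inner_eq_sum_coordGrad hf x _ (nabla (coordGrad f c) x v), ← Finset.sum_add_distrib,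
      ← sub_eq_zero, ← Finset.sum_sub_distrib] at h1
    rw [← h1]
    refine Finset.sum_congr rfl fun a _ ↦ ?_
    simp only [ContinuousLinearMap.coe_coe]
    ring

/-- The Laplacian of the `a`-th coordinate of `f`. -/
def coordLap (f : M → EuclideanSpace ℝ (Fin N)) (a : Fin N) (x : M) : ℝ :=
  ∑ b, mvfderiv (𝓡 n) (fun y ↦ inner ℝ (coordGrad (n := n) f a y) (coordGrad f b y)) x
    (coordGrad f b x)

theorem contMDiff_coordLap (hf : IsIsometricEmbedding (n := n) f) (a : Fin N) :
    ContMDiff (𝓡 n) 𝓘(ℝ) ∞ (coordLap (n := n) f a) :=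
  contMDiff_finsetSum fun b _ ↦
    contMDiff_mvfderiv_apply (contMDiff_inner_coordGrad hf a b) (contMDiff_coordGrad hf b)

-- `coordLap` is defined without a connection, so that its smoothness is immediate. The metric rule
-- produces the trace of the Hessian plus `⟨Eₐ, ∑ ∇_{E_b} E_b⟩`, which is zero.
set_option synthInstance.maxHeartbeats 200000 in
theorem IsLeviCivita.coordLap_eq (hf : IsIsometricEmbedding (n := n) f)
    (hLC : IsLeviCivita nabla) (a : Fin N) (x : M) :
    coordLap (n := n) f a x = IsSecondForm.lap (fun a ↦ coordGrad (n := n) f a x)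
      (fun a ↦ (nabla (coordGrad f a) x).toLinearMap) a := by
  have hEd (a) : MDifferentiableAt (𝓡 n) ((𝓡 n).prod 𝓘(ℝ, 𝔼))
      (T% (coordGrad (n := n) f a)) x := (contMDiff_coordGrad hf a).mdifferentiable (by simp) x
  have h0 := (hLC.isSecondForm hf x).sum_apply_self
  rw [coordLap, IsSecondForm.lap, Finset.sum_congr rfl fun b _ ↦
    hLC.mvfderiv_inner (hEd a) (hEd b) _, Finset.sum_add_distrib, ← inner_sum]
  erw [h0]
  rw [inner_zero_right, add_zero]
  rfl

/-- Integration by parts against a coordinate gradient. -/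
theorem integral_mvfderiv_coordGrad [CompactSpace M] [T2Space M] [MeasurableSpace M] [BorelSpace M]
    (hf : IsIsometricEmbedding (n := n) f) {u : M → ℝ} (hu : ContMDiff (𝓡 n) 𝓘(ℝ) ∞ u)
    (a : Fin N) :
    ∫ x, (mvfderiv (𝓡 n) u x (coordGrad f a x) + u x * coordLap (n := n) f a x)
      ∂riemannianVolume n M = 0 := by
  have hG (b) := contMDiff_inner_coordGrad (n := n) hf a b
  rw [← integral_sum_mvfderiv_eq_zero hf (u := fun b y ↦ u y *
    inner ℝ (coordGrad (n := n) f a y) (coordGrad f b y)) (fun b ↦ hu.mul (hG b)) fun x b ↦ ?_]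
  · refine integral_congr_ae (Filter.Eventually.of_forall fun x ↦ ?_)
    have h1 (b) : mvfderiv (𝓡 n)
        (fun y ↦ u y * inner ℝ (coordGrad (n := n) f a y) (coordGrad f b y)) x (coordGrad f b x) =
        u x * mvfderiv (𝓡 n) (fun y ↦ inner ℝ (coordGrad (n := n) f a y) (coordGrad f b y)) x
          (coordGrad f b x) +
        mvfderiv (𝓡 n) u x (inner ℝ (coordGrad (n := n) f b x) (coordGrad f a x) • coordGrad f b x) := by
      rw [mvfderiv_fun_mul (hu.mdifferentiable (by simp) x) ((hG b).mdifferentiable (by simp) x)]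
      simp only [add_apply, smul_apply, smul_eq_mul, map_smul, real_inner_comm]
    simp only [h1]
    rw [Finset.sum_add_distrib, ← map_sum, sum_inner_smul_coordGrad hf, coordLap, Finset.mul_sum,
      add_comm]
  · simp only [mul_assoc]
    rw [← Finset.mul_sum, ← inner_eq_sum_coordGrad hf x (coordGrad f a x) (coordGrad f b x)]
    simp only [real_inner_comm]

end LeviCivita

/-- The trace of a bilinear map is the same over an orthonormal basis and over a tight frame.
Pointwise definitions through `stdOrthonormalBasis` thereby become sums over globally smooth fields.
-/
theorem sum_orthonormalBasis_eq_sum_frame {V W ι : Type*} [NormedAddCommGroup V]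
    [InnerProductSpace ℝ V] [AddCommGroup W] [Module ℝ W] [Fintype ι] (e : OrthonormalBasis ι ℝ V)
    {N : ℕ} {E : Fin N → V} (hE : ∀ v, ∑ a, inner ℝ (E a) v • E a = v) (B : V →ₗ[ℝ] V →ₗ[ℝ] W) :
    ∑ i, B (e i) (e i) = ∑ a, B (E a) (E a) := by
  have h (a) : B (E a) (E a) = ∑ i, B (e i) (inner ℝ (E a) (e i) • E a) := by
    conv_lhs => enter [1]; rw [← e.sum_repr' (E a)]
    simp [real_inner_comm]
  rw [Finset.sum_congr rfl fun a _ ↦ h a, Finset.sum_comm]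
  exact Finset.sum_congr rfl fun i _ ↦ by rw [← map_sum, hE]

/-! ### Mean curvature through the Laplacians of the coordinates -/

section MeanCurvature

variable {n : ℕ} {M : Type*} [TopologicalSpace M] [ChartedSpace (EuclideanSpace ℝ (Fin n)) M]
  [IsManifold (𝓡 n) ∞ M] [RiemannianBundle (fun x : M ↦ TangentSpace (𝓡 n) x)]
  [IsContMDiffRiemannianBundle (𝓡 n) ∞ (EuclideanSpace ℝ (Fin n))
    (fun x : M ↦ TangentSpace (𝓡 n) x)]
  {N : ℕ} {f : M → EuclideanSpace ℝ (Fin N)}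
  {nabla : CovariantDerivative (𝓡 n) (EuclideanSpace ℝ (Fin n))
      (fun x : M ↦ TangentSpace (𝓡 n) x)}

local notation "𝔼" => EuclideanSpace ℝ (Fin n)

-- Differentiating `⟨Eₐ, W⟩` gives `⟨∇_v Eₐ, w⟩` plus the components of `df(∇_v W)`. The first
-- vector is normal by `IsSecondForm.orth` and the second tangential, so the projection keeps
-- exactly the first.
set_option synthInstance.maxHeartbeats 200000 in
theorem IsLeviCivita.secondFundamentalForm_eq (hf : IsIsometricEmbedding (n := n) f)
    (hLC : IsLeviCivita nabla) (x : M) (v w : TangentSpace (𝓡 n) x) :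
    secondFundamentalForm f x v w =
      WithLp.toLp 2 (fun a ↦ inner ℝ (nabla (coordGrad f a) x v) w) := by
  set W : Π x : M, TangentSpace (𝓡 n) x := FiberBundle.extend 𝔼 w with hW
  have hWx : W x = w := by simp [hW]
  have hWs : ContMDiffAt (𝓡 n) ((𝓡 n).prod 𝓘(ℝ, 𝔼)) ∞ (T% W) x :=
    FiberBundle.contMDiffAt_extend ..
  have hWd := hWs.mdifferentiableAt (by simp)
  have hEd (a) : MDifferentiableAt (𝓡 n) ((𝓡 n).prod 𝓘(ℝ, 𝔼))
      (T% (coordGrad (n := n) f a)) x := (contMDiff_coordGrad hf a).mdifferentiable (by simp) x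
  have hd : MDifferentiableAt (𝓡 n) (𝓡 N) (fun q ↦ mvfderiv (𝓡 n) f q (W q)) x :=
    (contMDiffAt_mvfderiv_apply hf.isSmoothEmbedding.contMDiff
      hWs).mdifferentiableAt (by simp)
  have key : mvfderiv (𝓡 n) (fun q ↦ mvfderiv (𝓡 n) f q (W q)) x v =
      WithLp.toLp 2 (fun a ↦ inner ℝ (nabla (coordGrad f a) x v) w) +
        mvfderiv (𝓡 n) f x (nabla W x v) := by
    refine PiLp.ext fun a ↦ ?_
    rw [PiLp.add_apply, mvfderiv_apply_eq_inner_coordGrad hf, mvfderiv_euclidean_apply hd]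
    simp only [mvfderiv_apply_eq_inner_coordGrad hf]
    rw [hLC.mvfderiv_inner (hEd a) hWd, hWx]
  rw [secondFundamentalForm, key, map_add]
  have h1 : mvfderiv (𝓡 n) f x (nabla W x v) ∈
      (LinearMap.range (mvfderiv (𝓡 n) f x).toLinearMap)ᗮᗮ :=
    Submodule.le_orthogonal_orthogonal _ ⟨_, rfl⟩
  have h2 : WithLp.toLp 2 (fun a ↦ inner ℝ (nabla (coordGrad f a) x v) w) ∈
      (LinearMap.range (mvfderiv (𝓡 n) f x).toLinearMap)ᗮ := by
    rw [Submodule.mem_orthogonal]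
    rintro _ ⟨u, rfl⟩
    have h3 := congrArg (fun z ↦ inner ℝ z u) ((hLC.isSecondForm hf x).orth v w)
    simp only [sum_inner, real_inner_smul_left, inner_zero_left] at h3
    rw [PiLp.inner_apply, ← h3]
    refine Finset.sum_congr rfl fun a _ ↦ ?_
    simp [mvfderiv_apply_eq_inner_coordGrad hf]
  rw [Submodule.starProjection_eq_self_iff.2 h2,
    (Submodule.starProjection_apply_eq_zero_iff _).2 h1, add_zero]

theorem IsLeviCivita.meanCurvatureVector_eq (hf : IsIsometricEmbedding (n := n) f)
    (hLC : IsLeviCivita nabla) (x : M) :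
    meanCurvatureVector (n := n) f x = WithLp.toLp 2 (fun a ↦ coordLap (n := n) f a x) := by
  refine PiLp.ext fun a ↦ ?_
  rw [meanCurvatureVector, WithLp.ofLp_sum, Finset.sum_apply]
  simp only [hLC.secondFundamentalForm_eq hf]
  rw [hLC.coordLap_eq hf]
  exact sum_orthonormalBasis_eq_sum_frame (stdOrthonormalBasis ℝ (TangentSpace (𝓡 n) x))
    (sum_inner_smul_coordGrad hf x) ((innerₗ _).comp (nabla (coordGrad f a) x).toLinearMap)

theorem IsLeviCivita.sq_mul_meanCurvature_sq (hf : IsIsometricEmbedding (n := n) f)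
    (hLC : IsLeviCivita nabla) (hn : 0 < n) (x : M) :
    (n : ℝ) ^ 2 * meanCurvature (n := n) f x ^ 2 = ∑ a, coordLap (n := n) f a x ^ 2 := by
  have h0 : (n : ℝ) ≠ 0 := by positivity
  rw [meanCurvature, hLC.meanCurvatureVector_eq hf, div_pow, mul_div_cancel₀ _ (by positivity),
    EuclideanSpace.norm_sq_eq]
  simp

theorem sum_norm_coordGrad_sq (hf : IsIsometricEmbedding (n := n) f) (x : M) :
    ∑ a, ‖coordGrad (n := n) f a x‖ ^ 2 = n := by
  have h := sum_orthonormalBasis_eq_sum_frame (stdOrthonormalBasis ℝ (TangentSpace (𝓡 n) x))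
    (sum_inner_smul_coordGrad hf x) (innerₗ (TangentSpace (𝓡 n) x))
  simp only [innerₗ_apply_apply, real_inner_self_eq_norm_sq, OrthonormalBasis.norm_eq_one] at h
  rw [← h]
  have : Module.finrank ℝ (TangentSpace (𝓡 n) x) = n := finrank_euclideanSpace_fin
  simp [this]

end MeanCurvature

/-! ### Real and `𝕜`-valued inner products with a common norm -/

section Compatibility

variable {𝕜 E : Type*} [RCLike 𝕜] [NormedAddCommGroup E] [InnerProductSpace ℝ E]
  [InnerProductSpace 𝕜 E]

/-- The two scalar actions are a priori unrelated; but `r ↦ (r : 𝕜) • s` is additive and continuous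
for the common norm, hence real linear. -/
theorem ofReal_smul_eq (r : ℝ) (s : E) : (r : 𝕜) • s = r • s := by
  let g : ℝ →+ E :=
    { toFun := fun r ↦ (r : 𝕜) • s
      map_zero' := by simp
      map_add' := fun a b ↦ by simp [add_smul] }
  have hg : Continuous g := (RCLike.continuous_ofReal (K := 𝕜)).smul continuous_const
  have h := map_real_smul g hg r 1
  simp only [g, AddMonoidHom.coe_mk, ZeroHom.coe_mk, smul_eq_mul, mul_one, RCLike.ofReal_one,
    one_smul] at h
  exact h

variable (𝕜) in
theorem real_inner_eq_re (s t : E) : inner ℝ s t = RCLike.re (inner 𝕜 s t) := by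
  rw [real_inner_eq_norm_add_mul_self_sub_norm_mul_self_sub_norm_mul_self_div_two,
    re_inner_eq_norm_add_mul_self_sub_norm_mul_self_sub_norm_mul_self_div_two]

theorem inner_real_smul_left (r : ℝ) (s t : E) :
    inner 𝕜 (r • s) t = (r : 𝕜) * inner 𝕜 s t := by
  rw [← ofReal_smul_eq (𝕜 := 𝕜), inner_smul_left, RCLike.conj_ofReal]

theorem inner_real_smul_right (r : ℝ) (s t : E) :
    inner 𝕜 s (r • t) = (r : 𝕜) * inner 𝕜 s t := by
  rw [← ofReal_smul_eq (𝕜 := 𝕜), inner_smul_right]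

/-- Reduces `𝕜`-valued integrals to real ones, where the real metric connection applies. For `𝕜 = ℝ`
one has `RCLike.I = 0` and the second term disappears. -/
theorem inner_eq_real_inner_add (s t : E) :
    inner 𝕜 s t = (inner ℝ s t : ℝ) + (inner ℝ ((RCLike.I : 𝕜) • s) t : ℝ) * RCLike.I := by
  rw [real_inner_eq_re 𝕜, real_inner_eq_re 𝕜, inner_smul_left, RCLike.conj_I, neg_mul, map_neg,
    RCLike.I_mul_re, neg_neg, RCLike.re_add_im]

end Compatibility

/-! ### Calculus on a Dirac bundle -/

section Dirac

variable {𝕜 : Type*} [RCLike 𝕜]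
  {n : ℕ} {M : Type*} [TopologicalSpace M] [ChartedSpace (EuclideanSpace ℝ (Fin n)) M]
  [IsManifold (𝓡 n) ∞ M]
  [RiemannianBundle (fun x : M ↦ TangentSpace (𝓡 n) x)]
  [IsContMDiffRiemannianBundle (𝓡 n) ∞ (EuclideanSpace ℝ (Fin n))
    (fun x : M ↦ TangentSpace (𝓡 n) x)]
  {F : Type*} [NormedAddCommGroup F] [NormedSpace ℝ F] [FiniteDimensional ℝ F]
  {V : M → Type*} [TopologicalSpace (TotalSpace F V)]
  [∀ x, NormedAddCommGroup (V x)] [∀ x, InnerProductSpace ℝ (V x)]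
  [∀ x, InnerProductSpace 𝕜 (V x)]
  [FiberBundle F V] [VectorBundle ℝ F V] [ContMDiffVectorBundle ∞ F V (𝓡 n)]
  [IsContMDiffRiemannianBundle (𝓡 n) ∞ F V]
  {N : ℕ} {f : M → EuclideanSpace ℝ (Fin N)}

local notation "𝔼" => EuclideanSpace ℝ (Fin n)

variable (n F) in
/-- Smoothness of a section. -/
abbrev SmoothSection (σ : Π x : M, V x) : Prop :=
  ContMDiff (𝓡 n) ((𝓡 n).prod 𝓘(ℝ, F)) ∞ (T% σ)

namespace DiracBundle

variable (S : DiracBundle 𝕜 n F V)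

/-- Clifford multiplication as a bilinear map. -/
def cmulₗ (x : M) : TangentSpace (𝓡 n) x →ₗ[ℝ] V x →ₗ[ℝ] V x :=
  (S.cliffordModule x).toLinearMap.comp (CliffordAlgebra.ι (cliffordForm (n := n) x))

theorem cmulₗ_cmulₗ_add (x : M) (v w : TangentSpace (𝓡 n) x) (s : V x) :
    S.cmulₗ x v (S.cmulₗ x w s) + S.cmulₗ x w (S.cmulₗ x v s) = (-2 * inner ℝ v w : ℝ) • s := by
  have h := congrArg (fun z ↦ S.cliffordModule x z s)
    (CliffordAlgebra.ι_mul_ι_add_swap (Q := cliffordForm (n := n) x) v w)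
  simp only [map_add, map_mul, AlgHom.commutes] at h
  refine Eq.trans h ?_
  rw [Module.algebraMap_end_apply]
  congr 1
  simp only [QuadraticMap.polar, cliffordForm, neg_apply,
    LinearMap.BilinMap.toQuadraticMap_apply, innerₗ_apply_apply, inner_add_left, inner_add_right,
    real_inner_comm v w]
  ring

theorem real_inner_cmulₗ (x : M) (v : TangentSpace (𝓡 n) x) (s t : V x) :
    inner ℝ (S.cmulₗ x v s) t = -inner ℝ s (S.cmulₗ x v t) := by
  have h := congrArg RCLike.re (S.clifford_skew x v s t)
  rw [map_add, ← real_inner_eq_re, ← real_inner_eq_re, map_zero] at h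
  exact eq_neg_of_add_eq_zero_left h

theorem smooth_cmulₗ {X : Π x : M, TangentSpace (𝓡 n) x} (hX : SmoothSection n 𝔼 X)
    {σ : Π x : M, V x} (hσ : SmoothSection n F σ) :
    SmoothSection n F (fun x ↦ S.cmulₗ x (X x) (σ x)) :=
  S.contMDiff_clifford ⟨X, hX⟩ ⟨σ, hσ⟩

theorem smooth_smul (S : DiracBundle 𝕜 n F V) (a : 𝕜) {σ : Π x : M, V x} (hσ : SmoothSection n F σ) :
    SmoothSection n F (fun x ↦ a • σ x) :=
  S.contMDiff_smul a ⟨σ, hσ⟩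

theorem smooth_conn {X : Π x : M, TangentSpace (𝓡 n) x} (hX : SmoothSection n 𝔼 X)
    {σ : Π x : M, V x} (hσ : SmoothSection n F σ) :
    SmoothSection n F (fun x ↦ S.conn σ x (X x)) := by
  have h := S.contMDiff_conn.contMDiff.contMDiff (σ := σ) (by simpa using! hσ.contMDiffOn)
  exact (contMDiffOn_univ.1 h).clm_bundle_apply hX

/-- The Levi-Civita connection. -/
def leviCivita : CovariantDerivative (𝓡 n) 𝔼 (fun x : M ↦ TangentSpace (𝓡 n) x) :=
  S.conn_clifford.choose

theorem isLeviCivita_leviCivita : IsLeviCivita S.leviCivita :=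
  S.conn_clifford.choose_spec.1

theorem conn_cmulₗ {X : Π x : M, TangentSpace (𝓡 n) x} (hX : SmoothSection n 𝔼 X)
    {σ : Π x : M, V x} (hσ : SmoothSection n F σ) (x : M) (v : TangentSpace (𝓡 n) x) :
    S.conn (fun y ↦ S.cmulₗ y (X y) (σ y)) x v =
      S.cmulₗ x (S.leviCivita X x v) (σ x) + S.cmulₗ x (X x) (S.conn σ x v) :=
  S.conn_clifford.choose_spec.2 ⟨X, hX⟩ ⟨σ, hσ⟩ x v

theorem conn_smul_apply {u : M → ℝ} (hu : ContMDiff (𝓡 n) 𝓘(ℝ) ∞ u) {σ : Π x : M, V x}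
    (hσ : SmoothSection n F σ) (x : M) (v : TangentSpace (𝓡 n) x) :
    S.conn (fun y ↦ u y • σ y) x v = u x • S.conn σ x v + mvfderiv (𝓡 n) u x v • σ x := by
  have h := S.conn.isCovariantDerivativeOnUniv.leibniz (hσ.mdifferentiable (by simp) x)
    (hu.mdifferentiable (by simp) x)
  exact congrArg (fun L ↦ L v) h

theorem conn_add {σ τ : Π x : M, V x} (hσ : SmoothSection n F σ) (hτ : SmoothSection n F τ)
    (x : M) (v : TangentSpace (𝓡 n) x) :
    S.conn (fun y ↦ σ y + τ y) x v = S.conn σ x v + S.conn τ x v :=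
  congrArg (fun L ↦ L v) (S.conn.isCovariantDerivativeOnUniv.add
    (hσ.mdifferentiable (by simp) x) (hτ.mdifferentiable (by simp) x))

theorem conn_sum {ι : Type*} (t : Finset ι) {σ : ι → Π x : M, V x}
    (hσ : ∀ i, SmoothSection n F (σ i)) (x : M) (v : TangentSpace (𝓡 n) x) :
    S.conn (fun y ↦ ∑ i ∈ t, σ i y) x v = ∑ i ∈ t, S.conn (σ i) x v := by
  classical
  induction t using Finset.induction_on with
  | empty =>
    have h := congrFun S.conn.zero x
    simp only [Finset.sum_empty]
    exact congrArg (fun L ↦ L v) h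
  | insert i t hi ih =>
    simp only [Finset.sum_insert hi]
    rw [S.conn_add (hσ i) (ContMDiff.sum_section fun j _ ↦ hσ j), ih]

theorem mvfderiv_inner {σ τ : Π x : M, V x} (hσ : SmoothSection n F σ)
    (hτ : SmoothSection n F τ) (x : M) (v : TangentSpace (𝓡 n) x) :
    mvfderiv (𝓡 n) (fun y ↦ inner ℝ (σ y) (τ y)) x v =
      inner ℝ (S.conn σ x v) (τ x) + inner ℝ (σ x) (S.conn τ x v) := by
  have h := S.conn_metric.mvfderiv_inner_eq (FiberBundle.extend 𝔼 v)
    (hσ.mdifferentiable (by simp) x) (hτ.mdifferentiable (by simp) x)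
  simpa using h

theorem dirac_eq_sum (hf : IsIsometricEmbedding (n := n) f) (σ : Π x : M, V x) (x : M) :
    S.dirac σ x = ∑ a, S.cmulₗ x (coordGrad f a x) (S.conn σ x (coordGrad f a x)) :=
  sum_orthonormalBasis_eq_sum_frame (stdOrthonormalBasis ℝ (TangentSpace (𝓡 n) x))
    (sum_inner_smul_coordGrad hf x) ((S.cmulₗ x).compl₂ (S.conn σ x).toLinearMap)

theorem smooth_dirac (hf : IsIsometricEmbedding (n := n) f) {σ : Π x : M, V x}
    (hσ : SmoothSection n F σ) : SmoothSection n F (S.dirac σ) := by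
  rw [funext (S.dirac_eq_sum hf σ)]
  exact ContMDiff.sum_section fun a _ ↦
    S.smooth_cmulₗ (contMDiff_coordGrad hf a) (S.smooth_conn (contMDiff_coordGrad hf a) hσ)

theorem dirac_smul (a : 𝕜) {σ : Π x : M, V x} (hσ : SmoothSection n F σ) (x : M) :
    S.dirac (fun y ↦ a • σ y) x = a • S.dirac σ x := by
  simp only [dirac, Finset.smul_sum]
  refine Finset.sum_congr rfl fun i _ ↦ ?_
  have h := S.conn_smul a ⟨σ, hσ⟩ x (stdOrthonormalBasis ℝ (TangentSpace (𝓡 n) x) i)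
  exact (congrArg (S.cmul x _) h).trans (S.clifford_smul ..)

end DiracBundle

end Dirac

theorem two_smul_sum_Ioi {W : Type*} [AddCommGroup W] [Module ℝ W] {m : ℕ} {g : Fin m → Fin m → W}
    (hs : ∀ i j, g i j = g j i) (h0 : ∀ i, g i i = 0) :
    (2 : ℝ) • ∑ i, ∑ j ∈ Finset.Ioi i, g i j = ∑ i, ∑ j, g i j := by
  have h1 (i : Fin m) : ∑ j, g i j = ∑ j ∈ Finset.Ioi i, g i j + ∑ j ∈ Finset.Iio i, g i j := by
    have hd : Disjoint (Finset.Ioi i) (Finset.Iio i) :=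
      Finset.disjoint_left.2 fun j hj hj' ↦ by simp at hj hj'; order
    rw [← Finset.sum_union hd]
    refine (Finset.sum_subset (Finset.subset_univ _) fun j _ hj ↦ ?_).symm
    have : j = i := by
      simp only [Finset.mem_union, Finset.mem_Ioi, Finset.mem_Iio, not_or, not_lt] at hj
      exact le_antisymm hj.1 hj.2
    rw [this, h0]
  have h2 : ∑ i, ∑ j ∈ Finset.Iio i, g i j = ∑ i, ∑ j ∈ Finset.Ioi i, g i j := by
    rw [Finset.sum_comm' (t' := Finset.univ) (s' := fun j ↦ Finset.Ioi j) (by simp)]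
    exact Finset.sum_congr rfl fun i _ ↦ Finset.sum_congr rfl fun j _ ↦ hs j i
  rw [Finset.sum_congr rfl fun i _ ↦ h1 i, Finset.sum_add_distrib, h2, two_smul]

/-! ### The commutator with a coordinate and the Bochner identity -/

section Dirac

variable {𝕜 : Type*} [RCLike 𝕜]
  {n : ℕ} {M : Type*} [TopologicalSpace M] [ChartedSpace (EuclideanSpace ℝ (Fin n)) M]
  [IsManifold (𝓡 n) ∞ M]
  [RiemannianBundle (fun x : M ↦ TangentSpace (𝓡 n) x)]
  [IsContMDiffRiemannianBundle (𝓡 n) ∞ (EuclideanSpace ℝ (Fin n))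
    (fun x : M ↦ TangentSpace (𝓡 n) x)]
  {F : Type*} [NormedAddCommGroup F] [NormedSpace ℝ F] [FiniteDimensional ℝ F]
  {V : M → Type*} [TopologicalSpace (TotalSpace F V)]
  [∀ x, NormedAddCommGroup (V x)] [∀ x, InnerProductSpace ℝ (V x)]
  [∀ x, InnerProductSpace 𝕜 (V x)]
  [FiberBundle F V] [VectorBundle ℝ F V] [ContMDiffVectorBundle ∞ F V (𝓡 n)]
  [IsContMDiffRiemannianBundle (𝓡 n) ∞ F V]
  {N : ℕ} {f : M → EuclideanSpace ℝ (Fin N)}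

local notation "𝔼" => EuclideanSpace ℝ (Fin n)

namespace DiracBundle

variable (S : DiracBundle 𝕜 n F V)

/-- The second fundamental form of `f` at `x`, as a family of linear maps. -/
theorem isSecondForm (hf : IsIsometricEmbedding (n := n) f) (x : M) :
    IsSecondForm (fun a ↦ coordGrad (n := n) f a x)
      (fun a ↦ (S.leviCivita (coordGrad f a) x).toLinearMap) :=
  S.isLeviCivita_leviCivita.isSecondForm hf x

/-- The connection Laplacian `∑ₐ ∇_{Eₐ}∇_{Eₐ}σ`. -/
def connLap (f : M → EuclideanSpace ℝ (Fin N)) (σ : Π x : M, V x) (x : M) : V x :=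
  ∑ a, S.conn (fun y ↦ S.conn σ y (coordGrad f a y)) x (coordGrad f a x)

theorem smooth_connLap (hf : IsIsometricEmbedding (n := n) f) {σ : Π x : M, V x}
    (hσ : SmoothSection n F σ) : SmoothSection n F (S.connLap f σ) :=
  ContMDiff.sum_section fun a _ ↦
    S.smooth_conn (contMDiff_coordGrad hf a) (S.smooth_conn (contMDiff_coordGrad hf a) hσ)

theorem dirac_smul_fun (hf : IsIsometricEmbedding (n := n) f) {u : M → ℝ}
    (hu : ContMDiff (𝓡 n) 𝓘(ℝ) ∞ u) {σ : Π x : M, V x} (hσ : SmoothSection n F σ) (x : M) :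
    S.dirac (fun y ↦ u y • σ y) x = u x • S.dirac σ x + S.cmulₗ x (grad u x) (σ x) := by
  rw [S.dirac_eq_sum hf, S.dirac_eq_sum hf]
  conv_rhs => enter [2, 1]; rw [← sum_inner_smul_coordGrad hf x (grad u x)]
  simp only [S.conn_smul_apply hu hσ, map_add, map_smul, map_sum, Finset.sum_add_distrib,
    Finset.smul_sum, LinearMap.sum_apply, LinearMap.smul_apply]
  congr 1
  refine Finset.sum_congr rfl fun a _ ↦ ?_
  rw [← inner_grad, real_inner_comm]

theorem dirac_add (hf : IsIsometricEmbedding (n := n) f) {σ τ : Π x : M, V x}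
    (hσ : SmoothSection n F σ) (hτ : SmoothSection n F τ) (x : M) :
    S.dirac (fun y ↦ σ y + τ y) x = S.dirac σ x + S.dirac τ x := by
  rw [S.dirac_eq_sum hf, S.dirac_eq_sum hf, S.dirac_eq_sum hf]
  simp only [S.conn_add hσ hτ, map_add, Finset.sum_add_distrib]

/-- The derivative of `Eₐ` contributes its Clifford trace `-Δxₐ`. Moving `Eₐ` past `E_b` changes the
sign and costs `2 ⟨E_b, Eₐ⟩`, which the frame identity sums to `2 ∇_{Eₐ}`. -/
theorem dirac_cmulₗ_coordGrad (hf : IsIsometricEmbedding (n := n) f) {σ : Π x : M, V x}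
    (hσ : SmoothSection n F σ) (a : Fin N) (x : M) :
    S.dirac (fun y ↦ S.cmulₗ y (coordGrad f a y) (σ y)) x =
      -coordLap (n := n) f a x • σ x - S.cmulₗ x (coordGrad f a x) (S.dirac σ x) -
        (2 : ℝ) • S.conn σ x (coordGrad f a x) := by
  have hsf := S.isSecondForm hf x
  have h1 := hsf.sum_clifford_clifford (S.cmulₗ x) (S.cmulₗ_cmulₗ_add x) a (σ x)
  rw [← S.isLeviCivita_leviCivita.coordLap_eq hf] at h1
  have h2 (b) : S.cmulₗ x (coordGrad f b x) (S.cmulₗ x (coordGrad f a x)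
      (S.conn σ x (coordGrad f b x))) = -(S.cmulₗ x (coordGrad f a x) (S.cmulₗ x (coordGrad f b x)
      (S.conn σ x (coordGrad f b x)))) -
      (2 : ℝ) • S.conn σ x (inner ℝ (coordGrad (n := n) f b x) (coordGrad f a x) • coordGrad f b x) := by
    have h3 := S.cmulₗ_cmulₗ_add x (coordGrad f b x) (coordGrad f a x)
      (S.conn σ x (coordGrad f b x))
    rw [map_smul]
    linear_combination (norm := module) h3
  rw [S.dirac_eq_sum hf, S.dirac_eq_sum hf, ← h1]
  simp only [S.conn_cmulₗ (contMDiff_coordGrad hf a) hσ, map_add, h2, Finset.sum_add_distrib,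
    Finset.sum_sub_distrib, Finset.sum_neg_distrib, map_sum]
  rw [← Finset.smul_sum, ← map_sum (S.conn σ x), sum_inner_smul_coordGrad hf]
  simp only [ContinuousLinearMap.coe_coe]
  abel

/-- The commutator of `D²` with multiplication by a coordinate function. -/
theorem dirac_dirac_coord_smul (hf : IsIsometricEmbedding (n := n) f) {σ : Π x : M, V x}
    (hσ : SmoothSection n F σ) (a : Fin N) (x : M) :
    S.dirac (S.dirac (fun y ↦ f y a • σ y)) x = f x a • S.dirac (S.dirac σ) x -
      (2 : ℝ) • S.conn σ x (coordGrad f a x) - coordLap (n := n) f a x • σ x := by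
  have hfa : ContMDiff (𝓡 n) 𝓘(ℝ) ∞ (fun y ↦ f y a) :=
    contMDiff_euclidean_apply hf.isSmoothEmbedding.contMDiff a
  have hD := S.smooth_dirac hf hσ
  -- `D²(xσ) = x D²σ + E · Dσ + D(E · σ)`, and the last term contains `-E · Dσ`.
  rw [funext (S.dirac_smul_fun hf hfa hσ), S.dirac_add hf (σ := fun y ↦ f y a • S.dirac σ y)
    (τ := fun y ↦ S.cmulₗ y (grad (fun z ↦ f z a) y) (σ y)) (hfa.smul_section hD)
    (S.smooth_cmulₗ (contMDiff_coordGrad hf a) hσ), S.dirac_smul_fun hf hfa hD,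
    show S.dirac (fun y ↦ S.cmulₗ y (grad (fun z ↦ f z a) y) (σ y)) x = _ from
      S.dirac_cmulₗ_coordGrad hf hσ a x, ← coordGrad.eq_1 f a x]
  module

section Curvature

variable {σ : Π x : M, V x}

theorem mdifferentiableAt_conn (hσ : SmoothSection n F σ) {X : Π x : M, TangentSpace (𝓡 n) x}
    {x : M} (hX : MDifferentiableAt (𝓡 n) ((𝓡 n).prod 𝓘(ℝ, 𝔼)) (T% X) x) :
    MDifferentiableAt (𝓡 n) ((𝓡 n).prod 𝓘(ℝ, F)) (T% (fun y ↦ S.conn σ y (X y))) x := by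
  have h := S.contMDiff_conn.contMDiff.contMDiff (σ := σ) (by simpa using! hσ.contMDiffOn)
  exact ((contMDiffOn_univ.1 h).mdifferentiable (by simp) x).clm_bundle_apply hX

theorem curvature_swap (X Y : Π x : M, TangentSpace (𝓡 n) x) (x : M) :
    S.curvature X Y σ x = -S.curvature Y X σ x := by
  rw [curvature, curvature, VectorField.mlieBracket_swap, Pi.neg_apply, map_neg]
  abel

/-- The derivative of `u` from `∇_X(u ∇_Y σ)` cancels the one from `[X, uY]`. Tensoriality permits
evaluating the curvature on the fields `Eₐ` instead of the extensions of basis vectors in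
`bochnerCurvature`. -/
theorem tensorialAt_curvature_right (hσ : SmoothSection n F σ)
    (X : Π x : M, TangentSpace (𝓡 n) x) (x : M) :
    TensorialAt (𝓡 n) 𝔼 (fun Y ↦ S.curvature X Y σ x) x where
  smul {u Y} hu hY := by
    have h := S.conn.isCovariantDerivativeOnUniv.leibniz (S.mdifferentiableAt_conn hσ hY) hu
    have h1 : S.conn (fun y ↦ S.conn σ y ((u • Y) y)) x (X x) =
        u x • S.conn (fun y ↦ S.conn σ y (Y y)) x (X x) +
          mvfderiv (𝓡 n) u x (X x) • S.conn σ x (Y x) := by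
      simp only [Pi.smul_apply', map_smul]
      exact congrArg (fun L ↦ L (X x)) h
    simp only [curvature]
    rw [h1, VectorField.mlieBracket_smul_right hu hY, map_add, map_smul, map_smul, Pi.smul_apply',
      map_smul]
    module
  add {Y Y'} hY hY' := by
    have h := S.conn.isCovariantDerivativeOnUniv.add (S.mdifferentiableAt_conn hσ hY)
      (S.mdifferentiableAt_conn hσ hY')
    have h1 : S.conn (fun y ↦ S.conn σ y ((Y + Y') y)) x (X x) =
        S.conn (fun y ↦ S.conn σ y (Y y)) x (X x) +
          S.conn (fun y ↦ S.conn σ y (Y' y)) x (X x) := by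
      simp only [Pi.add_apply, map_add]
      exact congrArg (fun L ↦ L (X x)) h
    simp only [curvature]
    rw [h1, VectorField.mlieBracket_add_right hY hY', map_add, Pi.add_apply, map_add]
    abel

theorem tensorialAt_curvature_left (hσ : SmoothSection n F σ)
    (Y : Π x : M, TangentSpace (𝓡 n) x) (x : M) :
    TensorialAt (𝓡 n) 𝔼 (fun X ↦ S.curvature X Y σ x) x where
  smul {u X} hu hX := by
    have h := (S.tensorialAt_curvature_right hσ Y x).smul hu hX
    rw [S.curvature_swap, h, S.curvature_swap X, smul_neg]
  add {X X'} hX hX' := by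
    have h := (S.tensorialAt_curvature_right hσ Y x).add hX hX'
    rw [S.curvature_swap, h, S.curvature_swap X, S.curvature_swap X', neg_add]

/-- The curvature as a bilinear form on a tangent space. -/
def curvatureTensor (hσ : SmoothSection n F σ) (x : M) :
    TangentSpace (𝓡 n) x →L[ℝ] TangentSpace (𝓡 n) x →L[ℝ] V x :=
  TensorialAt.mkHom₂ (fun X Y ↦ S.curvature X Y σ x) x
    (fun Y _ ↦ S.tensorialAt_curvature_left hσ Y x)
    (fun X _ ↦ S.tensorialAt_curvature_right hσ X x)

theorem curvatureTensor_apply (hσ : SmoothSection n F σ) {X Y : Π x : M, TangentSpace (𝓡 n) x}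
    {x : M} (hX : MDifferentiableAt (𝓡 n) ((𝓡 n).prod 𝓘(ℝ, 𝔼)) (T% X) x)
    (hY : MDifferentiableAt (𝓡 n) ((𝓡 n).prod 𝓘(ℝ, 𝔼)) (T% Y) x) :
    S.curvatureTensor hσ x (X x) (Y x) = S.curvature X Y σ x :=
  TensorialAt.mkHom₂_apply _ _ hX hY

theorem curvatureTensor_eq_extend (hσ : SmoothSection n F σ) (x : M)
    (v w : TangentSpace (𝓡 n) x) :
    S.curvatureTensor hσ x v w =
      S.curvature (FiberBundle.extend 𝔼 v) (FiberBundle.extend 𝔼 w) σ x :=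
  TensorialAt.mkHom₂_apply_eq_extend ..

theorem curvatureTensor_swap (hσ : SmoothSection n F σ) (x : M) (v w : TangentSpace (𝓡 n) x) :
    S.curvatureTensor hσ x v w = -S.curvatureTensor hσ x w v := by
  rw [curvatureTensor_eq_extend, curvatureTensor_eq_extend, curvature_swap]

/-- Both `eᵢ · eⱼ` (for `i ≠ j`) and the curvature are antisymmetric, so the sum over `i < j` is
half of the full sum; then each index is traded for the frame. -/
theorem two_smul_bochnerCurvature (hf : IsIsometricEmbedding (n := n) f)
    (hσ : SmoothSection n F σ) (x : M) :
    (2 : ℝ) • S.bochnerCurvature σ x = ∑ a, ∑ b, S.cmulₗ x (coordGrad f a x)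
      (S.cmulₗ x (coordGrad f b x)
        (S.curvatureTensor hσ x (coordGrad f a x) (coordGrad f b x))) := by
  let e := stdOrthonormalBasis ℝ (TangentSpace (𝓡 n) x)
  let c := S.cmulₗ x
  let K : TangentSpace (𝓡 n) x →ₗ[ℝ] TangentSpace (𝓡 n) x →ₗ[ℝ] V x :=
    (ContinuousLinearMap.coeLM ℝ).comp (S.curvatureTensor hσ x).toLinearMap
  have hK (v w) : K v w = -K w v := S.curvatureTensor_swap hσ x v w
  have hE := sum_inner_smul_coordGrad hf x
  have h1 : S.bochnerCurvature σ x = ∑ i, ∑ j ∈ Finset.Ioi i, c (e i) (c (e j) (K (e i) (e j))) :=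
    rfl
  have h2 (v) : ∑ j, c v (c (e j) (K v (e j))) =
      ∑ b, c v (c (coordGrad f b x) (K v (coordGrad f b x))) :=
    sum_orthonormalBasis_eq_sum_frame e hE ((c.compl₂ (K v)).compr₂ (c v))
  have h3 (w) : ∑ i, c (e i) (c w (K (e i) w)) =
      ∑ a, c (coordGrad f a x) (c w (K (coordGrad f a x) w)) :=
    sum_orthonormalBasis_eq_sum_frame e hE (c.compl₂ ((c w).comp (K.flip w)))
  have hKs (v) : K v v = 0 := by
    have h := hK v v
    have h' : (2 : ℝ) • K v v = 0 := by rw [two_smul]; nth_rewrite 1 [h]; simp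
    exact (smul_eq_zero.1 h').resolve_left two_ne_zero
  rw [h1, two_smul_sum_Ioi (fun i j ↦ ?_) (fun i ↦ by rw [hKs, map_zero, map_zero]),
    Finset.sum_congr rfl fun i _ ↦ h2 (e i), Finset.sum_comm, Finset.sum_congr rfl fun b _ ↦ h3 _,
    Finset.sum_comm]
  · rfl
  · by_cases hij : i = j
    · rw [hij]
    · have h4 := S.cmulₗ_cmulₗ_add x (e i) (e j) (K (e i) (e j))
      rw [e.orthonormal.2 hij, mul_zero, zero_smul] at h4
      rw [hK (e j), map_neg, map_neg]
      exact eq_neg_of_add_eq_zero_left h4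

theorem conn_conn_sub (hf : IsIsometricEmbedding (n := n) f) (hσ : SmoothSection n F σ)
    (a b : Fin N) (x : M) :
    S.conn (fun y ↦ S.conn σ y (coordGrad f b y)) x (coordGrad f a x) -
        S.conn (fun y ↦ S.conn σ y (coordGrad f a y)) x (coordGrad f b x) =
      S.curvatureTensor hσ x (coordGrad f a x) (coordGrad f b x) +
        (S.conn σ x (S.leviCivita (coordGrad f b) x (coordGrad f a x)) -
          S.conn σ x (S.leviCivita (coordGrad f a) x (coordGrad f b x))) := by
  have hd (a) : MDifferentiableAt (𝓡 n) ((𝓡 n).prod 𝓘(ℝ, 𝔼))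
      (T% (coordGrad (n := n) f a)) x := (contMDiff_coordGrad hf a).mdifferentiable (by simp) x
  have ht := (S.leviCivita.torsion_eq_zero_iff.1 S.isLeviCivita_leviCivita.1) (hd a) (hd b)
  rw [S.curvatureTensor_apply hσ (hd a) (hd b), curvature, ← map_sub, ht]
  abel

/-- The Bochner identity. -/
theorem dirac_dirac_eq (hf : IsIsometricEmbedding (n := n) f) (hσ : SmoothSection n F σ) (x : M) :
    S.dirac (S.dirac σ) x = S.bochnerCurvature σ x - S.connLap f σ x := by
  let E (a : Fin N) : TangentSpace (𝓡 n) x := coordGrad f a x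
  let c := S.cmulₗ x
  let H (a : Fin N) := (S.leviCivita (coordGrad f a) x).toLinearMap
  have hsf : IsSecondForm E H := S.isSecondForm hf x
  let T := (S.conn σ x).toLinearMap
  let P (a : Fin N) := (S.conn (fun y ↦ S.conn σ y (coordGrad f a y)) x).toLinearMap
  let K (v w : TangentSpace (𝓡 n) x) : V x := S.curvatureTensor hσ x v w
  have hE : ∀ v, ∑ a, inner ℝ (E a) v • E a = v := sum_inner_smul_coordGrad hf x
  have hc (v w s) : c v (c w s) = -c w (c v s) - (2 * inner ℝ v w) • s := by
    have h := S.cmulₗ_cmulₗ_add x v w s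
    linear_combination (norm := module) h
  have hswap (g : Fin N → Fin N → V x) (A : Fin N → TangentSpace (𝓡 n) x →ₗ[ℝ] V x)
      (hg : ∀ a b, g a b = A a (E b)) :
      ∑ a, ∑ b, c (E a) (c (E b) (g a b)) =
        -(∑ a, ∑ b, c (E b) (c (E a) (g a b))) - (2 : ℝ) • ∑ a, A a (E a) := by
    have h1 (a) : ∑ b, (2 * inner ℝ (E a) (E b)) • g a b = (2 : ℝ) • A a (E a) := by
      conv_rhs => rw [← hE (E a), map_sum, Finset.smul_sum]
      refine Finset.sum_congr rfl fun b _ ↦ ?_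
      rw [hg, map_smul, smul_smul, real_inner_comm]
    simp only [fun a b ↦ hc (E a) (E b) (g a b), Finset.sum_sub_distrib, Finset.sum_neg_distrib, h1,
      Finset.smul_sum]
  have h1 : S.dirac (S.dirac σ) x =
      ∑ a, ∑ b, c (E a) (c (H b (E a)) (T (E b))) + ∑ a, ∑ b, c (E a) (c (E b) (P b (E a))) := by
    rw [S.dirac_eq_sum hf, funext (S.dirac_eq_sum hf σ), ← Finset.sum_add_distrib]
    refine Finset.sum_congr rfl fun a _ ↦ ?_
    rw [S.conn_sum _ fun b ↦ S.smooth_cmulₗ (contMDiff_coordGrad hf b)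
      (S.smooth_conn (contMDiff_coordGrad hf b) hσ), map_sum, ← Finset.sum_add_distrib]
    refine Finset.sum_congr rfl fun b _ ↦ ?_
    rw [S.conn_cmulₗ (contMDiff_coordGrad hf b) (S.smooth_conn (contMDiff_coordGrad hf b) hσ),
      map_add]
    rfl
  -- Tracing over `a` leaves `-Δx_b ∇_{E_b} σ`, and the sum over `b` vanishes because `∑ Δx_b E_b =
  -- 0`.
  have h2 : ∑ a, ∑ b, c (E a) (c (H b (E a)) (T (E b))) = 0 := by
    rw [Finset.sum_comm, Finset.sum_congr rfl fun b _ ↦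
      hsf.sum_clifford_clifford c (S.cmulₗ_cmulₗ_add x) b (T (E b))]
    simp only [neg_smul, ← map_smul]
    rw [← map_sum, Finset.sum_neg_distrib, hsf.sum_lap_smul, neg_zero, map_zero]
  have h3 : ∑ a, ∑ b, c (E a) (c (E b) (P a (E b))) =
      -(∑ a, ∑ b, c (E a) (c (E b) (P b (E a)))) - (2 : ℝ) • S.connLap f σ x := by
    rw [hswap (fun a b ↦ P a (E b)) P fun _ _ ↦ rfl]
    congr 2
    exact Finset.sum_comm
  have h4 : ∑ a, ∑ b, c (E a) (c (E b) (T (H b (E a)))) = 0 :=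
    Finset.sum_eq_zero fun a _ ↦ by rw [← map_sum, hsf.sum_clifford_apply c T, map_zero]
  have h5 : ∑ a, ∑ b, c (E a) (c (E b) (T (H a (E b)))) = 0 := by
    rw [hswap (fun a b ↦ T (H a (E b))) (fun a ↦ T.comp (H a)) fun _ _ ↦ rfl, Finset.sum_comm, h4]
    simp only [LinearMap.comp_apply]
    rw [← map_sum, hsf.sum_apply_self, map_zero, smul_zero, neg_zero, sub_zero]
  have h6 (a b) : P b (E a) - P a (E b) = K (E a) (E b) + (T (H b (E a)) - T (H a (E b))) :=
    S.conn_conn_sub hf hσ a b x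
  -- Exchanging the order of the derivatives gives the curvature, the connection terms being zero by
  -- `h4` and `h5`. Together with the Clifford exchange `h3` this determines the double sum.
  have h7 : ∑ a, ∑ b, c (E a) (c (E b) (P b (E a))) - ∑ a, ∑ b, c (E a) (c (E b) (P a (E b))) =
      (2 : ℝ) • S.bochnerCurvature σ x := by
    rw [S.two_smul_bochnerCurvature hf hσ]
    simp only [← Finset.sum_sub_distrib, ← map_sub, h6]
    simp only [map_add, map_sub, Finset.sum_add_distrib, Finset.sum_sub_distrib, h4, h5, sub_zero,
      add_zero]
    rfl
  have h8 : (2 : ℝ) • S.dirac (S.dirac σ) x =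
      (2 : ℝ) • (S.bochnerCurvature σ x - S.connLap f σ x) := by
    rw [h1, h2, smul_sub, ← h7, h3]
    module
  exact smul_right_injective _ (two_ne_zero (α := ℝ)) h8

end Curvature

variable {σ : Π x : M, V x}

/-- The pointwise orthonormal bases in the definition need not vary smoothly; smoothness is read off
from the Bochner identity instead. -/
theorem smooth_bochnerCurvature (hf : IsIsometricEmbedding (n := n) f)
    (hσ : SmoothSection n F σ) : SmoothSection n F (S.bochnerCurvature σ) := by
  have h : S.bochnerCurvature σ = S.dirac (S.dirac σ) + S.connLap f σ := by
    ext1 x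
    rw [Pi.add_apply, S.dirac_dirac_eq hf hσ, sub_add_cancel]
  rw [h]
  exact (S.smooth_dirac hf (S.smooth_dirac hf hσ)).add_section (S.smooth_connLap hf hσ)

variable (f) in
/-- The commutator `[D², xₐ]σ`. -/
def coordCommutator (a : Fin N) (σ : Π x : M, V x) (x : M) : V x :=
  -((2 : ℝ) • S.conn σ x (coordGrad f a x) + coordLap (n := n) f a x • σ x)

theorem smooth_coordCommutator (hf : IsIsometricEmbedding (n := n) f) (a : Fin N)
    (hσ : SmoothSection n F σ) : SmoothSection n F (S.coordCommutator f a σ) :=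
  ((S.smooth_conn (contMDiff_coordGrad hf a) hσ).const_smul_section.add_section
    ((contMDiff_coordLap hf a).smul_section hσ)).neg_section

/-- The cross terms add up to the derivative of `σ` along `∑ (Δxₐ) Eₐ = 0`, the tangential part of
the mean curvature vector. -/
theorem sum_norm_coordCommutator_sq (hf : IsIsometricEmbedding (n := n) f) (σ : Π x : M, V x)
    (x : M) :
    ∑ a, ‖S.coordCommutator f a σ x‖ ^ 2 = 4 * ∑ a, ‖S.conn σ x (coordGrad f a x)‖ ^ 2 +
      (∑ a, coordLap (n := n) f a x ^ 2) * ‖σ x‖ ^ 2 := by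
  have h0 : ∑ a, coordLap (n := n) f a x • coordGrad (n := n) f a x = 0 := by
    simp only [S.isLeviCivita_leviCivita.coordLap_eq hf]
    exact (S.isSecondForm hf x).sum_lap_smul
  have h1 : ∑ a, coordLap (n := n) f a x * inner ℝ (S.conn σ x (coordGrad f a x)) (σ x) = 0 := by
    simp only [← real_inner_smul_left, ← map_smul]
    rw [← sum_inner, ← map_sum, h0, map_zero, inner_zero_left]
  have h2 (a) : ‖S.coordCommutator f a σ x‖ ^ 2 = 4 * ‖S.conn σ x (coordGrad f a x)‖ ^ 2 +
      coordLap (n := n) f a x ^ 2 * ‖σ x‖ ^ 2 +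
      4 * (coordLap (n := n) f a x * inner ℝ (S.conn σ x (coordGrad f a x)) (σ x)) := by
    rw [coordCommutator, norm_neg, norm_add_sq_real, norm_smul, norm_smul, mul_pow, mul_pow,
      real_inner_smul_left, real_inner_smul_right]
    simp only [Real.norm_eq_abs, sq_abs]
    ring
  rw [Finset.sum_congr rfl fun a _ ↦ h2 a, Finset.sum_add_distrib, Finset.sum_add_distrib,
    ← Finset.mul_sum, ← Finset.mul_sum, ← Finset.sum_mul, h1, mul_zero, add_zero]

end DiracBundle

end Dirac

/-! ### Integration: symmetry of `D` and the integrated identities -/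

section Dirac

variable {𝕜 : Type*} [RCLike 𝕜]
  {n : ℕ} {M : Type*} [TopologicalSpace M] [ChartedSpace (EuclideanSpace ℝ (Fin n)) M]
  [IsManifold (𝓡 n) ∞ M]
  [RiemannianBundle (fun x : M ↦ TangentSpace (𝓡 n) x)]
  [IsContMDiffRiemannianBundle (𝓡 n) ∞ (EuclideanSpace ℝ (Fin n))
    (fun x : M ↦ TangentSpace (𝓡 n) x)]
  [CompactSpace M] [T2Space M] [MeasurableSpace M] [BorelSpace M]
  {F : Type*} [NormedAddCommGroup F] [NormedSpace ℝ F] [FiniteDimensional ℝ F]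
  {V : M → Type*} [TopologicalSpace (TotalSpace F V)]
  [∀ x, NormedAddCommGroup (V x)] [∀ x, InnerProductSpace ℝ (V x)]
  [∀ x, InnerProductSpace 𝕜 (V x)]
  [FiberBundle F V] [VectorBundle ℝ F V] [ContMDiffVectorBundle ∞ F V (𝓡 n)]
  [IsContMDiffRiemannianBundle (𝓡 n) ∞ F V]
  {N : ℕ} {f : M → EuclideanSpace ℝ (Fin N)}

theorem integrable_of_continuous (hf : IsIsometricEmbedding (n := n) f) {W : Type*}
    [NormedAddCommGroup W] {u : M → W} (hu : Continuous u) :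
    Integrable u (riemannianVolume n M) := by
  have := isFiniteMeasure_riemannianVolume (n := n) (M := M) hf
  exact hu.integrable_of_hasCompactSupport (HasCompactSupport.of_compactSpace u)

theorem integrable_inner (hf : IsIsometricEmbedding (n := n) f) {σ τ : Π x : M, V x}
    (hσ : SmoothSection n F σ) (hτ : SmoothSection n F τ) :
    Integrable (fun x ↦ inner ℝ (σ x) (τ x)) (riemannianVolume n M) :=
  integrable_of_continuous hf (hσ.inner_bundle hτ).continuous

namespace DiracBundle

variable (S : DiracBundle 𝕜 n F V) {σ τ : Π x : M, V x}

theorem integrable_inner_rclike (S : DiracBundle 𝕜 n F V) (hf : IsIsometricEmbedding (n := n) f)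
    (hσ : SmoothSection n F σ) (hτ : SmoothSection n F τ) :
    Integrable (fun x ↦ inner 𝕜 (σ x) (τ x)) (riemannianVolume n M) := by
  rw [show (fun x ↦ inner 𝕜 (σ x) (τ x)) = _ from
    funext fun x ↦ inner_eq_real_inner_add (σ x) (τ x)]
  exact (integrable_inner hf hσ hτ).ofReal.add
    ((integrable_inner hf (S.smooth_smul _ hσ) hτ).ofReal.mul_const _)

theorem l2Inner_eq (S : DiracBundle 𝕜 n F V) (hf : IsIsometricEmbedding (n := n) f)
    (hσ : SmoothSection n F σ) (hτ : SmoothSection n F τ) :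
    l2Inner 𝕜 n σ τ = ((∫ x, inner ℝ (σ x) (τ x) ∂riemannianVolume n M : ℝ) : 𝕜) +
      ((∫ x, inner ℝ ((RCLike.I : 𝕜) • σ x) (τ x) ∂riemannianVolume n M : ℝ) : 𝕜) * RCLike.I := by
  rw [l2Inner, show (fun x ↦ inner 𝕜 (σ x) (τ x)) = _ from
    funext fun x ↦ inner_eq_real_inner_add (σ x) (τ x), integral_add (integrable_inner hf hσ hτ).ofReal
    ((integrable_inner hf (S.smooth_smul _ hσ) hτ).ofReal.mul_const _), integral_mul_const,
    integral_ofReal, integral_ofReal]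

theorem pairing_eq (S : DiracBundle 𝕜 n F V) (hf : IsIsometricEmbedding (n := n) f)
    (hσ : SmoothSection n F σ) (hτ : SmoothSection n F τ) :
    pairing 𝕜 n σ τ = ∫ x, inner ℝ (σ x) (τ x) ∂riemannianVolume n M := by
  rw [pairing, l2Inner, ← integral_re (S.integrable_inner_rclike hf hσ hτ)]
  simp only [real_inner_eq_re 𝕜]

/-- Pointwise, `⟨σ, Dτ⟩ - ⟨Dσ, τ⟩` is the divergence of the field with components `⟨σ, Eₐ · τ⟩`; the
term with `∑ ∇_{Eₐ} Eₐ` is zero. -/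
theorem integral_inner_dirac (hf : IsIsometricEmbedding (n := n) f) (hσ : SmoothSection n F σ)
    (hτ : SmoothSection n F τ) :
    ∫ x, inner ℝ (S.dirac σ x) (τ x) ∂riemannianVolume n M =
      ∫ x, inner ℝ (σ x) (S.dirac τ x) ∂riemannianVolume n M := by
  rw [← sub_eq_zero, ← integral_sub (integrable_inner hf (S.smooth_dirac hf hσ) hτ)
    (integrable_inner hf hσ (S.smooth_dirac hf hτ)), ← neg_eq_zero, ← integral_neg]
  have hc (a) := S.smooth_cmulₗ (contMDiff_coordGrad hf a) hτ
  rw [← integral_sum_mvfderiv_eq_zero hf (u := fun a x ↦ inner ℝ (σ x)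
    (S.cmulₗ x (coordGrad f a x) (τ x))) (fun a ↦ hσ.inner_bundle (hc a)) fun x a ↦ ?_]
  · refine integral_congr_ae (Filter.Eventually.of_forall fun x ↦ ?_)
    have h1 (a) := S.mvfderiv_inner hσ (hc a) x (coordGrad f a x)
    have h2 := (S.isSecondForm hf x).sum_apply_self
    simp only [h1, S.conn_cmulₗ (contMDiff_coordGrad hf _) hτ, inner_add_right,
      Finset.sum_add_distrib, ← inner_sum]
    rw [← LinearMap.sum_apply, ← map_sum]
    erw [h2]
    rw [map_zero, LinearMap.zero_apply, inner_zero_right, zero_add, ← S.dirac_eq_sum hf τ x,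
      S.dirac_eq_sum hf σ x, sum_inner]
    simp only [S.real_inner_cmulₗ, Finset.sum_neg_distrib]
    ring
  · conv_rhs => rw [← sum_inner_smul_coordGrad hf x (coordGrad f a x)]
    simp [inner_sum, real_inner_smul_right, mul_comm]

/-- The imaginary part is the real identity applied to `I • σ`, with which `D` commutes. -/
theorem l2Inner_dirac (hf : IsIsometricEmbedding (n := n) f) (hσ : SmoothSection n F σ)
    (hτ : SmoothSection n F τ) :
    l2Inner 𝕜 n (S.dirac σ) τ = l2Inner 𝕜 n σ (S.dirac τ) := by
  have hD {σ : Π x : M, V x} (hσ : SmoothSection n F σ) := S.smooth_dirac hf hσ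
  rw [S.l2Inner_eq hf (hD hσ) hτ, S.l2Inner_eq hf hσ (hD hτ), S.integral_inner_dirac hf hσ hτ,
    ← S.integral_inner_dirac hf (S.smooth_smul _ hσ) hτ]
  simp only [S.dirac_smul _ hσ]

/-- `|∇σ|²` and `⟨∑ ∇_{Eₐ} ∇_{Eₐ} σ, σ⟩` add up to the divergence of the field with components
`⟨∇_{Eₐ} σ, σ⟩`. -/
theorem integral_sum_conn_sq (hf : IsIsometricEmbedding (n := n) f) (hσ : SmoothSection n F σ) :
    ∫ x, ∑ a, ‖S.conn σ x (coordGrad f a x)‖ ^ 2 ∂riemannianVolume n M =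
      -∫ x, inner ℝ (S.connLap f σ x) (σ x) ∂riemannianVolume n M := by
  have hc (a) := S.smooth_conn (contMDiff_coordGrad hf a) hσ
  have hi : Integrable (fun x ↦ ∑ a, ‖S.conn σ x (coordGrad f a x)‖ ^ 2)
      (riemannianVolume n M) := by
    simp only [← real_inner_self_eq_norm_sq]
    exact integrable_finsetSum _ fun a _ ↦ integrable_inner hf (hc a) (hc a)
  rw [eq_neg_iff_add_eq_zero, ← integral_add hi
    (integrable_inner hf (S.smooth_connLap hf hσ) hσ)]
  rw [← integral_sum_mvfderiv_eq_zero hf (u := fun a x ↦ inner ℝ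
    (S.conn σ x (coordGrad f a x)) (σ x)) (fun a ↦ (hc a).inner_bundle hσ) fun x a ↦ ?_]
  · refine integral_congr_ae (Filter.Eventually.of_forall fun x ↦ ?_)
    have h1 (a) := S.mvfderiv_inner (hc a) hσ x (coordGrad f a x)
    simp only [h1, Finset.sum_add_distrib, connLap, sum_inner, real_inner_self_eq_norm_sq]
    ring
  · conv_rhs => rw [← sum_inner_smul_coordGrad hf x (coordGrad f a x)]
    simp [sum_inner, real_inner_smul_left, mul_comm]

/-- The integrated Bochner identity. -/
theorem integral_sum_conn_sq_eq (hf : IsIsometricEmbedding (n := n) f)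
    (hσ : SmoothSection n F σ) :
    ∫ x, ∑ a, ‖S.conn σ x (coordGrad f a x)‖ ^ 2 ∂riemannianVolume n M =
      ∫ x, inner ℝ (S.dirac (S.dirac σ) x) (σ x) ∂riemannianVolume n M -
        pairing 𝕜 n (S.bochnerCurvature σ) σ := by
  rw [S.integral_sum_conn_sq hf hσ, S.pairing_eq hf (S.smooth_bochnerCurvature hf hσ) hσ,
    ← integral_neg, ← integral_sub (integrable_inner hf (S.smooth_dirac hf (S.smooth_dirac hf hσ))
      hσ) (integrable_inner hf (S.smooth_bochnerCurvature hf hσ) hσ)]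
  refine integral_congr_ae (Filter.Eventually.of_forall fun x ↦ ?_)
  simp only
  rw [S.dirac_dirac_eq hf hσ, inner_sub_left]
  ring

/-- The difference of the integrands is minus the divergence of `xₐ |σ|² Eₐ`. -/
theorem integral_inner_coordCommutator (hf : IsIsometricEmbedding (n := n) f) (a : Fin N)
    (hσ : SmoothSection n F σ) :
    ∫ x, inner ℝ (S.coordCommutator f a σ x) (f x a • σ x) ∂riemannianVolume n M =
      ∫ x, ‖coordGrad (n := n) f a x‖ ^ 2 * ‖σ x‖ ^ 2 ∂riemannianVolume n M := by
  have hfa : ContMDiff (𝓡 n) 𝓘(ℝ) ∞ (fun y ↦ f y a) :=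
    contMDiff_euclidean_apply hf.isSmoothEmbedding.contMDiff a
  have hi : Integrable (fun x ↦ ‖coordGrad (n := n) f a x‖ ^ 2 * ‖σ x‖ ^ 2)
      (riemannianVolume n M) := by
    simp only [← real_inner_self_eq_norm_sq]
    exact integrable_of_continuous hf
      ((contMDiff_inner_coordGrad hf a a).mul (hσ.inner_bundle hσ)).continuous
  rw [← sub_eq_zero, ← integral_sub (integrable_inner hf (S.smooth_coordCommutator hf a hσ)
    (τ := fun x ↦ f x a • σ x) (hfa.smul_section hσ)) hi, ← neg_eq_zero, ← integral_neg,
    ← integral_mvfderiv_coordGrad hf (hfa.mul (hσ.inner_bundle hσ)) a]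
  refine integral_congr_ae (Filter.Eventually.of_forall fun x ↦ ?_)
  have h1 : mvfderiv (𝓡 n) ((fun y ↦ f y a) * fun y ↦ inner ℝ (σ y) (σ y)) x (coordGrad f a x) =
      f x a * (inner ℝ (S.conn σ x (coordGrad f a x)) (σ x) +
        inner ℝ (σ x) (S.conn σ x (coordGrad f a x))) +
      inner ℝ (σ x) (σ x) * inner ℝ (coordGrad (n := n) f a x) (coordGrad f a x) := by
    rw [mvfderiv_mul (hfa.mdifferentiable (by simp) x)
      ((hσ.inner_bundle hσ).mdifferentiable (by simp) x)]
    simp only [add_apply, smul_apply, smul_eq_mul]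
    rw [S.mvfderiv_inner hσ hσ, ← inner_grad (fun y ↦ f y a), ← coordGrad.eq_1 f a x]
  simp only [h1]
  simp only [Pi.mul_apply, coordCommutator, inner_neg_left, inner_add_left,
    real_inner_smul_left, real_inner_smul_right, real_inner_self_eq_norm_sq,
    real_inner_comm (S.conn σ x (coordGrad f a x)) (σ x)]
  ring

end DiracBundle

end Dirac

/-! ### Yang's inequality for the square of the Dirac operator -/

section Dirac

variable {𝕜 : Type*} [RCLike 𝕜]
  {n : ℕ} {M : Type*} [TopologicalSpace M] [ChartedSpace (EuclideanSpace ℝ (Fin n)) M]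
  [IsManifold (𝓡 n) ∞ M]
  [RiemannianBundle (fun x : M ↦ TangentSpace (𝓡 n) x)]
  [IsContMDiffRiemannianBundle (𝓡 n) ∞ (EuclideanSpace ℝ (Fin n))
    (fun x : M ↦ TangentSpace (𝓡 n) x)]
  {F : Type*} [NormedAddCommGroup F] [NormedSpace ℝ F] [FiniteDimensional ℝ F]
  {V : M → Type*} [TopologicalSpace (TotalSpace F V)]
  [∀ x, NormedAddCommGroup (V x)] [∀ x, InnerProductSpace ℝ (V x)]
  [∀ x, InnerProductSpace 𝕜 (V x)]
  [FiberBundle F V] [VectorBundle ℝ F V] [ContMDiffVectorBundle ∞ F V (𝓡 n)]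
  [IsContMDiffRiemannianBundle (𝓡 n) ∞ F V]
  {N : ℕ} {f : M → EuclideanSpace ℝ (Fin N)}

namespace DiracBundle

variable (S : DiracBundle 𝕜 n F V)

/-- The `𝕜`-vector space of smooth sections. -/
def smoothSections : Submodule 𝕜 (Π x : M, V x) where
  carrier := {σ | SmoothSection n F σ}
  add_mem' hσ hτ := ContMDiff.add_section hσ hτ
  zero_mem' := contMDiff_zeroSection ℝ V
  smul_mem' a _ hσ := S.smooth_smul a hσ

theorem contMDiff_meanCurvature_sq (S : DiracBundle 𝕜 n F V)
    (hf : IsIsometricEmbedding (n := n) f) (hn : 0 < n) :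
    ContMDiff (𝓡 n) 𝓘(ℝ) ∞ (fun x : M ↦ meanCurvature (n := n) f x ^ 2) := by
  have h (x : M) : meanCurvature (n := n) f x ^ 2 =
      ((n : ℝ) ^ 2)⁻¹ * ∑ a, coordLap (n := n) f a x ^ 2 := by
    rw [← S.isLeviCivita_leviCivita.sq_mul_meanCurvature_sq hf hn,
      inv_mul_cancel_left₀ (by positivity)]
  rw [funext h]
  exact contMDiff_const.mul (contMDiff_finsetSum fun a _ ↦ (contMDiff_coordLap hf a).pow 2)

variable [CompactSpace M] [T2Space M] [MeasurableSpace M] [BorelSpace M]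

/-- The `L²` inner product on smooth sections. -/
abbrev l2Core (hf : IsIsometricEmbedding (n := n) f) :
    PreInnerProductSpace.Core 𝕜 S.smoothSections where
  inner σ τ := l2Inner 𝕜 n σ.1 τ.1
  conj_inner_symm σ τ := by
    rw [l2Inner, l2Inner, ← integral_conj]
    simp only [inner_conj_symm]
  re_inner_nonneg σ := by
    rw [l2Inner, ← integral_re (S.integrable_inner_rclike hf σ.2 σ.2)]
    exact integral_nonneg fun x ↦ inner_self_nonneg
  add_left σ τ ρ := by
    rw [l2Inner, l2Inner, l2Inner, ← integral_add (S.integrable_inner_rclike hf σ.2 ρ.2)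
      (S.integrable_inner_rclike hf τ.2 ρ.2)]
    simp only [Submodule.coe_add, Pi.add_apply, inner_add_left]
  smul_left σ τ a := by
    rw [l2Inner, l2Inner, ← integral_const_mul]
    simp only [Submodule.coe_smul, Pi.smul_apply, inner_smul_left]

/-- Pair `D²(xₐ σ)` with `τ` in two ways: by symmetry `D²` moves to `τ` and gives `s`, while the
commutator formula gives `r` plus the commutator. -/
theorem l2Inner_coordCommutator (hf : IsIsometricEmbedding (n := n) f) (a : Fin N)
    {σ τ : Π x : M, V x} (hσ : SmoothSection n F σ) (hτ : SmoothSection n F τ) {r s : ℝ}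
    (hr : ∀ x, S.dirac (S.dirac σ) x = r • σ x) (hs : ∀ x, S.dirac (S.dirac τ) x = s • τ x) :
    l2Inner 𝕜 n (S.coordCommutator f a σ) τ =
      ((s - r : ℝ) : 𝕜) * l2Inner 𝕜 n (fun x ↦ f x a • σ x) τ := by
  have hfa : ContMDiff (𝓡 n) 𝓘(ℝ) ∞ (fun y ↦ f y a) :=
    contMDiff_euclidean_apply hf.isSmoothEmbedding.contMDiff a
  have hψ : SmoothSection n F (fun x ↦ f x a • σ x) := hfa.smul_section hσ
  have hD {σ : Π x : M, V x} (hσ : SmoothSection n F σ) := S.smooth_dirac hf hσ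
  have h1 : l2Inner 𝕜 n (S.dirac (S.dirac fun x ↦ f x a • σ x)) τ =
      (s : 𝕜) * l2Inner 𝕜 n (fun x ↦ f x a • σ x) τ := by
    rw [S.l2Inner_dirac hf (hD hψ) hτ, S.l2Inner_dirac hf hψ (hD hτ), l2Inner, l2Inner,
      ← integral_const_mul]
    simp only [hs, inner_real_smul_right]
  have h2 : l2Inner 𝕜 n (S.dirac (S.dirac fun x ↦ f x a • σ x)) τ =
      (r : 𝕜) * l2Inner 𝕜 n (fun x ↦ f x a • σ x) τ +
        l2Inner 𝕜 n (S.coordCommutator f a σ) τ := by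
    rw [l2Inner, l2Inner, l2Inner, ← integral_const_mul,
      ← integral_add ((S.integrable_inner_rclike hf hψ hτ).const_mul _)
        (S.integrable_inner_rclike hf (S.smooth_coordCommutator hf a hσ) hτ)]
    refine integral_congr_ae (Filter.Eventually.of_forall fun x ↦ ?_)
    simp only
    rw [S.dirac_dirac_coord_smul hf hσ, hr, ← inner_real_smul_left, ← inner_add_left]
    congr 1
    rw [coordCommutator, smul_comm]
    abel
  rw [RCLike.ofReal_sub, sub_mul, ← h1, h2]
  ring

theorem yang_coord (hf : IsIsometricEmbedding (n := n) f) {lam : ℕ → ℝ}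
    {φ : ℕ → Cₛ^∞⟮𝓡 n; F, V⟯} (hφ : IsSpectralResolution S lam φ) (a : Fin N) (k : ℕ) :
    ∑ i ∈ Finset.range k, (lam k - lam i) ^ 2 *
        ∫ x, ‖coordGrad (n := n) f a x‖ ^ 2 * ‖φ i x‖ ^ 2 ∂riemannianVolume n M ≤
      ∑ i ∈ Finset.range k, (lam k - lam i) *
        ∫ x, ‖S.coordCommutator f a (φ i) x‖ ^ 2 ∂riemannianVolume n M := by
  have hfa : ContMDiff (𝓡 n) 𝓘(ℝ) ∞ (fun y ↦ f y a) :=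
    contMDiff_euclidean_apply hf.isSmoothEmbedding.contMDiff a
  -- A positive semidefinite form suffices here: the abstract inequality needs only a seminorm.
  let core := S.l2Core hf
  let _ : SeminormedAddCommGroup S.smoothSections :=
    InnerProductSpace.Core.toSeminormedAddCommGroup (𝕜 := 𝕜)
  let _ : InnerProductSpace 𝕜 S.smoothSections := InnerProductSpace.ofCore core
  let Φ (i : ℕ) : S.smoothSections := ⟨φ i, (φ i).contMDiff⟩
  let Ψ (i : ℕ) : S.smoothSections :=
    ⟨fun x ↦ f x a • φ i x, hfa.smul_section (φ i).contMDiff⟩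
  let C (i : ℕ) : S.smoothSections :=
    ⟨S.coordCommutator f a (φ i), S.smooth_coordCommutator hf a (φ i).contMDiff⟩
  have hin (σ τ : S.smoothSections) : inner 𝕜 σ τ = l2Inner 𝕜 n σ.1 τ.1 := rfl
  have hre (σ τ : S.smoothSections) : RCLike.re (inner 𝕜 σ τ) =
      ∫ x, inner ℝ (σ.1 x) (τ.1 x) ∂riemannianVolume n M := S.pairing_eq hf σ.2 τ.2
  have hortho : Orthonormal 𝕜 Φ := by
    rw [orthonormal_iff_ite]
    exact hφ.orthonormal
  -- The topology is named because a submodule of a product of fibres also carries the topology of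
  -- pointwise convergence.
  have hdense : @Dense S.smoothSections PseudoMetricSpace.toUniformSpace.toTopologicalSpace
      (Submodule.span 𝕜 (Set.range Φ)) := by
    rw [Metric.dense_iff]
    intro σ r hr
    obtain ⟨s, b, hb⟩ := hφ.complete ⟨σ.1, σ.2⟩ (r ^ 2) (by positivity)
    refine ⟨∑ j ∈ s, b j • Φ j, ?_, Submodule.sum_mem _ fun j _ ↦
      Submodule.smul_mem _ _ (Submodule.subset_span ⟨j, rfl⟩)⟩
    rw [Metric.mem_ball, dist_comm, dist_eq_norm]
    refine lt_of_pow_lt_pow_left₀ 2 hr.le ?_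
    rw [← inner_self_eq_norm_sq (𝕜 := 𝕜), hre]
    refine lt_of_eq_of_lt (integral_congr_ae (Filter.Eventually.of_forall fun x ↦ ?_)) hb
    simp [Φ]
    rfl
  have key := sum_sq_mul_re_inner_le hortho hdense hφ.monotone (ψ := Ψ) (c := C) (fun i j ↦ ?_)
    (fun i j ↦ S.l2Inner_coordCommutator hf a (φ i).contMDiff (φ j).contMDiff (hφ.eigen i)
      (hφ.eigen j)) k
  · have h1 (i) : ∫ x, inner ℝ ((C i).1 x) ((Ψ i).1 x) ∂riemannianVolume n M = _ :=
      S.integral_inner_coordCommutator hf a (φ i).contMDiff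
    simpa only [hre, h1, real_inner_self_eq_norm_sq] using key
  · rw [hin, hin]
    simp only [l2Inner, Ψ, Φ, inner_real_smul_left, inner_real_smul_right]

theorem yang (hf : IsIsometricEmbedding (n := n) f) (hn : 0 < n) {lam : ℕ → ℝ}
    {φ : ℕ → Cₛ^∞⟮𝓡 n; F, V⟯} (hφ : IsSpectralResolution S lam φ) (k : ℕ) :
    n * ∑ i ∈ Finset.range k, (lam k - lam i) ^ 2 ≤
      ∑ i ∈ Finset.range k, (lam k - lam i) * (4 * lam i +
        ((n : ℝ) ^ 2 * pairing 𝕜 n (fun x ↦ meanCurvature (n := n) f x ^ 2 • φ i x) (φ i) -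
          4 * pairing 𝕜 n (S.bochnerCurvature (φ i)) (φ i))) := by
  have hs (i) : SmoothSection n F (φ i) := (φ i).contMDiff
  have hnorm (i) : ∫ x, ‖φ i x‖ ^ 2 ∂riemannianVolume n M = 1 := by
    have h := S.pairing_eq hf (hs i) (hs i)
    rw [pairing, hφ.orthonormal, if_pos rfl, RCLike.one_re] at h
    simpa only [real_inner_self_eq_norm_sq] using h.symm
  have hlap : ContMDiff (𝓡 n) 𝓘(ℝ) ∞ (fun x ↦ ∑ a, coordLap (n := n) f a x ^ 2) :=
    contMDiff_finsetSum fun a _ ↦ (contMDiff_coordLap hf a).pow 2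
  have hH := S.contMDiff_meanCurvature_sq hf hn
  have hint {σ : Π x : M, V x} (hσ : SmoothSection n F σ) :
      Integrable (fun x ↦ ‖σ x‖ ^ 2) (riemannianVolume n M) := by
    simpa only [real_inner_self_eq_norm_sq] using integrable_inner hf hσ hσ
  have h1 (i) : ∑ a, ∫ x, ‖coordGrad (n := n) f a x‖ ^ 2 * ‖φ i x‖ ^ 2 ∂riemannianVolume n M =
      n := by
    rw [← integral_finsetSum]
    · simp only [← Finset.sum_mul, sum_norm_coordGrad_sq hf]
      rw [integral_const_mul, hnorm, mul_one]
    · intro a _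
      simp only [← real_inner_self_eq_norm_sq]
      exact integrable_of_continuous hf
        ((contMDiff_inner_coordGrad hf a a).mul ((hs i).inner_bundle (hs i))).continuous
  have h2 (i) : ∑ a, ∫ x, ‖S.coordCommutator f a (φ i) x‖ ^ 2 ∂riemannianVolume n M =
      4 * lam i +
        ((n : ℝ) ^ 2 * pairing 𝕜 n (fun x ↦ meanCurvature (n := n) f x ^ 2 • φ i x) (φ i) -
          4 * pairing 𝕜 n (S.bochnerCurvature (φ i)) (φ i)) := by
    have h3 : ∫ x, inner ℝ (S.dirac (S.dirac (φ i)) x) (φ i x) ∂riemannianVolume n M = lam i := by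
      simp only [hφ.eigen, real_inner_smul_left, real_inner_self_eq_norm_sq]
      rw [integral_const_mul, hnorm, mul_one]
    have h4 := S.integral_sum_conn_sq_eq hf (hs i)
    rw [← integral_finsetSum _ fun a _ ↦ hint (S.smooth_coordCommutator hf a (hs i))]
    simp only [S.sum_norm_coordCommutator_sq hf]
    rw [integral_add, integral_const_mul, h4, h3,
      S.pairing_eq hf (σ := fun x ↦ meanCurvature (n := n) f x ^ 2 • φ i x)
        (hH.smul_section (hs i)) (hs i), ← integral_const_mul]
    · simp only [real_inner_smul_left, real_inner_self_eq_norm_sq, ← mul_assoc,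
        S.isLeviCivita_leviCivita.sq_mul_meanCurvature_sq hf hn]
      ring
    · exact (integrable_finsetSum _ fun a _ ↦
        hint (S.smooth_conn (contMDiff_coordGrad hf a) (hs i))).const_mul _
    · simp only [← real_inner_self_eq_norm_sq]
      exact integrable_of_continuous hf (hlap.mul ((hs i).inner_bundle (hs i))).continuous
  have key := Finset.sum_le_sum fun a (_ : a ∈ Finset.univ) ↦ S.yang_coord hf hφ a k
  rw [Finset.sum_comm, Finset.sum_comm (s := (Finset.univ : Finset (Fin N)))] at key
  simp only [← Finset.mul_sum, h1, h2] at key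
  rw [← Finset.sum_mul, mul_comm] at key
  exact key

/-- `H²` is continuous on a compact space, so the supremum is a genuine bound; for an unbounded
family `⨆` would be `0`. -/
theorem pairing_meanCurvature_le (S : DiracBundle 𝕜 n F V)
    (hf : IsIsometricEmbedding (n := n) f) (hn : 0 < n)
    {σ : Π x : M, V x} (hσ : SmoothSection n F σ) (h1 : pairing 𝕜 n σ σ = 1) :
    pairing 𝕜 n (fun x ↦ meanCurvature (n := n) f x ^ 2 • σ x) σ ≤
      ⨆ x : M, meanCurvature (n := n) f x ^ 2 := by
  have hH := S.contMDiff_meanCurvature_sq hf hn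
  have hb : BddAbove (Set.range fun x : M ↦ meanCurvature (n := n) f x ^ 2) :=
    (isCompact_range hH.continuous).bddAbove
  rw [S.pairing_eq hf hσ hσ] at h1
  rw [S.pairing_eq hf (σ := fun x ↦ meanCurvature (n := n) f x ^ 2 • σ x) (hH.smul_section hσ) hσ,
    ← mul_one (⨆ x : M, _), ← h1, ← integral_const_mul]
  refine integral_mono (integrable_inner hf (σ := fun x ↦ meanCurvature (n := n) f x ^ 2 • σ x)
    (hH.smul_section hσ) hσ) ((integrable_inner hf hσ hσ).const_mul _) fun x ↦ ?_
  simp only [real_inner_smul_left]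
  exact mul_le_mul_of_nonneg_right (le_ciSup hb x) real_inner_self_nonneg

end DiracBundle

end Dirac

end DiracYang

end

/-! ### The two inequalities -/

theorem theorem3p1 {𝕜 : Type*} [RCLike 𝕜] {n N : ℕ} (hn : 0 < n)
    {M : Type*} [TopologicalSpace M] [CompactSpace M] [T2Space M]
    [MeasurableSpace M] [BorelSpace M]
    [ChartedSpace (EuclideanSpace ℝ (Fin n)) M] [IsManifold (𝓡 n) ∞ M]
    [RiemannianBundle (fun x : M ↦ TangentSpace (𝓡 n) x)]
    [IsContMDiffRiemannianBundle (𝓡 n) ∞ (EuclideanSpace ℝ (Fin n))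
      (fun x : M ↦ TangentSpace (𝓡 n) x)]
    (f : M → EuclideanSpace ℝ (Fin N)) (hf : DiracYang.IsIsometricEmbedding (n := n) f)
    {F : Type*} [NormedAddCommGroup F] [NormedSpace ℝ F] [FiniteDimensional ℝ F]
    {V : M → Type*} [TopologicalSpace (TotalSpace F V)]
    [∀ x, NormedAddCommGroup (V x)] [∀ x, InnerProductSpace ℝ (V x)]
    [∀ x, InnerProductSpace 𝕜 (V x)]
    [FiberBundle F V] [VectorBundle ℝ F V] [ContMDiffVectorBundle ∞ F V (𝓡 n)]
    [IsContMDiffRiemannianBundle (𝓡 n) ∞ F V]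
    (S : DiracYang.DiracBundle 𝕜 n F V) (lam : ℕ → ℝ) (φ : ℕ → Cₛ^∞⟮𝓡 n; F, V⟯)
    (hφ : DiracYang.IsSpectralResolution S lam φ) :
    (∀ k : ℕ,
      ∑ i ∈ Finset.range k, (lam k - lam i) ^ 2 ≤
        4 / (n : ℝ) * ∑ i ∈ Finset.range k, (lam k - lam i) *
          (lam i + 1 / 4 *
            ((n : ℝ) ^ 2 *
                DiracYang.pairing 𝕜 n (fun x ↦ DiracYang.meanCurvature (n := n) f x ^ 2 • φ i x) (φ i) -
              4 * DiracYang.pairing 𝕜 n (S.bochnerCurvature (φ i)) (φ i)))) ∧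
    (∀ (k : ℕ) (R : ℝ),
      (∀ i < k, R ≤ DiracYang.pairing 𝕜 n (S.bochnerCurvature (φ i)) (φ i)) →
      ∀ η : ℕ → ℝ,
        (∀ i, η i = lam i + 1 / 4 * (n : ℝ) ^ 2 * (⨆ x : M, DiracYang.meanCurvature (n := n) f x ^ 2) - R) →
        ∑ i ∈ Finset.range k, (η k - η i) * (η k - (1 + 4 / (n : ℝ)) * η i) ≤ 0) := by
  have hn' : (0 : ℝ) < n := by exact_mod_cast hn
  have main (k : ℕ) : ∑ i ∈ Finset.range k, (lam k - lam i) ^ 2 ≤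
      4 / (n : ℝ) * ∑ i ∈ Finset.range k, (lam k - lam i) *
        (lam i + 1 / 4 *
          ((n : ℝ) ^ 2 *
              DiracYang.pairing 𝕜 n (fun x ↦ DiracYang.meanCurvature (n := n) f x ^ 2 • φ i x) (φ i) -
            4 * DiracYang.pairing 𝕜 n (S.bochnerCurvature (φ i)) (φ i))) := by
    refine le_of_mul_le_mul_left ((S.yang hf hn hφ k).trans_eq ?_) hn'
    rw [← mul_assoc, mul_div_cancel₀ _ hn'.ne', Finset.mul_sum]
    exact Finset.sum_congr rfl fun i _ ↦ by ring
  refine ⟨main, fun k R hR η hη ↦ ?_⟩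
  -- Indices start at `0`, so `lam k` is the eigenvalue numbered `k + 1`. Each bracket is at most `η
  -- i`, and the factors `lam k - lam i` are nonnegative.
  have h1 : ∑ i ∈ Finset.range k, (lam k - lam i) ^ 2 ≤
      4 / (n : ℝ) * ∑ i ∈ Finset.range k, (lam k - lam i) * η i := by
    refine (main k).trans (mul_le_mul_of_nonneg_left (Finset.sum_le_sum fun i hi ↦ ?_)
      (by positivity))
    have hik := Finset.mem_range.1 hi
    refine mul_le_mul_of_nonneg_left ?_ (sub_nonneg.2 (hφ.monotone hik.le))
    have hφi : DiracYang.pairing 𝕜 n (φ i) (φ i) = 1 := by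
      rw [DiracYang.pairing, hφ.orthonormal, if_pos rfl, RCLike.one_re]
    have h2 := mul_le_mul_of_nonneg_left
      (S.pairing_meanCurvature_le hf hn (φ i).contMDiff hφi) (sq_nonneg (n : ℝ))
    have h3 := hR i hik
    rw [hη]
    linarith
  rw [Finset.mul_sum, ← sub_nonpos, ← Finset.sum_sub_distrib] at h1
  refine le_trans (le_of_eq (Finset.sum_congr rfl fun i _ ↦ ?_)) h1
  -- The shift from `lam` to `η` is constant, so differences agree, and `(η k - η i)² - (4/n)(η k -
  -- η i) η i` factors as required.
  have h4 : lam k - lam i = η k - η i := by rw [hη, hη]; ring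
  rw [h4]
  ring
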